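/- **Theorem 2.4.** Let $G$ be a connected real finite-dimensional Lie group with unit $\epsilon$ and Lie algebra $\mathcal G=T_\epsilon G$, and let $\omega^+$ be a left-invariant symplectic form on $G$ (a closed nondegenerate 2-form), with value $\omega$ at $\epsilon$. For $x\in\mathcal G$ let $x^+$ and $x^-$ be the left- and the right-invariant vector field on $G$ with value $x$ at $\epsilon$, and let $\nabla^+$ be the linear connection on $G$ determined by $\omega^+(\nabla^+_{x^+}y^+,z^+)=-\omega^+(y^+,[x^+,z^+])$ for all $x,y,z\in\mathcal G$. Let $H\neq\{\epsilon\}$ be a connected normal (immersed, not necessarily closed) Lie subgroup of $G$ with Lie algebra $L(H)$, and suppose that the action $L_H$ of $H$ on $G$ by left translations is Hamiltonian: there is a smooth map $J:G\to L(H)^*$ such that $dJ_x=i(x^-)\omega^+$ for every $x\in L(H)$, where $J_x(\sigma)=J(\sigma)(x)$. Then $\nabla^+$ is a left-invariant affine structure on $G$ (a left-invariant smooth torsion-free flat connection), there is a unique connected Lie subgroup $H^\perp$ of $G$ with Lie algebra $L(H)^\perp=\{v\in\mathcal G:\ \omega(v,x)=0 \text{ for all } x\in L(H)\}$, and: 1.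 $H^\perp$ is closed in $G$ (so, with the subspace topology, it is an embedded Lie subgroup), and it is an affine subgroup of $(G,\nabla^+)$: it carries a left-invariant affine structure for which the inclusion $H^\perp\to G$ is an affine map. 2. The homogeneous manifold $G/H^\perp$ of left cosets, with the smooth structure for which the projection $G\to G/H^\perp$ is a smooth submersion, has a commutative parallelism, that is, a global smooth frame $X_1,\dots,X_r$ of its tangent bundle with $[X_i,X_j]=0$ for all $i,j$. The connection for which all the $X_i$ are parallel is an affine structure (smooth, torsion free and flat) on $G/H^\perp$, and the projection $G\to G/H^\perp$ is an affine map from $(G,\nabla^+)$ to it. Here a smooth map $f$ between manifolds with linear connections $\nabla$ and $\nabla'$ is affine if $df(\nabla_uY)=(f^*\nabla')_u(df\,Y)$ for all vector fields $Y$ and tangent vectors $u$ on the source. -/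

import Mathlib

open Bundle VectorField
open scoped Manifold ContDiff Topology

namespace SympLie

universe u

noncomputable section

/-! ### Affine structures and affine maps -/

section Affine

variable {E : Type*} [NormedAddCommGroup E] [NormedSpace ℝ E]
  {M : Type*} [TopologicalSpace M] [ChartedSpace E M] [IsManifold 𝓘(ℝ, E) ∞ M]
  {E' : Type*} [NormedAddCommGroup E'] [NormedSpace ℝ E']
  {M' : Type*} [TopologicalSpace M'] [ChartedSpace E' M'] [IsManifold 𝓘(ℝ, E') ∞ M']

/-- A smooth vector field on the manifold `M`. -/
def IsSmoothField (X : Π x : M, TangentSpace 𝓘(ℝ, E) x) : Prop :=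
  ContMDiff 𝓘(ℝ, E) 𝓘(ℝ, E).tangent ∞ (fun x ↦ (⟨x, X x⟩ : TangentBundle 𝓘(ℝ, E) M))

/-- The type of operators `∇` on vector fields; `cov Y x v` is `(∇_v Y)(x)` for `v` tangent
at `x`. -/
abbrev FieldOperator (E : Type*) [NormedAddCommGroup E] [NormedSpace ℝ E]
    (M : Type*) [TopologicalSpace M] [ChartedSpace E M] : Type _ :=
  (Π x : M, TangentSpace 𝓘(ℝ, E) x) →
    (Π x : M, TangentSpace 𝓘(ℝ, E) x →L[ℝ] TangentSpace 𝓘(ℝ, E) x)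

/-- An affine structure on `M`, given as a smooth linear connection on the tangent bundle which is
torsion free and flat. -/
structure IsAffineStructure (cov : FieldOperator E M) : Prop where
  isCovariantDerivative : IsCovariantDerivativeOn E cov Set.univ
  contMDiff : ∀ X Y : Π x : M, TangentSpace 𝓘(ℝ, E) x, IsSmoothField X → IsSmoothField Y →
    IsSmoothField (fun x ↦ cov Y x (X x))
  torsion_free : ∀ X Y : Π x : M, TangentSpace 𝓘(ℝ, E) x, IsSmoothField X → IsSmoothField Y →
    ∀ x, cov Y x (X x) - cov X x (Y x) = mlieBracket 𝓘(ℝ, E) X Y x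
  flat : ∀ X Y Z : Π x : M, TangentSpace 𝓘(ℝ, E) x,
    IsSmoothField X → IsSmoothField Y → IsSmoothField Z →
    ∀ x, cov (fun p ↦ cov Z p (Y p)) x (X x) - cov (fun p ↦ cov Z p (X p)) x (Y x)
      - cov Z x (mlieBracket 𝓘(ℝ, E) X Y x) = 0

/-- A smooth map `f : M → M'` is affine for the connections `cov` and `cov'` if `∇(df) = 0`, that
is `df (∇_u Y) = (f^*∇')_u (df Y)` for all vector fields `Y`, where `f^*∇'` is the pulled back
connection on `f^*TM'`: if `df Y = ∑ a i • (Z i ∘ f)` near `m`, then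
`(f^*∇')_u (df Y) = ∑ (a i • ∇'_{df u} (Z i) + (u (a i)) • Z i (f m))`. -/
structure IsAffineMap (cov : FieldOperator E M) (cov' : FieldOperator E' M') (f : M → M') :
    Prop where
  contMDiff : ContMDiff 𝓘(ℝ, E) 𝓘(ℝ, E') ∞ f
  map_cov : ∀ (Y : Π x : M, TangentSpace 𝓘(ℝ, E) x) (n : ℕ)
    (Z : Fin n → Π y : M', TangentSpace 𝓘(ℝ, E') y) (a : Fin n → M → ℝ),
    IsSmoothField Y → (∀ i, IsSmoothField (Z i)) → (∀ i, ContMDiff 𝓘(ℝ, E) 𝓘(ℝ, ℝ) ∞ (a i)) →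
    ∀ m : M,
      (∀ᶠ p in 𝓝 m, mfderiv 𝓘(ℝ, E) 𝓘(ℝ, E') f p (Y p) = ∑ i, a i p • Z i (f p)) →
      ∀ u : TangentSpace 𝓘(ℝ, E) m,
        mfderiv 𝓘(ℝ, E) 𝓘(ℝ, E') f m (cov Y m u) =
          ∑ i, (a i m • cov' (Z i) (f m) (mfderiv 𝓘(ℝ, E) 𝓘(ℝ, E') f m u)
            + mvfderiv 𝓘(ℝ, E) (a i) m u • Z i (f m))

/-- A commutative parallelism: a global smooth frame of the tangent bundle made of pairwise
commuting vector fields. -/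
structure IsCommutativeParallelism {ι : Type*} (X : ι → Π x : M, TangentSpace 𝓘(ℝ, E) x) :
    Prop where
  contMDiff : ∀ i, IsSmoothField (X i)
  linearIndependent : ∀ x, LinearIndependent ℝ (fun i ↦ X i x)
  span_eq_top : ∀ x, Submodule.span ℝ (Set.range (fun i ↦ X i x)) = ⊤
  commute : ∀ i j x, mlieBracket 𝓘(ℝ, E) (X i) (X j) x = 0

/-- A symplectic form on `M`: a smooth, nondegenerate 2-form `Ω` with `dΩ = 0`. -/
structure SymplecticForm (E : Type*) [NormedAddCommGroup E] [NormedSpace ℝ E]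
    (M : Type*) [TopologicalSpace M] [ChartedSpace E M] [IsManifold 𝓘(ℝ, E) ∞ M] where
  toFun : Π x : M, TangentSpace 𝓘(ℝ, E) x →L[ℝ] TangentSpace 𝓘(ℝ, E) x →L[ℝ] ℝ
  contMDiff : ∀ X Y : Π x : M, TangentSpace 𝓘(ℝ, E) x, IsSmoothField X → IsSmoothField Y →
    ContMDiff 𝓘(ℝ, E) 𝓘(ℝ, ℝ) ∞ (fun x ↦ toFun x (X x) (Y x))
  alternating : ∀ x v, toFun x v v = 0
  nondegenerate : ∀ x v, (∀ w, toFun x v w = 0) → v = 0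
  closed : ∀ X Y Z : Π x : M, TangentSpace 𝓘(ℝ, E) x,
    IsSmoothField X → IsSmoothField Y → IsSmoothField Z → ∀ x,
      mvfderiv 𝓘(ℝ, E) (fun p ↦ toFun p (Y p) (Z p)) x (X x)
        - mvfderiv 𝓘(ℝ, E) (fun p ↦ toFun p (X p) (Z p)) x (Y x)
        + mvfderiv 𝓘(ℝ, E) (fun p ↦ toFun p (X p) (Y p)) x (Z x)
        - toFun x (mlieBracket 𝓘(ℝ, E) X Y x) (Z x)
        + toFun x (mlieBracket 𝓘(ℝ, E) X Z x) (Y x)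
        - toFun x (mlieBracket 𝓘(ℝ, E) Y Z x) (X x) = 0

end Affine

/-! ### Lie groups -/

section Group

variable {E : Type*} [NormedAddCommGroup E] [NormedSpace ℝ E]
  {G : Type u} [TopologicalSpace G] [ChartedSpace E G] [Group G]
  [LieGroup 𝓘(ℝ, E) ∞ G]

/-- The 2-form is invariant under all left translations. -/
def SymplecticForm.IsLeftInvariant (Ω : SymplecticForm E G) : Prop :=
  ∀ (g σ : G) (v w : TangentSpace 𝓘(ℝ, E) σ),
    Ω.toFun (g * σ) (mfderiv 𝓘(ℝ, E) 𝓘(ℝ, E) (g * ·) σ v)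
      (mfderiv 𝓘(ℝ, E) 𝓘(ℝ, E) (g * ·) σ w) = Ω.toFun σ v w

/-- An operator on vector fields is left invariant if left translations are affine for it. -/
def IsLeftInvariantConnection (cov : FieldOperator E G) : Prop :=
  ∀ g : G, IsAffineMap cov cov (g * ·)

/-- The fundamental vector field of the action by left translations: the right invariant vector
field `x⁻` with value `x` at the unit. -/
def rightField (x : GroupLieAlgebra 𝓘(ℝ, E) G) (σ : G) : TangentSpace 𝓘(ℝ, E) σ :=
  mfderiv 𝓘(ℝ, E) 𝓘(ℝ, E) (fun τ : G ↦ τ * σ) (1 : G) x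

/-- `K` is (the underlying group of) a connected, immersed Lie subgroup of `G`
with Lie algebra `𝔨`. -/
def IsConnectedLieSubgroup (K : Subgroup G) (𝔨 : Submodule ℝ (GroupLieAlgebra 𝓘(ℝ, E) G)) :
    Prop :=
  ∃ (k : ℕ) (N : Type u) (_ : TopologicalSpace N)
    (_ : ChartedSpace (EuclideanSpace ℝ (Fin k)) N) (_ : Group N)
    (_ : LieGroup 𝓘(ℝ, EuclideanSpace ℝ (Fin k)) ∞ N) (j : N →* G),
    ConnectedSpace N ∧ Function.Injective j ∧ j.range = K ∧
    ContMDiff 𝓘(ℝ, EuclideanSpace ℝ (Fin k)) 𝓘(ℝ, E) ∞ j ∧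
    (∀ n : N, Function.Injective (mfderiv 𝓘(ℝ, EuclideanSpace ℝ (Fin k)) 𝓘(ℝ, E) j n)) ∧
    ∀ v : GroupLieAlgebra 𝓘(ℝ, E) G, v ∈ 𝔨 ↔
      ∃ w : GroupLieAlgebra 𝓘(ℝ, EuclideanSpace ℝ (Fin k)) N,
        mfderiv 𝓘(ℝ, EuclideanSpace ℝ (Fin k)) 𝓘(ℝ, E) j (1 : N) w = v

/-- The orthogonal of `𝔥` in the Lie algebra, for the value of the form at the unit. -/
def orthogonal (Ω : SymplecticForm E G)
    (𝔥 : Submodule ℝ (GroupLieAlgebra 𝓘(ℝ, E) G)) :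
    Submodule ℝ (GroupLieAlgebra 𝓘(ℝ, E) G) where
  carrier := {v | ∀ x ∈ 𝔥, Ω.toFun 1 v x = 0}
  add_mem' {v w} hv hw x hx := by
    simp only [Set.mem_ofPred_eq] at hv hw
    rw [map_add, add_apply, hv x hx, hw x hx, add_zero]
  zero_mem' x _ := by rw [map_zero, zero_apply]
  smul_mem' c v hv x hx := by
    simp only [Set.mem_ofPred_eq] at hv
    rw [map_smul, smul_apply, hv x hx, smul_zero]

/-- `J` is a momentum map for the action by left translations of the Lie subgroup with Lie algebra
`𝔥`: it is smooth (i.e. all its components `J_x` are) and `d J_x = i(x⁻) Ω` for all `x ∈ 𝔥`. -/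
def IsMomentumMap (Ω : SymplecticForm E G)
    (𝔥 : Submodule ℝ (GroupLieAlgebra 𝓘(ℝ, E) G)) (J : G → Module.Dual ℝ 𝔥) : Prop :=
  ∀ x : 𝔥, ContMDiff 𝓘(ℝ, E) 𝓘(ℝ, ℝ) ∞ (fun σ ↦ J σ x) ∧
    ∀ (σ : G) (v : TangentSpace 𝓘(ℝ, E) σ),
      mvfderiv 𝓘(ℝ, E) (fun τ ↦ J τ x) σ v
        = Ω.toFun σ (rightField (x : GroupLieAlgebra 𝓘(ℝ, E) G) σ) v

/-- The action by left translations of the Lie subgroup with Lie algebra `𝔥` is Hamiltonian. -/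
def IsHamiltonian (Ω : SymplecticForm E G)
    (𝔥 : Submodule ℝ (GroupLieAlgebra 𝓘(ℝ, E) G)) : Prop :=
  ∃ J : G → Module.Dual ℝ 𝔥, IsMomentumMap Ω 𝔥 J

/-! ### The canonical connection of a symplectic Lie group -/

/-- Left translation of tangent vectors at `σ` to the unit, valued in the Lie algebra
(whose underlying space is the model space `E`). -/
def toLieAlgebra (σ : G) : TangentSpace 𝓘(ℝ, E) σ →L[ℝ] E :=
  mfderiv 𝓘(ℝ, E) 𝓘(ℝ, E) (σ⁻¹ * ·) σ

/-- Left translation of elements of the Lie algebra (whose underlying space is `E`) to `σ`. -/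
def ofLieAlgebra (σ : G) : E →L[ℝ] TangentSpace 𝓘(ℝ, E) σ :=
  mfderiv 𝓘(ℝ, E) 𝓘(ℝ, E) (σ * ·) (1 : G)

lemma toLieAlgebra_mulInvariantVectorField (x : GroupLieAlgebra 𝓘(ℝ, E) G) (σ : G) :
    toLieAlgebra σ (mulInvariantVectorField x σ) = x := by
  have h1 : (fun τ : G ↦ σ⁻¹ * τ) ∘ (fun τ ↦ σ * τ) = id := by ext; simp
  have h2 := mfderiv_comp (I := 𝓘(ℝ, E)) (I' := 𝓘(ℝ, E)) (I'' := 𝓘(ℝ, E)) (1 : G)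
    (g := fun τ : G ↦ σ⁻¹ * τ) (f := fun τ : G ↦ σ * τ)
    ((contMDiff_mul_left (n := ∞)).mdifferentiable (by simp) _)
    ((contMDiff_mul_left (n := ∞)).mdifferentiable (by simp) _)
  rw [h1, mfderiv_id] at h2
  have h3 := DFunLike.congr_fun h2 x
  have h4 : ∀ ρ, ρ = σ → mfderiv 𝓘(ℝ, E) 𝓘(ℝ, E) (fun τ : G ↦ σ⁻¹ * τ) ρ
      (mfderiv 𝓘(ℝ, E) 𝓘(ℝ, E) (fun τ : G ↦ σ * τ) 1 x : E) =
      (mfderiv 𝓘(ℝ, E) 𝓘(ℝ, E) (fun τ : G ↦ σ⁻¹ * τ) σ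
      (mfderiv 𝓘(ℝ, E) 𝓘(ℝ, E) (fun τ : G ↦ σ * τ) 1 x : E) : E) := by
    rintro _ rfl; rfl
  exact (h4 _ (mul_one σ)).symm.trans h3.symm

variable [FiniteDimensional ℝ E]

/-- The isomorphism `v ↦ Ω(v, ·)` from the Lie algebra to its dual. -/
def musical (Ω : SymplecticForm E G) :
    GroupLieAlgebra 𝓘(ℝ, E) G ≃ₗ[ℝ] Module.Dual ℝ (GroupLieAlgebra 𝓘(ℝ, E) G) :=
  haveI : FiniteDimensional ℝ (GroupLieAlgebra 𝓘(ℝ, E) G) :=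
    inferInstanceAs (FiniteDimensional ℝ E)
  LinearMap.linearEquivOfInjective
    { toFun := fun v ↦ (Ω.toFun 1 v).toLinearMap
      map_add' := fun v w ↦ by rw [map_add]; rfl
      map_smul' := fun c v ↦ by rw [map_smul]; rfl }
    (by
      rw [← LinearMap.ker_eq_bot, LinearMap.ker_eq_bot']
      intro v hv
      exact Ω.nondegenerate 1 v fun w ↦ LinearMap.congr_fun hv w)
    Subspace.dual_finrank_eq.symm

lemma musical_apply (Ω : SymplecticForm E G) (v w : GroupLieAlgebra 𝓘(ℝ, E) G) :
    musical Ω v w = Ω.toFun 1 v w := rfl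

/-- The linear map `z ↦ [x, z]` on the Lie algebra, linearly in `x`. -/
def adjointMap : GroupLieAlgebra 𝓘(ℝ, E) G →ₗ[ℝ]
    GroupLieAlgebra 𝓘(ℝ, E) G →ₗ[ℝ] GroupLieAlgebra 𝓘(ℝ, E) G :=
  haveI : LieGroup 𝓘(ℝ, E) (minSmoothness ℝ 3) G := 
    LieGroup.of_le (n := ∞) (by
      rw [minSmoothness_of_isRCLikeNormedField]; exact WithTop.coe_le_coe.2 le_top)
  haveI : CompleteSpace E := FiniteDimensional.complete ℝ E
  LinearMap.mk₂ ℝ (fun x z ↦ ⁅x, z⁆) add_lie smul_lie lie_add (fun c x z ↦ lie_smul c x z)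

/-- The left symmetric product: `leftSymProd Ω y x` is the element `xy` of the Lie algebra with
`Ω(xy, z) = -Ω(y, [x, z])` for all `z`. -/
def leftSymProd (Ω : SymplecticForm E G) (y : GroupLieAlgebra 𝓘(ℝ, E) G) :
    GroupLieAlgebra 𝓘(ℝ, E) G →ₗ[ℝ] GroupLieAlgebra 𝓘(ℝ, E) G :=
  (musical Ω).symm.toLinearMap ∘ₗ
    (-((musical Ω y).compRight ℝ) ∘ₗ adjointMap)

lemma leftSymProd_spec (Ω : SymplecticForm E G) (x y z : GroupLieAlgebra 𝓘(ℝ, E) G) :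
    Ω.toFun 1 (leftSymProd Ω y x) z = -Ω.toFun 1 y ⁅x, z⁆ := by
  rw [← musical_apply, ← musical_apply]
  simp [leftSymProd, adjointMap]

/-- The operator `x ↦ xy` of `leftSymProd` on the space `E` underlying the Lie algebra. -/
def leftSymOp (Ω : SymplecticForm E G) (y : E) : E →L[ℝ] E :=
  LinearMap.toContinuousLinearMap (show E →ₗ[ℝ] E from leftSymProd Ω y)

/-- The canonical connection `∇⁺` of a symplectic Lie group: with `Y` read as a Lie algebra valued
function through left translations, `∇_v Y` is the left translate of `dY(v) + vY`, where `vY` is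
the left symmetric product. It is the linear connection with
`Ω(∇_{x⁺} y⁺, z⁺) = -Ω(y⁺, [x⁺, z⁺])` for left invariant fields, see
`canonicalConnection_spec`. -/
def canonicalConnection (Ω : SymplecticForm E G) : FieldOperator E G :=
  fun Y σ ↦ ofLieAlgebra σ ∘L
    (mvfderiv 𝓘(ℝ, E) (fun τ : G ↦ toLieAlgebra τ (Y τ)) σ +
      leftSymOp Ω (toLieAlgebra σ (Y σ)) ∘L toLieAlgebra σ)

/-- On left invariant fields, `∇⁺_{x⁺} y⁺ = (xy)⁺`. -/
lemma canonicalConnection_leftInvariant (Ω : SymplecticForm E G)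
    (x y : GroupLieAlgebra 𝓘(ℝ, E) G) (σ : G) :
    canonicalConnection Ω (mulInvariantVectorField y) σ (mulInvariantVectorField x σ) =
      mulInvariantVectorField (leftSymProd Ω y x) σ := by
  obtain ⟨y', hy'⟩ : ∃ y' : E, y' = y := ⟨y, rfl⟩
  have hf : (fun τ : G ↦ toLieAlgebra τ (mulInvariantVectorField (I := 𝓘(ℝ, E)) y τ))
      = fun _ ↦ y' := funext fun τ ↦ (toLieAlgebra_mulInvariantVectorField y τ).trans hy'.symm
  have h0 : mvfderiv 𝓘(ℝ, E) (fun _ : G ↦ y') σ = 0 := by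
    unfold mvfderiv; rw [mfderiv_const]; ext; simp
  have hx : toLieAlgebra σ (mulInvariantVectorField x σ) = (show E from x) :=
    toLieAlgebra_mulInvariantVectorField x σ
  have hy : toLieAlgebra σ (mulInvariantVectorField y σ) = y' :=
    (toLieAlgebra_mulInvariantVectorField y σ).trans hy'.symm
  simp only [canonicalConnection]
  rw [hf, h0, zero_add, ContinuousLinearMap.comp_apply, ContinuousLinearMap.comp_apply, hy, hx]
  subst hy'
  rfl

/-- The formula `Ω(∇⁺_{x⁺} y⁺, z⁺) = -Ω(y⁺, [x⁺, z⁺])` for left invariant fields. -/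
lemma canonicalConnection_spec (Ω : SymplecticForm E G) (hΩ : Ω.IsLeftInvariant)
    (x y z : GroupLieAlgebra 𝓘(ℝ, E) G) (σ : G) :
    Ω.toFun σ (canonicalConnection Ω (mulInvariantVectorField y) σ (mulInvariantVectorField x σ))
        (mulInvariantVectorField z σ) =
      -Ω.toFun σ (mulInvariantVectorField y σ)
        (mlieBracket 𝓘(ℝ, E) (mulInvariantVectorField x) (mulInvariantVectorField z) σ) := by
  have _ : LieGroup 𝓘(ℝ, E) (minSmoothness ℝ 3) G :=
    LieGroup.of_le (n := ∞) (by
      rw [minSmoothness_of_isRCLikeNormedField]; exact WithTop.coe_le_coe.2 le_top)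
  have _ : CompleteSpace E := FiniteDimensional.complete ℝ E
  have key : ∀ a b : GroupLieAlgebra 𝓘(ℝ, E) G,
      Ω.toFun σ (mulInvariantVectorField a σ) (mulInvariantVectorField b σ) = Ω.toFun 1 a b := by
    intro a b
    rw [← hΩ σ 1 a b]
    have : ∀ ρ, ρ = σ → Ω.toFun σ (mulInvariantVectorField a σ) (mulInvariantVectorField b σ) =
      Ω.toFun ρ (mulInvariantVectorField a σ : E) (mulInvariantVectorField b σ : E) := by
        rintro _ rfl; rfl
    exact this _ (mul_one σ)
  rw [canonicalConnection_leftInvariant, ← mulInvariantVector_mlieBracket, key, key,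
    leftSymProd_spec, GroupLieAlgebra.bracket_def]

end Group

end

end SympLie

open SympLie

namespace SympLie

set_option linter.unusedSectionVars false

/-! In the left trivialization of `TG` the connection `∇⁺` has constant Christoffel symbols, given
by the product `xy` with `ω(xy, z) = -ω(y, [x, z])`. For such a connection (`frameConnection` over
an `IsCoframe`) the affine structure axioms become `xy - yx = [x, y]` and `x(yz) - y(xz) = [x, y]z`;
see `IsCoframe.isAffineStructure`. The first identity is closedness of `ω` on left-invariant fields,
the second is the Jacobi identity.

Normality of `H` makes its Lie algebra `𝔥` invariant under `Ad(G)`. As `H` is only immersed, this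
uses that conjugation is continuous for the intrinsic topology of `H`, a closed graph argument
(`continuous_of_comp_injective`). In a basis `b i` of `𝔥`, and normalized by `J 1 = 0`, the momentum
map satisfies `dJ_i(v) = ω(Ad(σ⁻¹) b_i, σ⁻¹v)`. By invariance of `𝔥`, the maps `τ ↦ J (g τ)` and `τ
↦ A_g (J τ) + J g` have the same derivative for a suitable linear `A_g`, so they agree on the
connected group `G` (`IsMomentum.exists_cocycle`). Hence the fibres of `J` are the left cosets of
the subgroup `K₀ = J⁻¹(0)`. Nondegeneracy makes `J` a submersion, with kernel `𝔥^⊥` at the unit. So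
`K₀` is closed, and `H^⊥` is its identity component: a slice chart makes this component a Lie group
(`exists_isSubgroupChart`, `IsSubgroupChart.exists_lieGroup`), while any connected Lie subgroup with
Lie algebra `𝔥^⊥` lies in it, because `J` is constant on it, and contains a neighbourhood of the
unit of it.

Since `𝔥` is an ideal, `ω(xy, z) = -ω(y, [x, z]) = 0` for `y ∈ 𝔥^⊥` and `z ∈ 𝔥`; so `𝔥^⊥` is closed
under the product and `∇⁺` restricts to `H^⊥`.

Near the unit `K₀` and `H^⊥` coincide, so `J` descends to a local homeomorphism `f : G/H^⊥ → ℝ^r`.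
Its restrictions are charts whose transition maps are identities; their coordinate fields form the
parallelism. The projection is affine because `J` has vanishing second covariant derivative for
`∇⁺`: the derivative of `Ad(σ⁻¹) x` along `u` is `-[u, Ad(σ⁻¹) x]`, and the definition of the
product turns this bracket into exactly the Christoffel term (`IsMomentum.exists_mvfderiv_eq`). -/

lemma natCast_le_infty (n : ℕ) : (n : ℕ∞ω) ≤ ∞ := by
  exact_mod_cast (le_top : (n : ℕ∞) ≤ ⊤)

lemma two_le_infty : (2 : ℕ∞ω) ≤ ∞ := natCast_le_infty 2

/-! ### Lie brackets of vector fields as commutators of derivations -/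

section Bracket

variable {E : Type*} [NormedAddCommGroup E] [NormedSpace ℝ E] [CompleteSpace E]
  {M : Type*} [TopologicalSpace M] [ChartedSpace E M] [IsManifold 𝓘(ℝ, E) ∞ M]
  {F : Type*} [NormedAddCommGroup F] [NormedSpace ℝ F]

/-- The vector field `V` is differentiable at `x`. -/
abbrev IsDiffFieldAt (V : Π x : M, TangentSpace 𝓘(ℝ, E) x) (x : M) : Prop :=
  MDifferentiableAt 𝓘(ℝ, E) 𝓘(ℝ, E).tangent (fun x ↦ (⟨x, V x⟩ : TangentBundle 𝓘(ℝ, E) M)) x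

lemma IsSmoothField.isDiffFieldAt {V : Π x : M, TangentSpace 𝓘(ℝ, E) x} (hV : IsSmoothField V)
    (x : M) : IsDiffFieldAt V x :=
  ContMDiff.mdifferentiable hV (by simp) x

lemma mvfderiv_congr {f g : M → F} {x : M} (h : f =ᶠ[𝓝 x] g) :
    mvfderiv 𝓘(ℝ, E) f x = mvfderiv 𝓘(ℝ, E) g x := by
  ext v
  have h2 : (mfderiv 𝓘(ℝ, E) 𝓘(ℝ, F) f x v : F) = mfderiv 𝓘(ℝ, E) 𝓘(ℝ, F) g x v := by
    rw [h.mfderiv_eq]; rfl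
  exact h2

lemma mvfderiv_comp_extChartAt {g : E → F} {x p : M} (hp : p ∈ (chartAt E x).source)
    (hg : DifferentiableAt ℝ g (extChartAt 𝓘(ℝ, E) x p)) (v : TangentSpace 𝓘(ℝ, E) p) :
    mvfderiv 𝓘(ℝ, E) (g ∘ extChartAt 𝓘(ℝ, E) x) p v =
      fderiv ℝ g (extChartAt 𝓘(ℝ, E) x p)
        (mfderiv 𝓘(ℝ, E) 𝓘(ℝ, E) (extChartAt 𝓘(ℝ, E) x) p v) := by
  have h1 := mfderiv_comp_apply (I := 𝓘(ℝ, E)) (I' := 𝓘(ℝ, E)) (I'' := 𝓘(ℝ, F)) p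
    hg.mdifferentiableAt
    (mdifferentiableAt_extChartAt (I := 𝓘(ℝ, E)) hp) v
  rw [mfderiv_eq_fderiv] at h1
  exact h1

/-- The inverse of the derivative of the inverse chart is the derivative of the chart. This links
the coordinate expression of a field, in which the bracket is computed, with the value of the field.
-/
lemma mpullbackWithin_extChartAt {x p : M} (hp : p ∈ (chartAt E x).source)
    (V : Π x : M, TangentSpace 𝓘(ℝ, E) x) :
    mpullbackWithin 𝓘(ℝ, E) 𝓘(ℝ, E) (extChartAt 𝓘(ℝ, E) x).symm V (Set.range 𝓘(ℝ, E))
      (extChartAt 𝓘(ℝ, E) x p) =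
      mfderiv 𝓘(ℝ, E) 𝓘(ℝ, E) (extChartAt 𝓘(ℝ, E) x) p (V p) := by
  have hs : p ∈ (extChartAt 𝓘(ℝ, E) x).source := by rwa [extChartAt_source]
  have hy := (extChartAt 𝓘(ℝ, E) x).map_source hs
  have h1 := mfderiv_extChartAt_comp_mfderivWithin_extChartAt_symm (I := 𝓘(ℝ, E)) hy
  have h2 := mfderivWithin_extChartAt_symm_comp_mfderiv_extChartAt (I := 𝓘(ℝ, E)) hy
  rw [mpullbackWithin_apply, ContinuousLinearMap.inverse_eq h2 h1]
  have : ∀ q, q = p → (mfderiv 𝓘(ℝ, E) 𝓘(ℝ, E) (extChartAt 𝓘(ℝ, E) x) q (V q) : E) =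
    mfderiv 𝓘(ℝ, E) 𝓘(ℝ, E) (extChartAt 𝓘(ℝ, E) x) p (V p) := by rintro _ rfl; rfl
  exact this _ ((extChartAt 𝓘(ℝ, E) x).left_inv hs)

lemma IsDiffFieldAt.differentiableAt_mpullbackWithin {V : Π x : M, TangentSpace 𝓘(ℝ, E) x} {x : M}
    (hV : IsDiffFieldAt V x) :
    DifferentiableAt ℝ (fun y ↦ (mpullbackWithin 𝓘(ℝ, E) 𝓘(ℝ, E) (extChartAt 𝓘(ℝ, E) x).symm V
        (Set.range 𝓘(ℝ, E)) y : E)) (extChartAt 𝓘(ℝ, E) x x) := by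
  have _ : IsManifold 𝓘(ℝ, E) 1 M := IsManifold.of_le (n := ∞) (by simp)
  have _ : IsManifold 𝓘(ℝ, E) 2 M := IsManifold.of_le (n := ∞) two_le_infty
  have := (mdifferentiableWithinAt_univ.2 hV).differentiableWithinAt_mpullbackWithin_vectorField
  rw [Set.preimage_univ, Set.univ_inter] at this
  exact differentiableWithinAt_univ.1 (by simpa only [modelWithCornersSelf_coe, Set.range_id]
    using this)

lemma eventuallyEq_comp_extChartAt (f : M → F) (x : M) :
    f =ᶠ[𝓝 x] (f ∘ (extChartAt 𝓘(ℝ, E) x).symm) ∘ extChartAt 𝓘(ℝ, E) x := by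
  filter_upwards [(chartAt E x).open_source.mem_nhds (mem_chart_source E x)] with p hp
  rw [Function.comp_apply, Function.comp_apply, (extChartAt 𝓘(ℝ, E) x).left_inv]
  rwa [extChartAt_source]

lemma _root_.ContMDiffAt.contDiffAt_comp_extChartAt_symm {f : M → F} {x : M}
    (hf : ContMDiffAt 𝓘(ℝ, E) 𝓘(ℝ, F) ∞ f x) :
    ContDiffAt ℝ ∞ (f ∘ (extChartAt 𝓘(ℝ, E) x).symm) (extChartAt 𝓘(ℝ, E) x x) := by
  have := (contMDiffAt_iff.1 hf).2
  rw [modelWithCornersSelf_coe, Set.range_id, contDiffWithinAt_univ] at this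
  exact this

/-- An equality near `x`, and not just at `x`, because the bracket formula differentiates this
function once more. -/
lemma mvfderiv_apply_eventuallyEq {f : M → F} {x : M} (hf : ContMDiffAt 𝓘(ℝ, E) 𝓘(ℝ, F) ∞ f x)
    (V : Π x : M, TangentSpace 𝓘(ℝ, E) x) :
    (fun p ↦ mvfderiv 𝓘(ℝ, E) f p (V p)) =ᶠ[𝓝 x]
      ((fun y ↦ fderiv ℝ (f ∘ (extChartAt 𝓘(ℝ, E) x).symm) y
        (mpullbackWithin 𝓘(ℝ, E) 𝓘(ℝ, E) (extChartAt 𝓘(ℝ, E) x).symm V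
          (Set.range 𝓘(ℝ, E)) y)) ∘ extChartAt 𝓘(ℝ, E) x) := by
  have _ : IsManifold 𝓘(ℝ, E) 1 M := IsManifold.of_le (n := ∞) (by simp)
  have hgd := (hf.contDiffAt_comp_extChartAt_symm.of_le two_le_infty).eventually (by simp)
  have hφc : ContinuousAt (extChartAt 𝓘(ℝ, E) x) x := continuousAt_extChartAt x
  filter_upwards [(chartAt E x).open_source.mem_nhds (mem_chart_source E x),
    (eventuallyEq_comp_extChartAt (E := E) f x).eventually_nhds, hφc.eventually hgd] with p hp hp2 hp3
  rw [mvfderiv_congr hp2, mvfderiv_comp_extChartAt hp (hp3.differentiableAt (by simp)),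
    Function.comp_apply, mpullbackWithin_extChartAt hp]

lemma differentiableAt_fderiv_mpullbackWithin {f : M → F} {x : M}
    (hf : ContMDiffAt 𝓘(ℝ, E) 𝓘(ℝ, F) ∞ f x)
    {V : Π x : M, TangentSpace 𝓘(ℝ, E) x} (hV : IsDiffFieldAt V x) :
    DifferentiableAt ℝ (fun y ↦ fderiv ℝ (f ∘ (extChartAt 𝓘(ℝ, E) x).symm) y
        (mpullbackWithin 𝓘(ℝ, E) 𝓘(ℝ, E) (extChartAt 𝓘(ℝ, E) x).symm V
          (Set.range 𝓘(ℝ, E)) y)) (extChartAt 𝓘(ℝ, E) x x) :=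
  ((hf.contDiffAt_comp_extChartAt_symm.fderiv_right (m := 1)
    (by norm_num; exact two_le_infty)).differentiableAt (by simp)).clm_apply
    hV.differentiableAt_mpullbackWithin

lemma mdifferentiableAt_mvfderiv_apply {f : M → F} {x : M}
    (hf : ContMDiffAt 𝓘(ℝ, E) 𝓘(ℝ, F) ∞ f x)
    {V : Π x : M, TangentSpace 𝓘(ℝ, E) x} (hV : IsDiffFieldAt V x) :
    MDifferentiableAt 𝓘(ℝ, E) 𝓘(ℝ, F) (fun p ↦ mvfderiv 𝓘(ℝ, E) f p (V p)) x := by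
  have _ : IsManifold 𝓘(ℝ, E) 1 M := IsManifold.of_le (n := ∞) (by simp)
  refine MDifferentiableAt.congr_of_eventuallyEq ?_ (mvfderiv_apply_eventuallyEq hf V)
  exact (differentiableAt_fderiv_mpullbackWithin hf hV).mdifferentiableAt.comp x
    (mdifferentiableAt_extChartAt (mem_chart_source E x))

/-- The derivative along a Lie bracket is the commutator of the derivatives. -/
lemma mvfderiv_mlieBracket {f : M → F} {x : M} (hf : ContMDiffAt 𝓘(ℝ, E) 𝓘(ℝ, F) ∞ f x)
    {V W : Π x : M, TangentSpace 𝓘(ℝ, E) x} (hV : IsDiffFieldAt V x) (hW : IsDiffFieldAt W x) :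
    mvfderiv 𝓘(ℝ, E) f x (mlieBracket 𝓘(ℝ, E) V W x) =
      mvfderiv 𝓘(ℝ, E) (fun p ↦ mvfderiv 𝓘(ℝ, E) f p (W p)) x (V x) -
        mvfderiv 𝓘(ℝ, E) (fun p ↦ mvfderiv 𝓘(ℝ, E) f p (V p)) x (W x) := by
  have _ : IsManifold 𝓘(ℝ, E) 1 M := IsManifold.of_le (n := ∞) (by simp)
  have hx := mem_chart_source E x
  have hgs := hf.contDiffAt_comp_extChartAt_symm
  have hfV := mvfderiv_apply_eventuallyEq hf
  have hfg := eventuallyEq_comp_extChartAt (E := E) f x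
  rw [mvfderiv_congr (hfV W), mvfderiv_congr (hfV V), mvfderiv_congr hfg,
    mvfderiv_comp_extChartAt hx (hgs.differentiableAt (by simp)),
    mvfderiv_comp_extChartAt hx (differentiableAt_fderiv_mpullbackWithin hf hV),
    mvfderiv_comp_extChartAt hx (differentiableAt_fderiv_mpullbackWithin hf hW),
    ← mpullbackWithin_extChartAt hx V, ← mpullbackWithin_extChartAt hx W]
  set φ := extChartAt 𝓘(ℝ, E) x with hφ
  set g : E → F := f ∘ φ.symm with hg
  -- The vector space version of the identity, for the coordinate expressions; what remains is to
  -- identify the image of the bracket under the chart.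
  have key := fderiv_apply_lieBracket (𝕜 := ℝ) (n := 2) (hgs.of_le two_le_infty)
    (by simp) hW.differentiableAt_mpullbackWithin hV.differentiableAt_mpullbackWithin
  refine Eq.trans (congrArg (fderiv ℝ g (φ x)) ?_) key
  have h3 : (mfderiv 𝓘(ℝ, E) 𝓘(ℝ, E) φ x).IsInvertible := isInvertible_mfderiv_extChartAt
    (mem_extChartAt_source x)
  have h4 := mlieBracketWithin_apply (I := 𝓘(ℝ, E)) (V := V) (W := W) (s := Set.univ) (x₀ := x)
  rw [mlieBracket, h4]
  rw [← hφ]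
  obtain ⟨e, he⟩ := h3
  have h5 : ∀ w, mfderiv 𝓘(ℝ, E) 𝓘(ℝ, E) φ x ((mfderiv 𝓘(ℝ, E) 𝓘(ℝ, E) φ x).inverse w) = w := by
    intro w
    rw [← he, ContinuousLinearMap.inverse_equiv]
    exact e.apply_symm_apply w
  refine (h5 _).trans ?_
  have h6 : φ.symm ⁻¹' Set.univ ∩ Set.range 𝓘(ℝ, E) = Set.univ := by simp
  rw [h6]
  exact congrFun (lieBracketWithin_univ (𝕜 := ℝ) (E := E)) _


/-- Allows an equality of tangent vectors, in particular of brackets, to be tested on one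
vector-valued function, the chart. -/
lemma injective_mvfderiv_extChartAt (x : M) :
    Function.Injective (mvfderiv 𝓘(ℝ, E) (extChartAt 𝓘(ℝ, E) x) x) := by
  have _ : IsManifold 𝓘(ℝ, E) 1 M := IsManifold.of_le (n := ∞) (by simp)
  exact (isInvertible_mfderiv_extChartAt (mem_extChartAt_source (I := 𝓘(ℝ, E)) x)).injective

variable {E' : Type*} [NormedAddCommGroup E'] [NormedSpace ℝ E'] [CompleteSpace E']
  {M' : Type*} [TopologicalSpace M'] [ChartedSpace E' M'] [IsManifold 𝓘(ℝ, E') ∞ M']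

/-- The Lie brackets of related vector fields are related. -/
lemma mfderiv_mlieBracket_of_related {f : M → M'} (hf : ContMDiff 𝓘(ℝ, E) 𝓘(ℝ, E') ∞ f) {m : M}
    {X Y : Π x : M, TangentSpace 𝓘(ℝ, E) x} {X' Y' : Π x : M', TangentSpace 𝓘(ℝ, E') x}
    (hX : IsDiffFieldAt X m) (hY : IsDiffFieldAt Y m)
    (hX' : IsDiffFieldAt X' (f m)) (hY' : IsDiffFieldAt Y' (f m))
    (hXX' : ∀ p, mfderiv 𝓘(ℝ, E) 𝓘(ℝ, E') f p (X p) = X' (f p))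
    (hYY' : ∀ p, mfderiv 𝓘(ℝ, E) 𝓘(ℝ, E') f p (Y p) = Y' (f p)) :
    mfderiv 𝓘(ℝ, E) 𝓘(ℝ, E') f m (mlieBracket 𝓘(ℝ, E) X Y m) =
      mlieBracket 𝓘(ℝ, E') X' Y' (f m) := by
  have _ : IsManifold 𝓘(ℝ, E') 1 M' := IsManifold.of_le (n := ∞) (by simp)
  -- Tested on the chart `h` at `f m`, brackets become commutators of derivatives, and derivatives
  -- along related fields correspond under composition with `f`.
  apply injective_mvfderiv_extChartAt (f m)
  set h : M' → E' := fun q ↦ extChartAt 𝓘(ℝ, E') (f m) q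
  have hfd : ∀ p, MDifferentiableAt 𝓘(ℝ, E) 𝓘(ℝ, E') f p := hf.mdifferentiable (by simp)
  have hh : ContMDiffAt 𝓘(ℝ, E') 𝓘(ℝ, E') ∞ h (f m) := contMDiffAt_extChartAt
  have hcomp : ∀ g : M' → E', ∀ p, MDifferentiableAt 𝓘(ℝ, E') 𝓘(ℝ, E') g (f p) →
      ∀ v : TangentSpace 𝓘(ℝ, E) p, mvfderiv 𝓘(ℝ, E) (g ∘ f) p v =
        mvfderiv 𝓘(ℝ, E') g (f p) (mfderiv 𝓘(ℝ, E) 𝓘(ℝ, E') f p v) :=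
    fun g p hg v ↦ mfderiv_comp_apply p hg (hfd p) v
  have hnear : ∀ (X : Π x : M, TangentSpace 𝓘(ℝ, E) x) (X' : Π x : M', TangentSpace 𝓘(ℝ, E') x),
      (∀ p, mfderiv 𝓘(ℝ, E) 𝓘(ℝ, E') f p (X p) = X' (f p)) →
      (fun p ↦ mvfderiv 𝓘(ℝ, E) (h ∘ f) p (X p)) =ᶠ[𝓝 m]
        (fun q ↦ mvfderiv 𝓘(ℝ, E') h q (X' q)) ∘ f := by
    intro X X' hXX'
    filter_upwards [hf.continuous.continuousAt.preimage_mem_nhds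
      ((chartAt E' (f m)).open_source.mem_nhds (mem_chart_source E' (f m)))] with p hp
    rw [hcomp h p (mdifferentiableAt_extChartAt hp), hXX', Function.comp_apply]
  rw [← hcomp h m (hh.mdifferentiableAt (by simp)),
    mvfderiv_mlieBracket (hh.comp m hf.contMDiffAt) hX hY, mvfderiv_mlieBracket hh hX' hY',
    mvfderiv_congr (hnear X X' hXX'), mvfderiv_congr (hnear Y Y' hYY'),
    hcomp _ m (mdifferentiableAt_mvfderiv_apply hh hX'),
    hcomp _ m (mdifferentiableAt_mvfderiv_apply hh hY'), hXX', hYY']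

lemma contMDiff_mvfderiv_apply {f : M → F} (hf : ContMDiff 𝓘(ℝ, E) 𝓘(ℝ, F) ∞ f)
    {V : Π x : M, TangentSpace 𝓘(ℝ, E) x} (hV : IsSmoothField V) :
    ContMDiff 𝓘(ℝ, E) 𝓘(ℝ, F) ∞ (fun p ↦ mvfderiv 𝓘(ℝ, E) f p (V p)) := by
  have _ : IsManifold 𝓘(ℝ, E) 1 M := IsManifold.of_le (n := ∞) (by simp)
  exact (contMDiff_snd_tangentBundle_modelSpace F 𝓘(ℝ, F)).comp
    ((hf.contMDiff_tangentMap (m := ∞) (by simp)).comp hV)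

end Bracket

/-! ### Connections with constant Christoffel symbols in a trivialization -/

section Coframe

variable {E : Type*} [NormedAddCommGroup E] [NormedSpace ℝ E] [CompleteSpace E]
  {M : Type*} [TopologicalSpace M] [ChartedSpace E M] [IsManifold 𝓘(ℝ, E) ∞ M]

lemma _root_.MDifferentiableAt.differentiableAt_comp_extChartAt_symm {F : Type*}
    [NormedAddCommGroup F] [NormedSpace ℝ F] {f : M → F} {x : M}
    (hf : MDifferentiableAt 𝓘(ℝ, E) 𝓘(ℝ, F) f x) :
    DifferentiableAt ℝ (f ∘ (extChartAt 𝓘(ℝ, E) x).symm) (extChartAt 𝓘(ℝ, E) x x) := by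
  have := hf.differentiableWithinAt_writtenInExtChartAt
  rw [modelWithCornersSelf_coe, Set.range_id, differentiableWithinAt_univ] at this
  exact this

lemma mvfderiv_eq_fderiv {F : Type*} [NormedAddCommGroup F] [NormedSpace ℝ F] {f : M → F} {x : M}
    (hf : MDifferentiableAt 𝓘(ℝ, E) 𝓘(ℝ, F) f x) (v : TangentSpace 𝓘(ℝ, E) x) :
    mvfderiv 𝓘(ℝ, E) f x v =
      fderiv ℝ (f ∘ (extChartAt 𝓘(ℝ, E) x).symm) (extChartAt 𝓘(ℝ, E) x x) v := by
  rw [MDifferentiableAt.mvfderiv hf, modelWithCornersSelf_coe, Set.range_id, fderivWithin_univ]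
  rfl

/-- A smooth trivialization `θ` of the tangent bundle of `M`, with inverse `ψ`, whose structure
equation is `dθ(X, Y) = -c(θ X, θ Y)` with a constant `c`. -/
structure IsCoframe (θ : Π x : M, TangentSpace 𝓘(ℝ, E) x →L[ℝ] E)
    (ψ : Π x : M, E →L[ℝ] TangentSpace 𝓘(ℝ, E) x) (c : E →L[ℝ] E →L[ℝ] E) : Prop where
  left_inv : ∀ x v, ψ x (θ x v) = v
  right_inv : ∀ x v, θ x (ψ x v) = v
  mdifferentiableAt : ∀ (Y : Π x : M, TangentSpace 𝓘(ℝ, E) x) (x : M), IsDiffFieldAt Y x →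
    MDifferentiableAt 𝓘(ℝ, E) 𝓘(ℝ, E) (fun x ↦ θ x (Y x)) x
  contMDiff : ∀ Y : Π x : M, TangentSpace 𝓘(ℝ, E) x, IsSmoothField Y →
    ContMDiff 𝓘(ℝ, E) 𝓘(ℝ, E) ∞ (fun x ↦ θ x (Y x))
  isSmoothField : ∀ y : M → E, ContMDiff 𝓘(ℝ, E) 𝓘(ℝ, E) ∞ y → IsSmoothField (fun x ↦ ψ x (y x))
  structure_equation : ∀ X Y : Π x : M, TangentSpace 𝓘(ℝ, E) x, IsSmoothField X → IsSmoothField Y →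
    ∀ x, mvfderiv 𝓘(ℝ, E) (fun x ↦ θ x (Y x)) x (X x) -
      mvfderiv 𝓘(ℝ, E) (fun x ↦ θ x (X x)) x (Y x) - θ x (mlieBracket 𝓘(ℝ, E) X Y x) =
      -c (θ x (X x)) (θ x (Y x))

/-- The connection whose Christoffel symbols in a trivialization of the tangent bundle are given by
the constant bilinear map `B`. -/
noncomputable def frameConnection (θ : Π x : M, TangentSpace 𝓘(ℝ, E) x →L[ℝ] E)
    (ψ : Π x : M, E →L[ℝ] TangentSpace 𝓘(ℝ, E) x) (B : E →L[ℝ] E →L[ℝ] E) : FieldOperator E M :=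
  fun Y x ↦ ψ x ∘L (mvfderiv 𝓘(ℝ, E) (fun τ : M ↦ θ τ (Y τ)) x + B (θ x (Y x)) ∘L θ x)

variable {θ : Π x : M, TangentSpace 𝓘(ℝ, E) x →L[ℝ] E}
  {ψ : Π x : M, E →L[ℝ] TangentSpace 𝓘(ℝ, E) x} {c : E →L[ℝ] E →L[ℝ] E}

lemma frameConnection_apply (B : E →L[ℝ] E →L[ℝ] E) (Y : Π x : M, TangentSpace 𝓘(ℝ, E) x) (x : M)
    (u : TangentSpace 𝓘(ℝ, E) x) :
    frameConnection θ ψ B Y x u =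
      ψ x (mvfderiv 𝓘(ℝ, E) (fun τ : M ↦ θ τ (Y τ)) x u + B (θ x (Y x)) (θ x u)) := rfl

lemma IsCoframe.coframe_frameConnection (h : IsCoframe θ ψ c) (B : E →L[ℝ] E →L[ℝ] E)
    (Y : Π x : M, TangentSpace 𝓘(ℝ, E) x) (x : M) (u : TangentSpace 𝓘(ℝ, E) x) :
    θ x (frameConnection θ ψ B Y x u) =
      mvfderiv 𝓘(ℝ, E) (fun τ : M ↦ θ τ (Y τ)) x u + B (θ x (Y x)) (θ x u) := by
  rw [frameConnection_apply, h.right_inv]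

lemma IsCoframe.injective (h : IsCoframe θ ψ c) (x : M) : Function.Injective (θ x) :=
  Function.LeftInverse.injective (h.left_inv x)

lemma IsCoframe.isCovariantDerivativeOn (h : IsCoframe θ ψ c) (B : E →L[ℝ] E →L[ℝ] E) :
    IsCovariantDerivativeOn E (frameConnection θ ψ B) Set.univ where
  add {σ σ' x} hσ hσ' _ := by
    ext u
    apply h.injective x
    have e : (fun τ : M ↦ θ τ ((σ + σ') τ)) =
      (fun τ : M ↦ θ τ (σ τ)) + (fun τ : M ↦ θ τ (σ' τ)) := by
      ext τ; exact map_add (θ τ) _ _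
    have e' : θ x ((σ + σ') x) = θ x (σ x) + θ x (σ' x) := map_add (θ x) _ _
    rw [add_apply, map_add, h.coframe_frameConnection,
      h.coframe_frameConnection, h.coframe_frameConnection, e, e',
      mvfderiv_add (h.mdifferentiableAt _ _ hσ) (h.mdifferentiableAt _ _ hσ'), map_add,
      add_apply, add_apply]
    abel
  leibniz {σ g x} hσ hg _ := by
    ext u
    apply h.injective x
    have e : (fun τ : M ↦ θ τ ((g • σ) τ)) = g • (fun τ : M ↦ θ τ (σ τ)) := by
      ext τ; exact map_smul (θ τ) _ _
    have e' : θ x ((g • σ) x) = g x • θ x (σ x) := map_smul (θ x) _ _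
    have e2 : θ x ((g x • frameConnection θ ψ B σ x + (mvfderiv 𝓘(ℝ, E) g x).smulRight (σ x)) u) =
      g x • θ x (frameConnection θ ψ B σ x u) + mvfderiv 𝓘(ℝ, E) g x u • θ x (σ x) := by
      exact (map_add (θ x) _ _).trans (congrArg₂ _ (map_smul (θ x) _ _) (map_smul (θ x) _ _))
    rw [e2, h.coframe_frameConnection, h.coframe_frameConnection, e, e',
      mvfderiv_smul hg (h.mdifferentiableAt _ _ hσ), map_smul]
    simp only [add_apply, smul_apply,
      ContinuousLinearMap.smulRight_apply, smul_add]
    abel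

lemma contMDiff_bilinear {y z : M → E} (B : E →L[ℝ] E →L[ℝ] E)
    (hy : ContMDiff 𝓘(ℝ, E) 𝓘(ℝ, E) ∞ y) (hz : ContMDiff 𝓘(ℝ, E) 𝓘(ℝ, E) ∞ z) :
    ContMDiff 𝓘(ℝ, E) 𝓘(ℝ, E) ∞ (fun x ↦ B (y x) (z x)) :=
  (B.contMDiff.comp hy).clm_apply hz

lemma mvfderiv_clm_apply {F F' : Type*} [NormedAddCommGroup F] [NormedSpace ℝ F]
    [NormedAddCommGroup F'] [NormedSpace ℝ F'] {T : M → F →L[ℝ] F'} {y : M → F} {x : M}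
    (hT : MDifferentiableAt 𝓘(ℝ, E) 𝓘(ℝ, F →L[ℝ] F') T x)
    (hy : MDifferentiableAt 𝓘(ℝ, E) 𝓘(ℝ, F) y x) (u : TangentSpace 𝓘(ℝ, E) x) :
    MDifferentiableAt 𝓘(ℝ, E) 𝓘(ℝ, F') (fun p ↦ T p (y p)) x ∧
    mvfderiv 𝓘(ℝ, E) (fun p ↦ T p (y p)) x u =
      mvfderiv 𝓘(ℝ, E) T x u (y x) + T x (mvfderiv 𝓘(ℝ, E) y x u) := by
  have hd : MDifferentiableAt 𝓘(ℝ, E) 𝓘(ℝ, F') (fun p ↦ T p (y p)) x :=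
    (isBoundedBilinearMap_apply.differentiableAt (T x, y x)).mdifferentiableAt.comp x
      (f := fun p ↦ (T p, y p)) (hT.prodMk_space hy)
  refine ⟨hd, ?_⟩
  have hx : (extChartAt 𝓘(ℝ, E) x).symm (extChartAt 𝓘(ℝ, E) x x) = x := extChartAt_to_inv x
  have h1 := hT.differentiableAt_comp_extChartAt_symm
  have h2 := hy.differentiableAt_comp_extChartAt_symm
  rw [mvfderiv_eq_fderiv hd, mvfderiv_eq_fderiv hT, mvfderiv_eq_fderiv hy]
  have h3 := congrArg (fun L ↦ L u) (fderiv_clm_apply h1 h2)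
  simp only [Function.comp_apply, hx] at h3
  refine h3.trans ?_
  rw [add_comm]
  rfl

lemma mvfderiv_bilinear {y z : M → E} (B : E →L[ℝ] E →L[ℝ] E) {x : M}
    (hy : MDifferentiableAt 𝓘(ℝ, E) 𝓘(ℝ, E) y x) (hz : MDifferentiableAt 𝓘(ℝ, E) 𝓘(ℝ, E) z x)
    (u : TangentSpace 𝓘(ℝ, E) x) :
    mvfderiv 𝓘(ℝ, E) (fun x ↦ B (y x) (z x)) x u =
      B (mvfderiv 𝓘(ℝ, E) y x u) (z x) + B (y x) (mvfderiv 𝓘(ℝ, E) z x u) := by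
  have hB : MDifferentiableAt 𝓘(ℝ, E) 𝓘(ℝ, E →L[ℝ] E) (B ∘ y) x :=
    B.differentiableAt.mdifferentiableAt.comp x hy
  have h1 : mvfderiv 𝓘(ℝ, E) (B ∘ y) x u = B (mvfderiv 𝓘(ℝ, E) y x u) := by
    have h2 := mfderiv_comp_apply x (B.differentiableAt (x := y x)).mdifferentiableAt hy u
    rw [mfderiv_eq_fderiv, ContinuousLinearMap.fderiv] at h2
    exact h2
  rw [← h1]
  exact (mvfderiv_clm_apply hB hz u).2

/-- The connection with constant Christoffel symbols is an affine structure under two algebraic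
conditions. -/
lemma IsCoframe.isAffineStructure (h : IsCoframe θ ψ c) (B : E →L[ℝ] E →L[ℝ] E)
    (htor : ∀ x y, B y x - B x y = c x y)
    (hflat : ∀ x y z, B (B z y) x - B (B z x) y = B z (c x y)) :
    IsAffineStructure (frameConnection θ ψ B : FieldOperator E M) where
  isCovariantDerivative := h.isCovariantDerivativeOn B
  contMDiff X Y hX hY := by
    refine h.isSmoothField _ ((contMDiff_mvfderiv_apply (h.contMDiff Y hY) hX).add ?_)
    exact contMDiff_bilinear B (h.contMDiff Y hY) (h.contMDiff X hX)
  torsion_free X Y hX hY x := by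
    apply h.injective x
    have h1 := h.structure_equation X Y hX hY x
    have h2 := htor (θ x (X x)) (θ x (Y x))
    rw [map_sub, h.coframe_frameConnection, h.coframe_frameConnection]
    rw [← h2, sub_eq_iff_eq_add] at h1
    rw [add_sub_add_comm, h1]
    abel
  flat X Y Z hX hY hZ x := by
    apply h.injective x
    have hsX := h.contMDiff X hX
    have hsY := h.contMDiff Y hY
    have hsZ := h.contMDiff Z hZ
    have hd : ∀ {y : M → E}, ContMDiff 𝓘(ℝ, E) 𝓘(ℝ, E) ∞ y →
      MDifferentiableAt 𝓘(ℝ, E) 𝓘(ℝ, E) y x := fun hy ↦ hy.mdifferentiable (by simp) x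
    have e : ∀ W : Π x : M, TangentSpace 𝓘(ℝ, E) x,
        (fun p ↦ θ p (frameConnection θ ψ B Z p (W p))) =
        (fun p ↦ mvfderiv 𝓘(ℝ, E) (fun τ : M ↦ θ τ (Z τ)) p (W p)) +
          fun p ↦ B (θ p (Z p)) (θ p (W p)) := by
      intro W; ext p; exact h.coframe_frameConnection B Z p (W p)
    have e2 : ∀ V W : Π x : M, TangentSpace 𝓘(ℝ, E) x, IsSmoothField V → IsSmoothField W →
        θ x (frameConnection θ ψ B (fun p ↦ frameConnection θ ψ B Z p (W p)) x (V x)) =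
        mvfderiv 𝓘(ℝ, E) (fun p ↦ mvfderiv 𝓘(ℝ, E) (fun τ : M ↦ θ τ (Z τ)) p (W p)) x (V x) +
        (B (mvfderiv 𝓘(ℝ, E) (fun τ : M ↦ θ τ (Z τ)) x (V x)) (θ x (W x)) +
          B (θ x (Z x)) (mvfderiv 𝓘(ℝ, E) (fun τ : M ↦ θ τ (W τ)) x (V x))) +
        (B (mvfderiv 𝓘(ℝ, E) (fun τ : M ↦ θ τ (Z τ)) x (W x)) (θ x (V x)) +
          B (B (θ x (Z x)) (θ x (W x))) (θ x (V x))) := by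
      intro V W hV hW
      rw [h.coframe_frameConnection, e, h.coframe_frameConnection,
        mvfderiv_add (hd (contMDiff_mvfderiv_apply hsZ hW))
          (hd (contMDiff_bilinear B hsZ (h.contMDiff W hW))),
        add_apply, mvfderiv_bilinear B (hd hsZ) (hd (h.contMDiff W hW)),
        map_add, add_apply]
    -- The second derivatives of `θ Z` cancel against `d(θ Z)` of the bracket, and the terms
    -- containing first derivatives of `θ Z` are symmetric in `X` and `Y`. The rest is `B (θ Z)`
    -- applied to the structure equation, together with `hflat`.
    rw [map_sub, map_sub, e2 X Y hX hY, e2 Y X hY hX, h.coframe_frameConnection, map_zero,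
      mvfderiv_mlieBracket hsZ.contMDiffAt (hX.isDiffFieldAt x) (hY.isDiffFieldAt x)]
    have h1 := h.structure_equation X Y hX hY x
    have h3 := congrArg (B (θ x (Z x))) h1
    rw [map_sub, map_sub, map_neg, ← hflat] at h3
    rw [← sub_eq_zero] at h3
    rw [← h3]
    abel

variable {E' : Type*} [NormedAddCommGroup E'] [NormedSpace ℝ E'] [CompleteSpace E']
  {M' : Type*} [TopologicalSpace M'] [ChartedSpace E' M'] [IsManifold 𝓘(ℝ, E') ∞ M']
  {θ' : Π x : M', TangentSpace 𝓘(ℝ, E') x →L[ℝ] E'}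
  {ψ' : Π x : M', E' →L[ℝ] TangentSpace 𝓘(ℝ, E') x} {c' : E' →L[ℝ] E' →L[ℝ] E'}

lemma mvfderiv_finset_sum {F : Type*} [NormedAddCommGroup F] [NormedSpace ℝ F] {ι : Type*}
    (s : Finset ι) {f : ι → M → F} {x : M}
    (hf : ∀ i, MDifferentiableAt 𝓘(ℝ, E) 𝓘(ℝ, F) (f i) x) (u : TangentSpace 𝓘(ℝ, E) x) :
    MDifferentiableAt 𝓘(ℝ, E) 𝓘(ℝ, F) (fun p ↦ ∑ i ∈ s, f i p) x ∧
    mvfderiv 𝓘(ℝ, E) (fun p ↦ ∑ i ∈ s, f i p) x u = ∑ i ∈ s, mvfderiv 𝓘(ℝ, E) (f i) x u := by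
  classical
  induction s using Finset.induction_on with
  | empty =>
    simp only [Finset.sum_empty]
    refine ⟨mdifferentiableAt_const, ?_⟩
    rw [mvfderiv_const]; rfl
  | insert a s ha ih =>
    simp only [Finset.sum_insert ha]
    refine ⟨(hf a).add ih.1, ?_⟩
    have := mvfderiv_add (hf a) ih.1
    rw [← ih.2]
    exact congrArg (fun L ↦ L u) this

/-- A smooth map whose derivative in trivializations is given by `T` is affine if `T` satisfies
a first order differential equation. -/
lemma IsCoframe.isAffineMap (h : IsCoframe θ ψ c) (h' : IsCoframe θ' ψ' c')
    (B : E →L[ℝ] E →L[ℝ] E) (B' : E' →L[ℝ] E' →L[ℝ] E') {f : M → M'}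
    (hf : ContMDiff 𝓘(ℝ, E) 𝓘(ℝ, E') ∞ f) (T : M → E →L[ℝ] E')
    (hTd : ∀ x, MDifferentiableAt 𝓘(ℝ, E) 𝓘(ℝ, E →L[ℝ] E') T x)
    (hT : ∀ x v, θ' (f x) (mfderiv 𝓘(ℝ, E) 𝓘(ℝ, E') f x v) = T x (θ x v))
    (hB : ∀ x (u : TangentSpace 𝓘(ℝ, E) x) y,
      mvfderiv 𝓘(ℝ, E) T x u y + B' (T x y) (T x (θ x u)) = T x (B y (θ x u))) :
    IsAffineMap (frameConnection θ ψ B) (frameConnection θ' ψ' B') f where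
  contMDiff := hf
  map_cov Y n Z a hY hZ ha m hYZ u := by
    apply h'.injective (f m)
    have hfm : MDifferentiableAt 𝓘(ℝ, E) 𝓘(ℝ, E') f m := hf.mdifferentiable (by simp) m
    have hθZ : ∀ i, MDifferentiableAt 𝓘(ℝ, E') 𝓘(ℝ, E') (fun q ↦ θ' q (Z i q)) (f m) :=
      fun i ↦ (h'.contMDiff _ (hZ i)).mdifferentiable (by simp) _
    have hθY : MDifferentiableAt 𝓘(ℝ, E) 𝓘(ℝ, E) (fun q ↦ θ q (Y q)) m :=
      (h.contMDiff _ hY).mdifferentiable (by simp) _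
    have ham : ∀ i, MDifferentiableAt 𝓘(ℝ, E) 𝓘(ℝ, ℝ) (a i) m :=
      fun i ↦ (ha i).mdifferentiable (by simp) _
    -- The expansion of `df Y` along the fields `Z i`, read through `θ'`. Differentiating its right
    -- side gives the derivative terms of the pulled back connection; the left side gives those of
    -- `cov` and the derivative of `T`.
    have e1 : (fun p ↦ T p (θ p (Y p))) =ᶠ[𝓝 m]
        fun p ↦ ∑ i, (a i • ((fun q ↦ θ' q (Z i q)) ∘ f)) p := by
      filter_upwards [hYZ] with p hp
      rw [← hT, hp, map_sum]
      exact Finset.sum_congr rfl fun i _ ↦ map_smul _ _ _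
    have e2 : mvfderiv 𝓘(ℝ, E) (fun p ↦ T p (θ p (Y p))) m u =
        T m (mvfderiv 𝓘(ℝ, E) (fun p ↦ θ p (Y p)) m u) + mvfderiv 𝓘(ℝ, E) T m u (θ m (Y m)) := by
      rw [(mvfderiv_clm_apply (hTd m) hθY u).2, add_comm]
    have e3 : ∀ i, MDifferentiableAt 𝓘(ℝ, E) 𝓘(ℝ, E') ((fun q ↦ θ' q (Z i q)) ∘ f) m :=
      fun i ↦ (hθZ i).comp m hfm
    have e4 : θ' (f m) (mfderiv 𝓘(ℝ, E) 𝓘(ℝ, E') f m (Y m)) = ∑ i, a i m • θ' (f m) (Z i (f m)) := by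
      rw [hYZ.self_of_nhds, map_sum]
      exact Finset.sum_congr rfl fun i _ ↦ map_smul _ _ _
    have e5 : ∀ i, mvfderiv 𝓘(ℝ, E) ((fun q ↦ θ' q (Z i q)) ∘ f) m u =
      mvfderiv 𝓘(ℝ, E') (fun q ↦ θ' q (Z i q)) (f m) (mfderiv 𝓘(ℝ, E) 𝓘(ℝ, E') f m u) :=
      fun i ↦ mfderiv_comp_apply m (hθZ i) hfm u
    have e6 : ∀ i, θ' (f m) (a i m • frameConnection θ' ψ' B' (Z i) (f m)
        (mfderiv 𝓘(ℝ, E) 𝓘(ℝ, E') f m u) + mvfderiv 𝓘(ℝ, E) (a i) m u • Z i (f m)) =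
        mvfderiv 𝓘(ℝ, E) (a i • ((fun q ↦ θ' q (Z i q)) ∘ f)) m u +
          B' (a i m • θ' (f m) (Z i (f m))) (T m (θ m u)) := by
      intro i
      rw [map_add, map_smul, map_smul, h'.coframe_frameConnection, hT, mvfderiv_smul (ham i) (e3 i),
        map_smul]
      simp only [add_apply, smul_apply,
        ContinuousLinearMap.smulRight_apply, smul_add, e5, Function.comp_apply]
      abel
    rw [hT, h.coframe_frameConnection, map_add, map_sum, Finset.sum_congr rfl fun i _ ↦ e6 i,
      Finset.sum_add_distrib, ← (mvfderiv_finset_sum Finset.univ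
        (fun i ↦ (ham i).smul (e3 i)) u).2, ← mvfderiv_congr e1, e2, ← hB m u, ← hT m (Y m), e4]
    simp only [map_sum, sum_apply]
    abel

end Coframe

/-! ### Smoothness of maps into a single tangent space -/

section TangentFiber

variable {E : Type*} [NormedAddCommGroup E] [NormedSpace ℝ E]
  {M : Type*} [TopologicalSpace M] [ChartedSpace E M] [IsManifold 𝓘(ℝ, E) ∞ M]
  {E' : Type*} [NormedAddCommGroup E'] [NormedSpace ℝ E']
  {N : Type*} [TopologicalSpace N] [ChartedSpace E' N]

lemma trivializationAt_self_snd [IsManifold 𝓘(ℝ, E) 1 M] (x : M) (v : E) :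
    (trivializationAt E (TangentSpace 𝓘(ℝ, E)) x (⟨x, v⟩ : TangentBundle 𝓘(ℝ, E) M)).2 = v :=
  (tangentBundleCore 𝓘(ℝ, E) M).coordChange_self (achart E x) x (mem_chart_source E x) v

/-- At its own base point the trivialization is the identity of the fibre. Lie algebra valued
functions can thus be studied as maps into `TG` over the unit. -/
lemma contMDiff_tangentFiber_iff [IsManifold 𝓘(ℝ, E) 1 M] (x : M) {y : N → E} :
    ContMDiff 𝓘(ℝ, E') 𝓘(ℝ, E).tangent ∞ (fun n ↦ (⟨x, y n⟩ : TangentBundle 𝓘(ℝ, E) M)) ↔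
      ContMDiff 𝓘(ℝ, E') 𝓘(ℝ, E) ∞ y := by
  have h : (fun n : N ↦ (trivializationAt E (TangentSpace 𝓘(ℝ, E)) x
    (⟨x, y n⟩ : TangentBundle 𝓘(ℝ, E) M)).2) = y := funext fun n ↦ trivializationAt_self_snd x _
  constructor
  · intro hy n
    have := (contMDiffAt_totalSpace.1 (hy n)).2
    exact h ▸ this
  · intro hy n
    refine contMDiffAt_totalSpace.2 ⟨contMDiffAt_const, ?_⟩
    exact h.symm ▸ hy n

lemma mdifferentiableAt_of_tangentFiber [IsManifold 𝓘(ℝ, E) 1 M] (x : M) {y : N → E} {n : N}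
    (hy : MDifferentiableAt 𝓘(ℝ, E') 𝓘(ℝ, E).tangent
      (fun n ↦ (⟨x, y n⟩ : TangentBundle 𝓘(ℝ, E) M)) n) :
    MDifferentiableAt 𝓘(ℝ, E') 𝓘(ℝ, E) y n := by
  have h : (fun n : N ↦ (trivializationAt E (TangentSpace 𝓘(ℝ, E)) x
    (⟨x, y n⟩ : TangentBundle 𝓘(ℝ, E) M)).2) = y := funext fun n ↦ trivializationAt_self_snd x _
  have := ((mdifferentiableAt_totalSpace _ _).1 hy).2
  exact h ▸ this

end TangentFiber

/-! ### The left trivialization of a Lie group and the Maurer-Cartan equation -/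

section Group

variable {E : Type*} [NormedAddCommGroup E] [NormedSpace ℝ E]
  {G : Type*} [TopologicalSpace G] [ChartedSpace E G] [Group G]
  [LieGroup 𝓘(ℝ, E) ∞ G]

lemma isManifold_one : IsManifold 𝓘(ℝ, E) 1 G := IsManifold.of_le (n := ∞) (by simp)

lemma lieGroup_minSmoothness : LieGroup 𝓘(ℝ, E) (minSmoothness ℝ 3) G :=
  LieGroup.of_le (n := ∞) (by
    rw [minSmoothness_of_isRCLikeNormedField]; exact natCast_le_infty 3)

/-- This is the tangent map of the multiplication under `T(G × G) = TG × TG`. With the zero vector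
in one factor it yields the smoothness of the left trivialization, of its inverse and of the
right-invariant fields. -/
lemma contMDiff_tangentMul :
    ContMDiff (𝓘(ℝ, E).tangent.prod 𝓘(ℝ, E).tangent) 𝓘(ℝ, E).tangent ∞
      (fun p : TangentBundle 𝓘(ℝ, E) G × TangentBundle 𝓘(ℝ, E) G ↦
        (⟨p.1.1 * p.2.1, mfderiv 𝓘(ℝ, E) 𝓘(ℝ, E) (fun τ : G ↦ τ * p.2.1) p.1.1 p.1.2 +
          mfderiv 𝓘(ℝ, E) 𝓘(ℝ, E) (fun τ : G ↦ p.1.1 * τ) p.2.1 p.2.2⟩ :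
          TangentBundle 𝓘(ℝ, E) G)) := by
  have _ : IsManifold 𝓘(ℝ, E) 1 G := isManifold_one
  have h := (contMDiff_mul 𝓘(ℝ, E) ∞ (G := G)).contMDiff_tangentMap (m := ∞) (by simp)
  have h2 := h.comp (contMDiff_equivTangentBundleProd_symm (I := 𝓘(ℝ, E)) (M := G)
    (I' := 𝓘(ℝ, E)) (M' := G))
  convert h2 using 2 with p
  simp only [Function.comp_apply, tangentMap]
  rw [mfderiv_prod_eq_add_apply ((contMDiff_mul 𝓘(ℝ, E) ∞).mdifferentiable (by simp) _)]
  rfl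

lemma mdifferentiableAt_mul_left (g h : G) :
    MDifferentiableAt 𝓘(ℝ, E) 𝓘(ℝ, E) (fun τ : G ↦ g * τ) h :=
  (contMDiff_mul_left (n := ∞)).mdifferentiable (by simp) _

lemma mdifferentiableAt_mul_right (g h : G) :
    MDifferentiableAt 𝓘(ℝ, E) 𝓘(ℝ, E) (fun τ : G ↦ τ * g) h :=
  (contMDiff_mul_right (n := ∞)).mdifferentiable (by simp) _

lemma mfderiv_mul_left_mul (a b c : G) (v : TangentSpace 𝓘(ℝ, E) c) :
    (mfderiv 𝓘(ℝ, E) 𝓘(ℝ, E) (fun τ : G ↦ a * τ) (b * c)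
      (mfderiv 𝓘(ℝ, E) 𝓘(ℝ, E) (fun τ : G ↦ b * τ) c v) : E) =
    mfderiv 𝓘(ℝ, E) 𝓘(ℝ, E) (fun τ : G ↦ a * b * τ) c v := by
  have h1 : (fun τ : G ↦ a * b * τ) = (fun τ ↦ a * τ) ∘ (fun τ ↦ b * τ) := by
    ext τ; simp [mul_assoc]
  have h2 := mfderiv_comp_apply (I := 𝓘(ℝ, E)) (I' := 𝓘(ℝ, E)) (I'' := 𝓘(ℝ, E)) c
    (g := fun τ : G ↦ a * τ) (f := fun τ : G ↦ b * τ) (mdifferentiableAt_mul_left a (b * c))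
    (mdifferentiableAt_mul_left b c) v
  rw [h1]
  exact h2.symm

lemma ofLieAlgebra_toLieAlgebra (σ : G) (v : TangentSpace 𝓘(ℝ, E) σ) :
    ofLieAlgebra σ (toLieAlgebra σ v) = v := by
  have h := mfderiv_mul_left_mul σ σ⁻¹ σ v
  have h1 : (fun τ : G ↦ σ * σ⁻¹ * τ) = id := by ext; simp
  rw [h1, mfderiv_id] at h
  refine Eq.trans ?_ h
  have h4 : ∀ ρ, ρ = (1 : G) → ∀ w : E, (mfderiv 𝓘(ℝ, E) 𝓘(ℝ, E) (fun τ : G ↦ σ * τ) 1 w : E) =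
    (mfderiv 𝓘(ℝ, E) 𝓘(ℝ, E) (fun τ : G ↦ σ * τ) ρ w : E) := by
    rintro _ rfl; exact fun _ ↦ rfl
  exact h4 _ (inv_mul_cancel σ) _

lemma toLieAlgebra_ofLieAlgebra (σ : G) (v : E) :
    toLieAlgebra σ (ofLieAlgebra σ v) = v :=
  toLieAlgebra_mulInvariantVectorField v σ

/-- Base points such as `σ⁻¹ * σ` and `1` are not definitionally equal; since every tangent space is
`E` by definition, a vector moves between them without a cast. -/
lemma tangentBundle_mk_eq {ρ ρ' : G} (h : ρ = ρ') (v : E) :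
    (⟨ρ, v⟩ : TangentBundle 𝓘(ℝ, E) G) = ⟨ρ', v⟩ := by subst h; rfl

lemma contMDiff_zeroField :
    ContMDiff 𝓘(ℝ, E) 𝓘(ℝ, E).tangent ∞ (fun σ : G ↦ (⟨σ, 0⟩ : TangentBundle 𝓘(ℝ, E) G)) := by
  have _ : IsManifold 𝓘(ℝ, E) 1 G := isManifold_one
  exact contMDiff_zeroSection ℝ (TangentSpace 𝓘(ℝ, E) : G → Type _)

lemma tangentBundle_mk_toLieAlgebra (Y : Π σ : G, TangentSpace 𝓘(ℝ, E) σ) :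
    (fun σ : G ↦ (⟨1, toLieAlgebra (E := E) σ (Y σ)⟩ : TangentBundle 𝓘(ℝ, E) G)) =
    fun σ ↦ ⟨σ⁻¹ * σ, mfderiv 𝓘(ℝ, E) 𝓘(ℝ, E) (fun τ : G ↦ τ * σ) σ⁻¹ 0 +
          mfderiv 𝓘(ℝ, E) 𝓘(ℝ, E) (fun τ : G ↦ σ⁻¹ * τ) σ (Y σ)⟩ := by
  ext1 σ
  rw [map_zero, zero_add]
  exact tangentBundle_mk_eq (E := E) (inv_mul_cancel σ).symm _

lemma contMDiff_toLieAlgebra {Y : Π σ : G, TangentSpace 𝓘(ℝ, E) σ} (hY : IsSmoothField Y) :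
    ContMDiff 𝓘(ℝ, E) 𝓘(ℝ, E) ∞ (fun σ ↦ toLieAlgebra σ (Y σ)) := by
  have _ : IsManifold 𝓘(ℝ, E) 1 G := isManifold_one
  refine (contMDiff_tangentFiber_iff (1 : G)).1 ?_
  rw [tangentBundle_mk_toLieAlgebra]
  exact contMDiff_tangentMul.comp ((contMDiff_zeroField.comp (contMDiff_inv 𝓘(ℝ, E) ∞)).prodMk hY)

lemma mdifferentiableAt_toLieAlgebra {Y : Π σ : G, TangentSpace 𝓘(ℝ, E) σ} {σ : G}
    (hY : IsDiffFieldAt Y σ) :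
    MDifferentiableAt 𝓘(ℝ, E) 𝓘(ℝ, E) (fun σ ↦ toLieAlgebra σ (Y σ)) σ := by
  have _ : IsManifold 𝓘(ℝ, E) 1 G := isManifold_one
  refine mdifferentiableAt_of_tangentFiber (1 : G) ?_
  rw [tangentBundle_mk_toLieAlgebra]
  exact (contMDiff_tangentMul.mdifferentiable (by simp) _).comp σ
    (((contMDiff_zeroField.comp (contMDiff_inv 𝓘(ℝ, E) ∞)).mdifferentiable (by simp) σ).prodMk hY)

lemma isSmoothField_ofLieAlgebra {y : G → E} (hy : ContMDiff 𝓘(ℝ, E) 𝓘(ℝ, E) ∞ y) :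
    IsSmoothField (fun σ ↦ ofLieAlgebra σ (y σ)) := by
  have _ : IsManifold 𝓘(ℝ, E) 1 G := isManifold_one
  have h := contMDiff_tangentMul.comp
    (contMDiff_zeroField.prodMk ((contMDiff_tangentFiber_iff (1 : G)).2 hy))
  refine h.congr fun σ ↦ ?_
  refine Eq.symm (Eq.trans ?_ (tangentBundle_mk_eq (E := E) (mul_one σ) (ofLieAlgebra σ (y σ))))
  simp only [Function.comp_apply]
  rw [map_zero, zero_add]
  rfl

lemma isSmoothField_mulInvariantVectorField (x : GroupLieAlgebra 𝓘(ℝ, E) G) :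
    IsSmoothField (mulInvariantVectorField x) :=
  isSmoothField_ofLieAlgebra (E := E) (y := fun _ ↦ x) contMDiff_const

lemma isSmoothField_rightField (x : GroupLieAlgebra 𝓘(ℝ, E) G) :
    IsSmoothField (rightField x) := by
  have _ : IsManifold 𝓘(ℝ, E) 1 G := isManifold_one
  have h := contMDiff_tangentMul.comp
    (((contMDiff_tangentFiber_iff (E := E) (1 : G)).2
      (contMDiff_const (I := 𝓘(ℝ, E)) (M := G) (M' := E) (c := x))).prodMk contMDiff_zeroField)
  refine h.congr fun σ ↦ ?_
  refine Eq.symm (Eq.trans ?_ (tangentBundle_mk_eq (E := E) (one_mul σ) (rightField x σ)))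
  simp only [Function.comp_apply]
  rw [map_zero, add_zero]
  rfl

variable [FiniteDimensional ℝ E]

variable (E G) in
/-- The Lie bracket of the Lie algebra of `G` as a continuous bilinear map. -/
noncomputable def bracketCLM : E →L[ℝ] E →L[ℝ] E :=
  LinearMap.toContinuousLinearMap (LinearMap.toContinuousLinearMap.toLinearMap ∘ₗ
    (show E →ₗ[ℝ] E →ₗ[ℝ] E from adjointMap (G := G)))

/-- The Maurer-Cartan equation. -/
lemma toLieAlgebra_structure_equation {X Y : Π σ : G, TangentSpace 𝓘(ℝ, E) σ} {σ : G}
    (hX : IsDiffFieldAt X σ) (hY : IsDiffFieldAt Y σ) :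
    mvfderiv 𝓘(ℝ, E) (fun τ ↦ toLieAlgebra τ (Y τ)) σ (X σ) -
      mvfderiv 𝓘(ℝ, E) (fun τ ↦ toLieAlgebra τ (X τ)) σ (Y σ) -
      toLieAlgebra σ (mlieBracket 𝓘(ℝ, E) X Y σ) =
      -bracketCLM E G (toLieAlgebra σ (X σ)) (toLieAlgebra σ (Y σ)) := by
  have _ : IsManifold 𝓘(ℝ, E) 1 G := isManifold_one
  have _ : LieGroup 𝓘(ℝ, E) (minSmoothness ℝ 3) G := lieGroup_minSmoothness
  have _ : CompleteSpace E := FiniteDimensional.complete ℝ E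
  let θ : (Π σ : G, TangentSpace 𝓘(ℝ, E) σ) → G → E := fun X τ ↦ toLieAlgebra τ (X τ)
  -- The defect in the Maurer-Cartan equation. The derivatives of coefficient functions cancel, so
  -- `Φ` is tensorial at `σ` in its first argument, and by antisymmetry in the second. It can
  -- therefore be evaluated on left-invariant fields, on which `θ` is constant.
  let Φ : (Π σ : G, TangentSpace 𝓘(ℝ, E) σ) → (Π σ : G, TangentSpace 𝓘(ℝ, E) σ) → E := fun X Y ↦
    mvfderiv 𝓘(ℝ, E) (θ Y) σ (X σ) - mvfderiv 𝓘(ℝ, E) (θ X) σ (Y σ) -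
      toLieAlgebra σ (mlieBracket 𝓘(ℝ, E) X Y σ) + bracketCLM E G (θ X σ) (θ Y σ)
  have hswap : ∀ X Y, Φ X Y = -Φ Y X := by
    intro X Y
    have h : bracketCLM E G (θ X σ) (θ Y σ) = -bracketCLM E G (θ Y σ) (θ X σ) :=
      (lie_skew (L := GroupLieAlgebra 𝓘(ℝ, E) G) (θ X σ) (θ Y σ)).symm
    simp only [Φ]
    rw [mlieBracket_swap_apply, map_neg, h]
    abel
  have hθadd : ∀ X Y, θ (X + Y) = θ X + θ Y := fun X Y ↦ funext fun τ ↦ map_add _ _ _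
  have hθsmul : ∀ (f : G → ℝ) X, θ (f • X) = f • θ X := fun X Y ↦ funext fun τ ↦ map_smul _ _ _
  have h1 : ∀ Y, IsDiffFieldAt Y σ → TensorialAt 𝓘(ℝ, E) E (Φ · Y) σ := by
    intro Y hY
    constructor
    · intro f X hf hX
      have h2 : mvfderiv 𝓘(ℝ, E) (θ Y) σ ((f • X) σ) = f σ • mvfderiv 𝓘(ℝ, E) (θ Y) σ (X σ) :=
        map_smul _ _ _
      simp only [Φ]
      rw [h2, mlieBracket_smul_left hf hX, hθsmul,
        mvfderiv_smul hf (mdifferentiableAt_toLieAlgebra hX)]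
      have h3 : toLieAlgebra σ (-(mvfderiv 𝓘(ℝ, E) f σ) (Y σ) • X σ +
          f σ • mlieBracket 𝓘(ℝ, E) X Y σ) = -mvfderiv 𝓘(ℝ, E) f σ (Y σ) • θ X σ +
          f σ • toLieAlgebra σ (mlieBracket 𝓘(ℝ, E) X Y σ) := by
        rw [map_add, map_smul, map_smul]
      refine Eq.trans (congrArg₂ _ (congrArg₂ _ rfl h3) rfl) ?_
      simp only [add_apply, smul_apply, ContinuousLinearMap.smulRight_apply, Pi.smul_apply',
        map_smul, smul_sub, smul_add, neg_smul]
      abel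
    · intro X X' hX hX'
      have h2 : mvfderiv 𝓘(ℝ, E) (θ Y) σ ((X + X') σ) = mvfderiv 𝓘(ℝ, E) (θ Y) σ (X σ) +
        mvfderiv 𝓘(ℝ, E) (θ Y) σ (X' σ) := map_add _ _ _
      simp only [Φ]
      rw [h2, mlieBracket_add_left hX hX', hθadd, map_add,
        mvfderiv_add (mdifferentiableAt_toLieAlgebra hX) (mdifferentiableAt_toLieAlgebra hX')]
      simp only [add_apply, Pi.add_apply, map_add]
      abel
  have h2 : ∀ X, IsDiffFieldAt X σ → TensorialAt 𝓘(ℝ, E) E (Φ X ·) σ := by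
    intro X hX
    constructor
    · intro f Y hf hY
      simp only [hswap X]
      rw [(h1 X hX).smul hf hY, smul_neg]
    · intro Y Y' hY hY'
      simp only [hswap X]
      rw [(h1 X hX).add hY hY', neg_add]
  let inv : E → Π σ : G, TangentSpace 𝓘(ℝ, E) σ := fun x ↦ mulInvariantVectorField x
  have hs : ∀ x, IsDiffFieldAt (inv x) σ := fun x ↦
    (isSmoothField_mulInvariantVectorField (E := E) (G := G) x).isDiffFieldAt σ
  have hinv : ∀ x y : E, Φ (inv x) (inv y) = 0 := by
    intro x y
    have hc : ∀ x : E, θ (inv x) = fun _ ↦ x :=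
      fun x ↦ funext fun τ ↦ toLieAlgebra_mulInvariantVectorField x τ
    have hb : toLieAlgebra σ (mlieBracket 𝓘(ℝ, E) (inv x) (inv y) σ) = bracketCLM E G x y := by
      have h := congrFun (mulInvariantVector_mlieBracket (I := 𝓘(ℝ, E)) (G := G) x y) σ
      exact (congrArg (toLieAlgebra σ) h.symm).trans (toLieAlgebra_mulInvariantVectorField _ σ)
    simp only [Φ]
    rw [hc, hc, mvfderiv_const, mvfderiv_const, hb]
    simp
  have key := TensorialAt.pointwise₂ h1 h2 hX (hs (toLieAlgebra σ (X σ))) hY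
    (hs (toLieAlgebra σ (Y σ)))
    (ofLieAlgebra_toLieAlgebra σ (X σ)).symm (ofLieAlgebra_toLieAlgebra σ (Y σ)).symm
  exact eq_neg_of_add_eq_zero_left (key.trans (hinv _ _))

lemma isCoframe_toLieAlgebra :
    IsCoframe (M := G) toLieAlgebra ofLieAlgebra (bracketCLM E G) where
  left_inv := ofLieAlgebra_toLieAlgebra
  right_inv := toLieAlgebra_ofLieAlgebra
  mdifferentiableAt _ _ := mdifferentiableAt_toLieAlgebra
  contMDiff _ := contMDiff_toLieAlgebra
  isSmoothField _ := isSmoothField_ofLieAlgebra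
  structure_equation _ _ hX hY σ :=
    toLieAlgebra_structure_equation (hX.isDiffFieldAt σ) (hY.isDiffFieldAt σ)

end Group

/-! ### Commutation of left- and right-invariant fields; derivatives of homomorphisms -/

lemma fderiv_partial_comm {E F : Type*} [NormedAddCommGroup E] [NormedSpace ℝ E]
    [NormedAddCommGroup F] [NormedSpace ℝ F] {f : E × E → F} {u : E × E}
    (hf : ContDiffAt ℝ 2 f u) (x z : E) :
    fderiv ℝ (fun a ↦ fderiv ℝ (fun b ↦ f (a, b)) u.2 z) u.1 x =
      fderiv ℝ (fun b ↦ fderiv ℝ (fun a ↦ f (a, b)) u.1 x) u.2 z := by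
  have hev := hf.eventually (by simp)
  have hdf : DifferentiableAt ℝ (fderiv ℝ f) (u.1, u.2) :=
    (hf.fderiv_right (m := 1) (by norm_num)).differentiableAt (by simp)
  have hl : Filter.Tendsto (fun a : E ↦ (a, u.2)) (𝓝 u.1) (𝓝 u) :=
    (Continuous.prodMk_left u.2).tendsto u.1
  have hr : Filter.Tendsto (fun b : E ↦ (u.1, b)) (𝓝 u.2) (𝓝 u) :=
    (Continuous.prodMk_right u.1).tendsto u.2
  have e1 : (fun a ↦ fderiv ℝ (fun b ↦ f (a, b)) u.2 z) =ᶠ[𝓝 u.1]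
      fun a ↦ fderiv ℝ f (a, u.2) (0, z) := by
    filter_upwards [hl.eventually hev] with a ha
    have := (ha.differentiableAt (by simp)).hasFDerivAt.comp u.2 (hasFDerivAt_prodMk_right a u.2)
    rw [show (fun b ↦ f (a, b)) = f ∘ fun b ↦ (a, b) from rfl, this.fderiv]
    simp
  have e2 : (fun b ↦ fderiv ℝ (fun a ↦ f (a, b)) u.1 x) =ᶠ[𝓝 u.2]
      fun b ↦ fderiv ℝ f (u.1, b) (x, 0) := by
    filter_upwards [hr.eventually hev] with b hb
    have := HasFDerivAt.comp (g := f) (f := fun a ↦ (a, b)) u.1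
      (hb.differentiableAt (by simp)).hasFDerivAt (hasFDerivAt_prodMk_left u.1 b)
    rw [show (fun a ↦ f (a, b)) = f ∘ fun a ↦ (a, b) from rfl, this.fderiv]
    simp
  rw [e1.fderiv_eq, e2.fderiv_eq]
  have h1 := ((HasFDerivAt.comp (g := fderiv ℝ f) (f := fun a ↦ (a, u.2)) u.1
    hdf.hasFDerivAt (hasFDerivAt_prodMk_left u.1 u.2)).clm_apply
    (hasFDerivAt_const ((0 : E), z) u.1)).fderiv
  have h2 := ((HasFDerivAt.comp (g := fderiv ℝ f) (f := fun b ↦ (u.1, b)) u.2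
    hdf.hasFDerivAt (hasFDerivAt_prodMk_right u.1 u.2)).clm_apply
    (hasFDerivAt_const (x, (0 : E)) u.2)).fderiv
  have h1' := congrArg (fun L ↦ L x) h1
  have h2' := congrArg (fun L ↦ L z) h2
  simp only [Function.comp_def] at h1' h2'
  rw [h1', h2']
  simpa using (hf.isSymmSndFDerivAt (by simp)) (x, 0) (0, z)

section Group

variable {E : Type*} [NormedAddCommGroup E] [NormedSpace ℝ E]
  {G : Type*} [TopologicalSpace G] [ChartedSpace E G] [Group G]
  [LieGroup 𝓘(ℝ, E) ∞ G]

lemma mvfderiv_comp_of_eq' {F E' N : Type*} [NormedAddCommGroup F] [NormedSpace ℝ F]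
    [NormedAddCommGroup E'] [NormedSpace ℝ E'] [TopologicalSpace N] [ChartedSpace E' N]
    {g : G → F} {f : N → G} {n : N} {τ : G}
    (hg : MDifferentiableAt 𝓘(ℝ, E) 𝓘(ℝ, F) g τ) (hf : MDifferentiableAt 𝓘(ℝ, E') 𝓘(ℝ, E) f n)
    (h : f n = τ) (v : TangentSpace 𝓘(ℝ, E') n) :
    mvfderiv 𝓘(ℝ, E') (g ∘ f) n v = mvfderiv 𝓘(ℝ, E) g τ
      (mfderiv 𝓘(ℝ, E') 𝓘(ℝ, E) f n v : E) := by
  subst h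
  exact mfderiv_comp_apply n hg hf v

variable [FiniteDimensional ℝ E]

/-- A left-invariant field moves `τ` by right multiplication. In the chart at the unit the
derivative is an ordinary one, so derivatives along `x⁻` and `z⁺` become partial derivatives of one
function. -/
lemma mvfderiv_mulInvariantVectorField {F : Type*} [NormedAddCommGroup F] [NormedSpace ℝ F]
    {g : G → F} {τ : G} (hg : MDifferentiableAt 𝓘(ℝ, E) 𝓘(ℝ, F) g τ) (z : E) :
    mvfderiv 𝓘(ℝ, E) g τ (mulInvariantVectorField (I := 𝓘(ℝ, E)) (G := G) z τ) =
      fderiv ℝ (fun b ↦ g (τ * (extChartAt 𝓘(ℝ, E) (1 : G)).symm b))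
        (extChartAt 𝓘(ℝ, E) (1 : G) 1) z := by
  have _ : CompleteSpace E := FiniteDimensional.complete ℝ E
  have hd := mdifferentiableAt_mul_left (E := E) τ 1
  have h := mvfderiv_comp_of_eq' hg hd (mul_one τ) z
  have hg' : MDifferentiableAt 𝓘(ℝ, E) 𝓘(ℝ, F) (g ∘ fun x : G ↦ τ * x) 1 :=
    hg.comp_of_eq _ hd (mul_one τ)
  exact h.symm.trans (mvfderiv_eq_fderiv hg' z)

lemma mvfderiv_rightField {F : Type*} [NormedAddCommGroup F] [NormedSpace ℝ F]
    {g : G → F} {τ : G} (hg : MDifferentiableAt 𝓘(ℝ, E) 𝓘(ℝ, F) g τ) (x : E) :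
    mvfderiv 𝓘(ℝ, E) g τ (rightField (E := E) (G := G) x τ) =
      fderiv ℝ (fun a ↦ g ((extChartAt 𝓘(ℝ, E) (1 : G)).symm a * τ))
        (extChartAt 𝓘(ℝ, E) (1 : G) 1) x := by
  have _ : CompleteSpace E := FiniteDimensional.complete ℝ E
  have hd := mdifferentiableAt_mul_right (E := E) τ 1
  have h := mvfderiv_comp_of_eq' hg hd (one_mul τ) x
  have hg' : MDifferentiableAt 𝓘(ℝ, E) 𝓘(ℝ, F) (g ∘ fun x : G ↦ x * τ) 1 :=
    hg.comp_of_eq _ hd (one_mul τ)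
  exact h.symm.trans (mvfderiv_eq_fderiv hg' x)

/-- Right and left invariant vector fields commute. -/
lemma mlieBracket_rightField_mulInvariantVectorField (x z : GroupLieAlgebra 𝓘(ℝ, E) G) (σ : G) :
    mlieBracket 𝓘(ℝ, E) (rightField x) (mulInvariantVectorField z) σ = 0 := by
  have _ : CompleteSpace E := FiniteDimensional.complete ℝ E
  have _ : IsManifold 𝓘(ℝ, E) 1 G := isManifold_one
  have _ : ContinuousMul G := continuousMul_of_contMDiffMul 𝓘(ℝ, E) ∞
  apply injective_mvfderiv_extChartAt σ
  set h : G → E := fun q ↦ extChartAt 𝓘(ℝ, E) σ q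
  have hh : ContMDiffAt 𝓘(ℝ, E) 𝓘(ℝ, E) ∞ h σ := contMDiffAt_extChartAt
  have hR := (isSmoothField_rightField x).isDiffFieldAt σ
  have hL := (isSmoothField_mulInvariantVectorField z).isDiffFieldAt σ
  rw [mvfderiv_mlieBracket hh hR hL, map_zero, sub_eq_zero]
  set u := extChartAt 𝓘(ℝ, E) (1 : G) 1 with hu
  set ψ := (extChartAt 𝓘(ℝ, E) (1 : G)).symm with hψ
  have hψu : ψ u = 1 := extChartAt_to_inv 1
  have hψs : ContMDiffAt 𝓘(ℝ, E) 𝓘(ℝ, E) ∞ ψ u :=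
    (contMDiffOn_extChartAt_symm (1 : G)).contMDiffAt (extChartAt_target_mem_nhds (1 : G))
  have hnear : ∀ᶠ p in 𝓝 σ, MDifferentiableAt 𝓘(ℝ, E) 𝓘(ℝ, E) h p := by
    filter_upwards [(chartAt E σ).open_source.mem_nhds (mem_chart_source E σ)] with p hp
    exact mdifferentiableAt_extChartAt hp
  rw [mvfderiv_rightField (mdifferentiableAt_mvfderiv_apply hh hL) x,
    mvfderiv_mulInvariantVectorField (mdifferentiableAt_mvfderiv_apply hh hR) z]
  have t1 : Filter.Tendsto (fun a ↦ ψ a * σ) (𝓝 u) (𝓝 σ) := by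
    have := hψs.continuousAt.tendsto.mul_const σ
    rwa [hψu, one_mul] at this
  have t2 : Filter.Tendsto (fun a ↦ σ * ψ a) (𝓝 u) (𝓝 σ) := by
    have := hψs.continuousAt.tendsto.const_mul σ
    rwa [hψu, mul_one] at this
  have e1 : (fun a ↦ mvfderiv 𝓘(ℝ, E) h (ψ a * σ) (mulInvariantVectorField z (ψ a * σ))) =ᶠ[𝓝 u]
      fun a ↦ fderiv ℝ (fun b ↦ h (ψ a * σ * ψ b)) u z := by
    filter_upwards [t1.eventually hnear] with a ha
    exact mvfderiv_mulInvariantVectorField ha z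
  have e2 : (fun b ↦ mvfderiv 𝓘(ℝ, E) h (σ * ψ b) (rightField x (σ * ψ b))) =ᶠ[𝓝 u]
      fun b ↦ fderiv ℝ (fun a ↦ h (ψ a * σ * ψ b)) u x := by
    filter_upwards [t2.eventually hnear] with b hb
    rw [mvfderiv_rightField hb x]
    simp only [mul_assoc, ← hψ, ← hu]
  rw [e1.fderiv_eq, e2.fderiv_eq]
  -- Both sides are now mixed partial derivatives, in opposite orders, of `(a, b) ↦ h (ψ a * σ * ψ
  -- b)`: the right-invariant field moves the left factor, the left-invariant field the right
  -- factor.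
  have hF : ContDiffAt ℝ 2 (fun p : E × E ↦ h (ψ p.1 * σ * ψ p.2)) (u, u) := by
    refine ContDiffAt.of_le (n := ∞) ?_ two_le_infty
    refine ContMDiffAt.contDiffAt ?_
    have c1 : ContMDiffAt 𝓘(ℝ, E × E) 𝓘(ℝ, E) ∞ (fun p : E × E ↦ ψ p.1) (u, u) :=
      ContMDiffAt.comp (u, u) (g := ψ) hψs contDiffAt_fst.contMDiffAt
    have c2 : ContMDiffAt 𝓘(ℝ, E × E) 𝓘(ℝ, E) ∞ (fun p : E × E ↦ ψ p.2) (u, u) :=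
      ContMDiffAt.comp (u, u) (g := ψ) hψs contDiffAt_snd.contMDiffAt
    refine ContMDiffAt.comp_of_eq (g := h) hh ((c1.mul contMDiffAt_const).mul c2) ?_
    simp [hψu]
  exact fderiv_partial_comm hF x z

/-- The derivative of `σ ↦ Ad(σ⁻¹) x`. -/
lemma mvfderiv_toLieAlgebra_rightField (x : GroupLieAlgebra 𝓘(ℝ, E) G) (σ : G)
    (v : TangentSpace 𝓘(ℝ, E) σ) :
    mvfderiv 𝓘(ℝ, E) (fun τ ↦ toLieAlgebra (E := E) τ (rightField x τ)) σ v =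
      -bracketCLM E G (toLieAlgebra (E := E) σ v) (toLieAlgebra σ (rightField x σ)) := by
  -- Extend `v` to a left-invariant field: its trivialization is constant and it commutes with `x⁻`,
  -- so two terms of the Maurer-Cartan equation drop out.
  have h := toLieAlgebra_structure_equation
    ((isSmoothField_mulInvariantVectorField (E := E) (G := G) (toLieAlgebra (E := E) σ v)).isDiffFieldAt σ)
    ((isSmoothField_rightField x).isDiffFieldAt σ)
  have h1 : (fun τ : G ↦ toLieAlgebra τ (mulInvariantVectorField (I := 𝓘(ℝ, E)) (G := G)
      (toLieAlgebra (E := E) σ v) τ)) = fun _ ↦ toLieAlgebra (E := E) σ v :=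
    funext fun τ ↦ toLieAlgebra_mulInvariantVectorField _ τ
  have h2 : mulInvariantVectorField (I := 𝓘(ℝ, E)) (G := G) (toLieAlgebra (E := E) σ v) σ = v :=
    ofLieAlgebra_toLieAlgebra σ v
  have h3 : mlieBracket 𝓘(ℝ, E) (mulInvariantVectorField (I := 𝓘(ℝ, E)) (G := G)
      (toLieAlgebra (E := E) σ v)) (rightField x) σ = 0 :=
    mlieBracket_swap_apply.trans (neg_eq_zero.2
      (mlieBracket_rightField_mulInvariantVectorField x (toLieAlgebra (E := E) σ v) σ))
  rw [h1, mvfderiv_const, h3, h2, map_zero] at h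
  simpa using h

variable {E' : Type*} [NormedAddCommGroup E'] [NormedSpace ℝ E'] [FiniteDimensional ℝ E']
  {N : Type*} [TopologicalSpace N] [ChartedSpace E' N] [Group N]
  [LieGroup 𝓘(ℝ, E') ∞ N]

/-- The derivative of a homomorphism commutes with left translations. -/
lemma mfderiv_monoidHom (j : N →* G) (hj : ContMDiff 𝓘(ℝ, E') 𝓘(ℝ, E) ∞ j) (n : N) (w : E') :
    mfderiv 𝓘(ℝ, E') 𝓘(ℝ, E) j n (ofLieAlgebra n w) =
      ofLieAlgebra (E := E) (j n) (mfderiv 𝓘(ℝ, E') 𝓘(ℝ, E) j 1 w : E) := by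
  have hjd : ∀ n, MDifferentiableAt 𝓘(ℝ, E') 𝓘(ℝ, E) j n := hj.mdifferentiable (by simp)
  have h1 := mfderiv_comp_apply_of_eq (1 : N) (hjd n)
    (mdifferentiableAt_mul_left (E := E') n 1) (mul_one n) w
  have h2 := mfderiv_comp_apply_of_eq (1 : N) (mdifferentiableAt_mul_left (E := E) (j n) 1)
    (hjd 1) (map_one j) w
  have h3 : j ∘ (fun x ↦ n * x) = (fun x ↦ j n * x) ∘ j := by ext; simp
  rw [h3] at h1
  exact h1.symm.trans h2

/-- Because a homomorphism intertwines left translations, its derivative in the left trivializations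
is the same linear map at every point. This is the constant `T` with which the inclusion of a
subgroup enters `IsCoframe.isAffineMap`. -/
lemma toLieAlgebra_mfderiv_monoidHom (j : N →* G) (hj : ContMDiff 𝓘(ℝ, E') 𝓘(ℝ, E) ∞ j) (n : N)
    (v : TangentSpace 𝓘(ℝ, E') n) :
    toLieAlgebra (j n) (mfderiv 𝓘(ℝ, E') 𝓘(ℝ, E) j n v) =
      (mfderiv 𝓘(ℝ, E') 𝓘(ℝ, E) j 1 (toLieAlgebra n v : E') : E) := by
  have h := mfderiv_monoidHom j hj n (toLieAlgebra n v)
  rw [ofLieAlgebra_toLieAlgebra] at h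
  rw [h]
  exact toLieAlgebra_ofLieAlgebra (j n) _

/-- The derivative of a homomorphism is a homomorphism of Lie algebras. -/
lemma mfderiv_monoidHom_bracket (j : N →* G) (hj : ContMDiff 𝓘(ℝ, E') 𝓘(ℝ, E) ∞ j) (x y : E') :
    (mfderiv 𝓘(ℝ, E') 𝓘(ℝ, E) j 1 (bracketCLM E' N x y) : E) =
      bracketCLM E G (mfderiv 𝓘(ℝ, E') 𝓘(ℝ, E) j 1 x : E) (mfderiv 𝓘(ℝ, E') 𝓘(ℝ, E) j 1 y : E) := by
  have _ : CompleteSpace E := FiniteDimensional.complete ℝ E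
  have _ : CompleteSpace E' := FiniteDimensional.complete ℝ E'
  have hs := fun x ↦ isSmoothField_mulInvariantVectorField (E := E') (G := N) x
  have hs' := fun x ↦ isSmoothField_mulInvariantVectorField (E := E) (G := G) x
  have h := mfderiv_mlieBracket_of_related hj (m := 1) ((hs x).isDiffFieldAt 1)
    ((hs y).isDiffFieldAt 1)
    ((hs' (mfderiv 𝓘(ℝ, E') 𝓘(ℝ, E) j 1 x : E)).isDiffFieldAt _)
    ((hs' (mfderiv 𝓘(ℝ, E') 𝓘(ℝ, E) j 1 y : E)).isDiffFieldAt _)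
    (fun p ↦ mfderiv_monoidHom j hj p x) (fun p ↦ mfderiv_monoidHom j hj p y)
  have h1 : ∀ g : G, g = 1 → (mlieBracket 𝓘(ℝ, E)
    (mulInvariantVectorField (I := 𝓘(ℝ, E)) (G := G) (mfderiv 𝓘(ℝ, E') 𝓘(ℝ, E) j 1 x : E))
    (mulInvariantVectorField (I := 𝓘(ℝ, E)) (G := G) (mfderiv 𝓘(ℝ, E') 𝓘(ℝ, E) j 1 y : E)) g : E) =
    bracketCLM E G (mfderiv 𝓘(ℝ, E') 𝓘(ℝ, E) j 1 x : E) (mfderiv 𝓘(ℝ, E') 𝓘(ℝ, E) j 1 y : E) := by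
    rintro _ rfl; rfl
  exact Eq.trans h (h1 _ (map_one j))

end Group

/-! ### Algebra of the left symmetric product: torsion and flatness of `∇⁺` -/

section Group

variable {E : Type*} [NormedAddCommGroup E] [NormedSpace ℝ E]
  {G : Type*} [TopologicalSpace G] [ChartedSpace E G] [Group G]
  [LieGroup 𝓘(ℝ, E) ∞ G]

lemma toLieAlgebra_mul_left (g σ : G) (v : TangentSpace 𝓘(ℝ, E) σ) :
    toLieAlgebra (g * σ) (mfderiv 𝓘(ℝ, E) 𝓘(ℝ, E) (fun τ : G ↦ g * τ) σ v) =
      toLieAlgebra (E := E) σ v := by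
  have h := mfderiv_mul_left_mul (g * σ)⁻¹ g σ v
  have h1 : (fun τ : G ↦ (g * σ)⁻¹ * g * τ) = fun τ ↦ σ⁻¹ * τ := by ext; simp
  rw [h1] at h
  exact h

lemma ofLieAlgebra_one (v : E) : ofLieAlgebra (1 : G) v = v := by
  have h : (fun τ : G ↦ 1 * τ) = id := by ext; simp
  rw [ofLieAlgebra, h, mfderiv_id]
  rfl

variable [FiniteDimensional ℝ E]

lemma bracketCLM_jacobi (x y z : E) :
    bracketCLM E G (bracketCLM E G x y) z =
      bracketCLM E G x (bracketCLM E G y z) - bracketCLM E G y (bracketCLM E G x z) := by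
  have _ : LieGroup 𝓘(ℝ, E) (minSmoothness ℝ 3) G := lieGroup_minSmoothness
  have _ : CompleteSpace E := FiniteDimensional.complete ℝ E
  exact lie_lie (L := GroupLieAlgebra 𝓘(ℝ, E) G) (M := GroupLieAlgebra 𝓘(ℝ, E) G) x y z

/-- A left translation reads as the identity of `E` in the left trivialization, and the Christoffel
symbols do not depend on the point. -/
lemma isLeftInvariantConnection_frameConnection (B : E →L[ℝ] E →L[ℝ] E) :
    IsLeftInvariantConnection (frameConnection (M := G) toLieAlgebra ofLieAlgebra B) := by
  have _ : CompleteSpace E := FiniteDimensional.complete ℝ E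
  intro g
  refine isCoframe_toLieAlgebra.isAffineMap isCoframe_toLieAlgebra B B contMDiff_mul_left
    (fun _ ↦ ContinuousLinearMap.id ℝ E) (fun _ ↦ mdifferentiableAt_const)
    (fun σ v ↦ toLieAlgebra_mul_left g σ v) fun σ u y ↦ ?_
  rw [mvfderiv_const]
  simp

/-- The value of the form at the unit. -/
def SymplecticForm.atOne (Ω : SymplecticForm E G) : E →L[ℝ] E →L[ℝ] ℝ := Ω.toFun 1

lemma SymplecticForm.atOne_swap (Ω : SymplecticForm E G) (v w : E) :
    Ω.atOne v w = -Ω.atOne w v := by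
  have halt : ∀ v, Ω.atOne v v = 0 := Ω.alternating 1
  have h := halt (v + w)
  simp only [map_add, add_apply, halt] at h
  linarith

lemma SymplecticForm.atOne_nondegenerate (Ω : SymplecticForm E G) {v : E}
    (h : ∀ w, Ω.atOne v w = 0) : v = 0 := Ω.nondegenerate 1 v h

lemma SymplecticForm.IsLeftInvariant.eq_atOne {Ω : SymplecticForm E G} (hΩ : Ω.IsLeftInvariant)
    (σ : G) (v w : TangentSpace 𝓘(ℝ, E) σ) :
    Ω.toFun σ v w = Ω.atOne (toLieAlgebra σ v) (toLieAlgebra σ w) := by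
  rw [← hΩ σ⁻¹ σ v w]
  have : ∀ ρ : G, ρ = 1 → ∀ a b : E, Ω.toFun ρ a b = Ω.atOne a b := by
    rintro _ rfl; exact fun _ _ ↦ rfl
  exact this _ (inv_mul_cancel σ) _ _

/-- On left-invariant fields the functions `ω(x⁺, y⁺)` are constant, so only the bracket terms of
`dω = 0` survive. -/
lemma SymplecticForm.IsLeftInvariant.atOne_closed {Ω : SymplecticForm E G}
    (hΩ : Ω.IsLeftInvariant) (x y z : E) :
    Ω.atOne (bracketCLM E G x y) z = Ω.atOne (bracketCLM E G x z) y -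
      Ω.atOne (bracketCLM E G y z) x := by
  let inv : E → Π σ : G, TangentSpace 𝓘(ℝ, E) σ := fun x ↦ mulInvariantVectorField x
  have hs : ∀ x, IsSmoothField (inv x) := isSmoothField_mulInvariantVectorField (E := E) (G := G)
  have hθ : ∀ x σ, toLieAlgebra σ (inv x σ) = x := toLieAlgebra_mulInvariantVectorField
  have hc : ∀ x y, (fun σ : G ↦ Ω.toFun σ (inv x σ) (inv y σ)) = fun _ ↦ Ω.atOne x y := by
    intro x y; ext σ; rw [hΩ.eq_atOne, hθ, hθ]
  have h1 : ∀ x, inv x 1 = x := ofLieAlgebra_one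
  have h := Ω.closed (inv x) (inv y) (inv z) (hs x) (hs y) (hs z) 1
  rw [hc, hc, hc, mvfderiv_const, mvfderiv_const, mvfderiv_const, h1, h1, h1] at h
  have h2 : ∀ x y : E, (mlieBracket 𝓘(ℝ, E) (inv x) (inv y) 1 : E) = bracketCLM E G x y :=
    fun _ _ ↦ rfl
  have h3 : (0 : ℝ) - 0 + 0 - Ω.atOne (bracketCLM E G x y) z + Ω.atOne (bracketCLM E G x z) y -
      Ω.atOne (bracketCLM E G y z) x = 0 := h
  linarith

lemma atOne_leftSymOp (Ω : SymplecticForm E G) (x y z : E) :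
    Ω.atOne (leftSymOp Ω y x) z = -Ω.atOne y (bracketCLM E G x z) :=
  leftSymProd_spec Ω x y z

lemma SymplecticForm.atOne_ext (Ω : SymplecticForm E G) {v w : E}
    (h : ∀ z, Ω.atOne v z = Ω.atOne w z) : v = w := by
  rw [← sub_eq_zero]
  refine Ω.atOne_nondegenerate fun z ↦ ?_
  rw [map_sub, sub_apply, h, sub_self]

/-- The left symmetric product as a continuous bilinear map. -/
noncomputable def leftSymCLM (Ω : SymplecticForm E G) : E →L[ℝ] E →L[ℝ] E :=
  LinearMap.toContinuousLinearMap
    { toFun := leftSymOp Ω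
      map_add' := fun y y' ↦ by
        ext x
        refine Ω.atOne_ext fun z ↦ ?_
        rw [add_apply, map_add, add_apply, atOne_leftSymOp, atOne_leftSymOp, atOne_leftSymOp,
          map_add, add_apply, neg_add]
      map_smul' := fun c y ↦ by
        ext x
        refine Ω.atOne_ext fun z ↦ ?_
        rw [RingHom.id_apply, smul_apply, map_smul, smul_apply, atOne_leftSymOp, atOne_leftSymOp,
          map_smul, smul_apply, smul_neg] }

lemma atOne_leftSymCLM (Ω : SymplecticForm E G) (x y z : E) :
    Ω.atOne (leftSymCLM Ω y x) z = -Ω.atOne y (bracketCLM E G x z) :=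
  leftSymProd_spec Ω x y z

lemma canonicalConnection_eq_frameConnection (Ω : SymplecticForm E G) :
    canonicalConnection Ω = frameConnection toLieAlgebra ofLieAlgebra (leftSymCLM Ω) := rfl

/-- Paired with `z`, the left side is `-ω(y, [x, z]) + ω(x, [y, z])`, which closedness identifies
with `ω([x, y], z)`. -/
lemma SymplecticForm.IsLeftInvariant.leftSymCLM_sub {Ω : SymplecticForm E G}
    (hΩ : Ω.IsLeftInvariant) (x y : E) :
    leftSymCLM Ω y x - leftSymCLM Ω x y = bracketCLM E G x y := by
  refine Ω.atOne_ext fun z ↦ ?_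
  rw [map_sub, sub_apply, atOne_leftSymCLM, atOne_leftSymCLM, hΩ.atOne_closed, Ω.atOne_swap y,
    Ω.atOne_swap x]
  ring

/-- Left multiplication by `x` is minus the `ω`-transpose of `ad x`, that is, the coadjoint
representation carried over by `ω`; the Jacobi identity makes it a representation. -/
lemma leftSymCLM_leftSymCLM_sub (Ω : SymplecticForm E G) (x y z : E) :
    leftSymCLM Ω (leftSymCLM Ω z y) x - leftSymCLM Ω (leftSymCLM Ω z x) y =
      leftSymCLM Ω z (bracketCLM E G x y) := by
  refine Ω.atOne_ext fun w ↦ ?_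
  rw [map_sub, sub_apply, atOne_leftSymCLM, atOne_leftSymCLM, atOne_leftSymCLM, atOne_leftSymCLM,
    atOne_leftSymCLM, bracketCLM_jacobi, map_sub]
  ring

lemma SymplecticForm.IsLeftInvariant.isAffineStructure {Ω : SymplecticForm E G}
    (hΩ : Ω.IsLeftInvariant) : IsAffineStructure (canonicalConnection Ω) := by
  have _ : CompleteSpace E := FiniteDimensional.complete ℝ E
  rw [canonicalConnection_eq_frameConnection]
  exact isCoframe_toLieAlgebra.isAffineStructure (leftSymCLM Ω) hΩ.leftSymCLM_sub (leftSymCLM_leftSymCLM_sub Ω)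

end Group

/-! ### Connected groups and automatic continuity of homomorphisms -/

section Topological

variable {N : Type*} [TopologicalSpace N] [Group N] [IsTopologicalGroup N]

lemma _root_.Subgroup.eq_top_of_mem_nhds_one [ConnectedSpace N] {S : Subgroup N}
    (hS : (S : Set N) ∈ 𝓝 1) : S = ⊤ := by
  have ho : IsOpen (S : Set N) := S.isOpen_of_mem_nhds hS
  have hc : IsClosed (S : Set N) := OpenSubgroup.isClosed ⟨S, ho⟩
  exact SetLike.coe_injective (IsClopen.eq_univ ⟨hc, ho⟩ ⟨1, S.one_mem⟩)

/-- A connected locally compact group is `σ`-compact. -/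
lemma sigmaCompactSpace_of_connectedSpace [ConnectedSpace N] [LocallyCompactSpace N] :
    SigmaCompactSpace N := by
  obtain ⟨V, hV, hV1⟩ := exists_compact_mem_nhds (1 : N)
  open scoped Pointwise in
  let W : Set N := V ∪ V⁻¹
  have hW : IsCompact W := hV.union hV.inv
  have hinv : W⁻¹ = W := by simp [W, Set.union_comm]
  have hpow : ∀ n : ℕ, IsCompact (W ^ n) := fun n ↦ by
    induction n with
    | zero => simp
    | succ n ih => rw [pow_succ]; exact ih.mul hW
  let S : Subgroup N :=
    { carrier := ⋃ n : ℕ, W ^ n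
      one_mem' := Set.mem_iUnion.2 ⟨0, by simp⟩
      mul_mem' := by
        intro a b ha hb
        obtain ⟨m, hm⟩ := Set.mem_iUnion.1 ha
        obtain ⟨n, hn⟩ := Set.mem_iUnion.1 hb
        exact Set.mem_iUnion.2 ⟨m + n, by rw [pow_add]; exact Set.mul_mem_mul hm hn⟩
      inv_mem' := by
        intro a ha
        obtain ⟨m, hm⟩ := Set.mem_iUnion.1 ha
        exact Set.mem_iUnion.2 ⟨m, by rw [← hinv, inv_pow]; simpa using hm⟩ }
  have hS : S = ⊤ := by
    apply Subgroup.eq_top_of_mem_nhds_one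
    refine Filter.mem_of_superset hV1 fun x hx ↦ Set.mem_iUnion.2 ⟨1, ?_⟩
    rw [pow_one]; exact Or.inl hx
  exact ⟨⟨fun n ↦ W ^ n, hpow, congrArg (fun T : Subgroup N ↦ (T : Set N)) hS⟩⟩

/-- A homomorphism is continuous if its composition with an injective continuous homomorphism is. -/
lemma continuous_of_comp_injective {G : Type*} [TopologicalSpace G] [T2Space G] [Group G]
    [T2Space N] [LocallyCompactSpace N] [SigmaCompactSpace N] {j f : N →* G} {h : N →* N}
    (hj : Continuous j) (hinj : Function.Injective j) (hf : Continuous f)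
    (hjh : ∀ n, j (h n) = f n) : Continuous h := by
  let Γ : Subgroup (N × N) := h.graph
  -- Injectivity of `j` expresses the graph through the continuous maps `f` and `j` alone, so it is
  -- closed.
  have hΓ : (Γ : Set (N × N)) = {p | f p.1 = j p.2} := by
    ext p
    change h p.1 = p.2 ↔ f p.1 = j p.2
    rw [← hjh, hinj.eq_iff]
  have hcl : IsClosed (Γ : Set (N × N)) := by
    rw [hΓ]; exact isClosed_eq (hf.comp continuous_fst) (hj.comp continuous_snd)
  have _ : SigmaCompactSpace Γ := hcl.isClosedEmbedding_subtypeVal.sigmaCompactSpace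
  -- The first projection of the graph is a continuous surjective homomorphism from a σ-compact
  -- group, hence open. It is also injective, and `h` is its inverse followed by the second
  -- projection.
  let p : Γ →* N := (MonoidHom.fst N N).comp Γ.subtype
  have hp : IsOpenMap p := by
    refine p.isOpenMap_of_sigmaCompact (fun n ↦ ⟨⟨(n, h n), rfl⟩, rfl⟩) ?_
    exact continuous_fst.comp continuous_subtype_val
  refine continuous_def.2 fun U hU ↦ ?_
  have : h ⁻¹' U = p '' ((fun x : Γ ↦ x.1.2) ⁻¹' U) := by
    ext n
    constructor
    · intro hn; exact ⟨⟨(n, h n), rfl⟩, hn, rfl⟩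
    · rintro ⟨⟨⟨a, b⟩, hab⟩, hb, rfl⟩
      have hab' : h a = b := hab
      change h a ∈ U
      rw [hab']; exact hb
  rw [this]
  exact hp _ (hU.preimage (continuous_snd.comp continuous_subtype_val))

end Topological

/-- If `f = g ∘ h` near `a` with `h` continuous and `g` an immersion, then the derivative of `f`
takes values in the range of that of `g`. -/
lemma exists_fderiv_eq_of_comp_continuousAt {F E D : Type*} [NormedAddCommGroup F]
    [NormedSpace ℝ F] [NormedAddCommGroup E] [NormedSpace ℝ E] [NormedAddCommGroup D]
    [NormedSpace ℝ D] [FiniteDimensional ℝ E] [FiniteDimensional ℝ D]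
    {f : F → E} {g : D → E} {h : F → D} {a : F}
    (hf : DifferentiableAt ℝ f a) (hg : ContDiffAt ℝ ∞ g (h a))
    (hginj : Function.Injective (fderiv ℝ g (h a))) (hh : ContinuousAt h a)
    (hfgh : f =ᶠ[𝓝 a] g ∘ h) (v : F) : ∃ w, fderiv ℝ f a v = fderiv ℝ g (h a) w := by
  have _ : CompleteSpace D := FiniteDimensional.complete ℝ D
  have _ : CompleteSpace E := FiniteDimensional.complete ℝ E
  -- With a left inverse `R` of the derivative, `R ∘ g` has a local inverse `q`. Continuity of `h`
  -- gives `h = q ∘ R ∘ f` near `a`, so `h` is differentiable and the chain rule applies to `g ∘ h`.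
  obtain ⟨R₀, hR₀⟩ := LinearMap.exists_leftInverse_of_injective
    (fderiv ℝ g (h a)).toLinearMap (LinearMap.ker_eq_bot.2 hginj)
  let R : E →L[ℝ] D := LinearMap.toContinuousLinearMap R₀
  have hR : R ∘L fderiv ℝ g (h a) = ContinuousLinearMap.id ℝ D := by
    ext w; exact LinearMap.congr_fun hR₀ w
  have hs : HasStrictFDerivAt (R ∘ g) ((ContinuousLinearEquiv.refl ℝ D : D ≃L[ℝ] D) : D →L[ℝ] D)
      (h a) := by
    have := R.hasStrictFDerivAt.comp (h a) (hg.hasStrictFDerivAt (by simp))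
    rw [hR] at this; exact this
  have hq := hs.to_localInverse.hasFDerivAt
  set q := hs.localInverse (R ∘ g) _ (h a) with hqdef
  have hev : h =ᶠ[𝓝 a] q ∘ (R ∘ f) := by
    filter_upwards [hfgh, hh.tendsto.eventually hs.eventually_left_inverse] with b hb1 hb2
    have : R (f b) = (R ∘ g) (h b) := by rw [hb1]; rfl
    simp only [Function.comp_apply] at this ⊢
    rw [this]; exact hb2.symm
  have hfa : f a = g (h a) := hfgh.self_of_nhds
  have hRf : HasFDerivAt (R ∘ f) (R ∘L fderiv ℝ f a) a :=
    R.hasFDerivAt.comp a hf.hasFDerivAt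
  have hRfa : (R ∘ f) a = (R ∘ g) (h a) := by simp [hfa]
  rw [← hRfa] at hq
  have hdh : DifferentiableAt ℝ h a :=
    ((hq.comp a hRf).congr_of_eventuallyEq hev).differentiableAt
  refine ⟨fderiv ℝ h a v, ?_⟩
  rw [hfgh.fderiv_eq, fderiv_comp a (hg.differentiableAt (by simp)) hdh]
  rfl

/-! ### Conjugation and the Lie algebra of a normal immersed subgroup -/

section Group

variable {E : Type*} [NormedAddCommGroup E] [NormedSpace ℝ E] [FiniteDimensional ℝ E]
  {G : Type*} [TopologicalSpace G] [ChartedSpace E G] [Group G]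
  [LieGroup 𝓘(ℝ, E) ∞ G]

lemma t2Space_of_lieGroup (E : Type*) [NormedAddCommGroup E] [NormedSpace ℝ E]
    (G : Type*) [TopologicalSpace G] [ChartedSpace E G] [Group G]
    [LieGroup 𝓘(ℝ, E) ∞ G] : T2Space G := by
  have _ : T1Space G := ChartedSpace.t1Space E G
  have _ : IsTopologicalGroup G := topologicalGroup_of_lieGroup 𝓘(ℝ, E) ∞
  infer_instance

/-- The range of the derivative at the unit of an injective immersion of connected Lie groups
with normal image is invariant under conjugation. -/
lemma exists_mfderiv_eq_toLieAlgebra_rightField {E' : Type*} [NormedAddCommGroup E']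
    [NormedSpace ℝ E'] [FiniteDimensional ℝ E']
    {N : Type*} [TopologicalSpace N] [ChartedSpace E' N] [Group N]
    [LieGroup 𝓘(ℝ, E') ∞ N] [ConnectedSpace N] (j : N →* G)
    (hj : ContMDiff 𝓘(ℝ, E') 𝓘(ℝ, E) ∞ j) (hinj : Function.Injective j)
    (himm : Function.Injective (mfderiv 𝓘(ℝ, E') 𝓘(ℝ, E) j 1)) (hnormal : j.range.Normal)
    (w : E') (σ : G) :
    ∃ w' : E', (mfderiv 𝓘(ℝ, E') 𝓘(ℝ, E) j 1 w' : E) =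
      toLieAlgebra (E := E) σ (rightField (mfderiv 𝓘(ℝ, E') 𝓘(ℝ, E) j 1 w : E) σ) := by
  have _ : IsTopologicalGroup N := topologicalGroup_of_lieGroup 𝓘(ℝ, E') ∞
  have _ : IsTopologicalGroup G := topologicalGroup_of_lieGroup 𝓘(ℝ, E) ∞
  have _ : T2Space N := t2Space_of_lieGroup E' N
  have _ : T2Space G := t2Space_of_lieGroup E G
  have _ : LocallyCompactSpace N := ChartedSpace.locallyCompactSpace E' N
  have _ : SigmaCompactSpace N := sigmaCompactSpace_of_connectedSpace
  -- By normality this conjugate of `j` factors as `j ∘ h`, at first with an abstract homomorphism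
  -- `h` of `N`. The topology of `N` may be finer than that of the image, so continuity of `h` needs
  -- the closed graph argument.
  let f : N →* G := (MulAut.conj σ⁻¹).toMonoidHom.comp j
  have hfe : ∀ n, f n = σ⁻¹ * j n * σ := fun n ↦ by simp [f]
  have hmem : ∀ n, ∃ m, j m = f n := fun n ↦ by
    rw [hfe]; simpa using hnormal.conj_mem (j n) ⟨n, rfl⟩ σ⁻¹
  choose h₀ hh₀ using hmem
  let h : N →* N :=
    { toFun := h₀
      map_one' := hinj (by simp [hh₀])
      map_mul' := fun a b ↦ hinj (by simp [hh₀]) }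
  have hfs : ContMDiff 𝓘(ℝ, E') 𝓘(ℝ, E) ∞ f := by
    have : (f : N → G) = fun n ↦ σ⁻¹ * j n * σ := funext hfe
    rw [this]; exact (contMDiff_const.mul hj).mul contMDiff_const
  have hhc : Continuous h :=
    continuous_of_comp_injective hj.continuous hinj hfs.continuous hh₀
  set φ : G → E := fun g ↦ extChartAt 𝓘(ℝ, E) (1 : G) g with hφ
  have hφd : MDifferentiableAt 𝓘(ℝ, E) 𝓘(ℝ, E) φ 1 :=
    mdifferentiableAt_extChartAt (mem_chart_source E 1)
  have hφs : ContMDiffAt 𝓘(ℝ, E) 𝓘(ℝ, E) ∞ φ 1 := contMDiffAt_extChartAt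
  have hjd : MDifferentiableAt 𝓘(ℝ, E') 𝓘(ℝ, E) j 1 := hj.mdifferentiable (by simp) 1
  have hfd : MDifferentiableAt 𝓘(ℝ, E') 𝓘(ℝ, E) f 1 := hfs.mdifferentiable (by simp) 1
  have hφj : ContMDiffAt 𝓘(ℝ, E') 𝓘(ℝ, E) ∞ (φ ∘ j) 1 :=
    hφs.comp_of_eq (hj 1) (map_one j)
  have hφf : ContMDiffAt 𝓘(ℝ, E') 𝓘(ℝ, E) ∞ (φ ∘ f) 1 :=
    hφs.comp_of_eq (hfs 1) (map_one f)
  set χ := extChartAt 𝓘(ℝ, E') (1 : N) with hχ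
  have ha : χ.symm (χ 1) = 1 := extChartAt_to_inv 1
  have ej : ∀ v : E', fderiv ℝ ((φ ∘ j) ∘ χ.symm) (χ 1) v =
      mvfderiv 𝓘(ℝ, E) φ 1 (mfderiv 𝓘(ℝ, E') 𝓘(ℝ, E) j 1 v : E) := fun v ↦
    (mvfderiv_eq_fderiv (hφj.mdifferentiableAt (by simp)) v).symm.trans
      (mvfderiv_comp_of_eq' hφd hjd (map_one j) v)
  have ef : ∀ v : E', fderiv ℝ ((φ ∘ f) ∘ χ.symm) (χ 1) v =
      mvfderiv 𝓘(ℝ, E) φ 1 (mfderiv 𝓘(ℝ, E') 𝓘(ℝ, E) f 1 v : E) := fun v ↦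
    (mvfderiv_eq_fderiv (hφf.mdifferentiableAt (by simp)) v).symm.trans
      (mvfderiv_comp_of_eq' hφd hfd (map_one f) v)
  have hφinj := injective_mvfderiv_extChartAt (E := E) (1 : G)
  have hcs : ContinuousAt χ.symm (χ 1) := continuousAt_extChartAt_symm 1
  set hh : E' → E' := χ ∘ h ∘ χ.symm with hhh
  have hh1 : hh (χ 1) = χ 1 := by simp [hhh, ha]
  have key := exists_fderiv_eq_of_comp_continuousAt (f := (φ ∘ f) ∘ χ.symm)
    (g := (φ ∘ j) ∘ χ.symm) (h := hh) (a := χ 1)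
    (hφf.contDiffAt_comp_extChartAt_symm.differentiableAt (by simp))
    (by rw [hh1]; exact hφj.contDiffAt_comp_extChartAt_symm)
    (by
      rw [hh1]
      intro v w hvw
      exact himm (hφinj ((ej v).symm.trans (hvw.trans (ej w)))))
    (by
      refine ContinuousAt.comp (g := χ) ?_ (hhc.continuousAt.comp hcs)
      simp only [Function.comp_apply, ha, map_one]
      exact continuousAt_extChartAt 1)
    (by
      have : Filter.Tendsto (h ∘ χ.symm) (𝓝 (χ 1)) (𝓝 1) := by
        have := (hhc.continuousAt.comp hcs).tendsto
        simpa [ha] using this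
      filter_upwards [this.eventually (extChartAt_source_mem_nhds (I := 𝓘(ℝ, E')) (1 : N))]
        with b hb
      have e1 : χ.symm (χ (h (χ.symm b))) = h (χ.symm b) := χ.left_inv hb
      simp only [Function.comp_apply, hhh, e1]
      exact congrArg φ (hh₀ _).symm)
    w
  obtain ⟨w', hw'⟩ := key
  rw [hh1] at hw'
  refine ⟨w', ?_⟩
  have e1 : (mfderiv 𝓘(ℝ, E') 𝓘(ℝ, E) j 1 w' : E) = (mfderiv 𝓘(ℝ, E') 𝓘(ℝ, E) f 1 w : E) :=
    hφinj ((ej w').symm.trans (hw'.symm.trans (ef w)))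
  rw [e1]
  have c1 : (f : N → G) = (fun τ ↦ σ⁻¹ * τ) ∘ ((fun τ ↦ τ * σ) ∘ j) := by
    ext n; simp [hfe, mul_assoc]
  have d1 := mfderiv_comp_apply_of_eq (1 : N) (mdifferentiableAt_mul_right (E := E) σ 1) hjd
    (map_one j) w
  have d2 := mfderiv_comp_apply_of_eq (1 : N) (mdifferentiableAt_mul_left (E := E) σ⁻¹ σ)
    ((mdifferentiableAt_mul_right (E := E) σ 1).comp_of_eq _ hjd (map_one j))
    (by simp) w
  rw [← c1] at d2
  refine Eq.trans d2 ?_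
  exact congrArg (toLieAlgebra (E := E) σ) d1

end Group

/-! ### Functions determined by their derivative -/

section Manifold

variable {E : Type*} [NormedAddCommGroup E] [NormedSpace ℝ E] [CompleteSpace E]
  {M : Type*} [TopologicalSpace M] [ChartedSpace E M] [IsManifold 𝓘(ℝ, E) ∞ M]
  {F : Type*} [NormedAddCommGroup F] [NormedSpace ℝ F]

lemma isLocallyConstant_of_mvfderiv_eq_zero {f : M → F}
    (hf : MDifferentiable 𝓘(ℝ, E) 𝓘(ℝ, F) f) (h : ∀ x v, mvfderiv 𝓘(ℝ, E) f x v = 0) :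
    IsLocallyConstant f := by
  refine (IsLocallyConstant.iff_eventually_eq f).2 fun x ↦ ?_
  set χ := extChartAt 𝓘(ℝ, E) x with hχ
  have hopen : IsOpen χ.target := isOpen_extChartAt_target x
  have hd : ∀ u ∈ χ.target, MDifferentiableAt 𝓘(ℝ, E) 𝓘(ℝ, E) χ.symm u := fun u hu ↦
    ((contMDiffOn_extChartAt_symm (n := ∞) x).contMDiffAt (hopen.mem_nhds hu)).mdifferentiableAt
      (by simp)
  have hd' : ∀ u ∈ χ.target, DifferentiableAt ℝ (f ∘ χ.symm) u := fun u hu ↦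
    ((hf _).comp u (hd u hu)).differentiableAt
  have hz : ∀ u ∈ χ.target, fderiv ℝ (f ∘ χ.symm) u = 0 := fun u hu ↦ by
    rw [← mfderiv_eq_fderiv]
    ext v
    exact (mfderiv_comp_apply u (hf _) (hd u hu) v).trans (h _ _)
  obtain ⟨ε, hε, hball⟩ := Metric.isOpen_iff.1 hopen (χ x) (mem_extChartAt_target x)
  have hn : ∀ᶠ y in 𝓝 x, χ y ∈ Metric.ball (χ x) ε :=
    (continuousAt_extChartAt (I := 𝓘(ℝ, E)) x).eventually (Metric.ball_mem_nhds _ hε)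
  filter_upwards [hn, extChartAt_source_mem_nhds (I := 𝓘(ℝ, E)) x] with y hy hys
  have := (convex_ball (χ x) ε).is_const_of_fderivWithin_eq_zero (𝕜 := ℝ) (f := f ∘ χ.symm)
    (fun u hu ↦ (hd' u (hball hu)).differentiableWithinAt)
    (fun u hu ↦ by rw [fderivWithin_of_isOpen Metric.isOpen_ball hu]; exact hz u (hball hu))
    hy (Metric.mem_ball_self hε)
  have e1 : χ.symm (χ y) = y := χ.left_inv hys
  have e2 : χ.symm (χ x) = x := extChartAt_to_inv x
  simpa only [Function.comp_apply, e1, e2] using this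

lemma eq_of_mvfderiv_eq [PreconnectedSpace M] {f g : M → F}
    (hf : MDifferentiable 𝓘(ℝ, E) 𝓘(ℝ, F) f) (hg : MDifferentiable 𝓘(ℝ, E) 𝓘(ℝ, F) g)
    (h : ∀ x v, mvfderiv 𝓘(ℝ, E) f x v = mvfderiv 𝓘(ℝ, E) g x v) {a : M} (ha : f a = g a) :
    f = g := by
  have hlc : IsLocallyConstant (fun x ↦ f x - g x) := by
    refine isLocallyConstant_of_mvfderiv_eq_zero (E := E)
      (fun x ↦ ((hf x).sub (hg x))) fun x v ↦ ?_
    have : mvfderiv 𝓘(ℝ, E) (fun x ↦ f x - g x) x = mvfderiv 𝓘(ℝ, E) f x - mvfderiv 𝓘(ℝ, E) g x :=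
      mvfderiv_sub (hf x) (hg x)
    rw [this, sub_apply, h, sub_self]
  ext x
  have := hlc.apply_eq_of_preconnectedSpace x a
  simpa [ha, sub_eq_zero] using this

/-- A linear projection with kernel `S` annihilates `f`, hence also its derivative. -/
lemma mvfderiv_mem_of_forall_mem [FiniteDimensional ℝ F] {f : M → F} {x : M}
    (hf : MDifferentiableAt 𝓘(ℝ, E) 𝓘(ℝ, F) f x) {S : Submodule ℝ F} (hS : ∀ y, f y ∈ S)
    (v : TangentSpace 𝓘(ℝ, E) x) : mvfderiv 𝓘(ℝ, E) f x v ∈ S := by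
  obtain ⟨T, hT⟩ := S.exists_isCompl
  let p : F →L[ℝ] F := LinearMap.toContinuousLinearMap (T.projection S hT.symm)
  have hker : ∀ y, p y = 0 ↔ y ∈ S := fun y ↦ by
    change T.projection S hT.symm y = 0 ↔ y ∈ S
    rw [← LinearMap.mem_ker, Submodule.ker_projection]
  rw [← hker]
  have h1 : (p ∘ f : M → F) = fun _ ↦ 0 := funext fun y ↦ (hker _).2 (hS y)
  have h2 := mfderiv_comp_apply x (p.mdifferentiableAt (x := f x)) hf v
  rw [h1, mfderiv_const] at h2
  have h3 : mfderiv 𝓘(ℝ, F) 𝓘(ℝ, F) p (f x) = p := p.mfderiv_eq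
  rw [h3] at h2
  exact h2.symm

end Manifold

/-! ### The adjoint action and normalized momentum maps -/

section Group

variable {E : Type*} [NormedAddCommGroup E] [NormedSpace ℝ E]
  {G : Type*} [TopologicalSpace G] [ChartedSpace E G] [Group G]
  [LieGroup 𝓘(ℝ, E) ∞ G]

/-- The adjoint action `Ad(σ⁻¹)`, on the space `E` underlying the Lie algebra. -/
noncomputable def adInv (σ : G) : E →L[ℝ] E :=
  mfderiv 𝓘(ℝ, E) 𝓘(ℝ, E) (fun τ : G ↦ σ⁻¹ * (τ * σ)) 1

lemma mdifferentiableAt_conj (σ τ : G) :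
    MDifferentiableAt 𝓘(ℝ, E) 𝓘(ℝ, E) (fun τ : G ↦ σ⁻¹ * (τ * σ)) τ :=
  (mdifferentiableAt_mul_left (E := E) σ⁻¹ (τ * σ)).comp τ (mdifferentiableAt_mul_right σ τ)

lemma adInv_apply (σ : G) (x : E) :
    adInv σ x = toLieAlgebra (E := E) σ (rightField (E := E) (G := G) x σ) :=
  mfderiv_comp_apply_of_eq (1 : G) (mdifferentiableAt_mul_left (E := E) σ⁻¹ σ)
    (mdifferentiableAt_mul_right (E := E) σ 1) (one_mul σ) x

/-- The order is reversed because `adInv σ` stands for `Ad(σ⁻¹)`. -/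
lemma adInv_mul (σ τ : G) (x : E) : adInv (σ * τ) x = adInv τ (adInv (E := E) σ x) := by
  have h := mfderiv_comp_apply_of_eq (1 : G) (mdifferentiableAt_conj (E := E) τ 1)
    (mdifferentiableAt_conj (E := E) σ 1) (by simp) x
  have h1 : (fun ρ : G ↦ τ⁻¹ * (ρ * τ)) ∘ (fun ρ : G ↦ σ⁻¹ * (ρ * σ)) =
      fun ρ ↦ (σ * τ)⁻¹ * (ρ * (σ * τ)) := by
    ext ρ; simp [mul_assoc]
  rw [h1] at h
  exact h

lemma adInv_one (x : E) : adInv (1 : G) x = x := by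
  have h1 : (fun ρ : G ↦ (1 : G)⁻¹ * (ρ * 1)) = id := by ext; simp
  rw [adInv, h1, mfderiv_id]
  rfl

lemma adInv_inv_apply (σ : G) (x : E) : adInv σ⁻¹ (adInv (E := E) σ x) = x := by
  rw [← adInv_mul, mul_inv_cancel, adInv_one]

lemma adInv_injective (σ : G) : Function.Injective (adInv (E := E) σ) :=
  Function.LeftInverse.injective (adInv_inv_apply σ)

variable (G) in
/-- A subspace of the Lie algebra is invariant under the adjoint action of `G`. -/
def IsAdInvariant (S : Submodule ℝ E) : Prop := ∀ σ : G, ∀ x ∈ S, adInv σ x ∈ S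

variable [FiniteDimensional ℝ E]

lemma IsConnectedLieSubgroup.isAdInvariant {H : Subgroup G}
    {𝔥 : Submodule ℝ (GroupLieAlgebra 𝓘(ℝ, E) G)} (hH : IsConnectedLieSubgroup H 𝔥)
    (hnormal : H.Normal) : IsAdInvariant (E := E) G 𝔥 := by
  obtain ⟨k, N, _, _, _, _, j, _, hinj, rfl, hj, himm, hmem⟩ := hH
  intro σ x hx
  obtain ⟨w, hw⟩ := (hmem x).1 hx
  obtain ⟨w', hw'⟩ := exists_mfderiv_eq_toLieAlgebra_rightField j hj hinj (himm 1) hnormal w σ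
  refine (hmem _).2 ⟨w', hw'.trans ?_⟩
  rw [adInv_apply]
  exact congrArg (fun y : E ↦ toLieAlgebra (E := E) σ (rightField (E := E) (G := G) y σ)) hw

lemma mvfderiv_adInv (x : E) (σ : G) (v : TangentSpace 𝓘(ℝ, E) σ) :
    mvfderiv 𝓘(ℝ, E) (fun τ : G ↦ adInv (E := E) τ x) σ v =
      -bracketCLM E G (toLieAlgebra (E := E) σ v) (adInv σ x) := by
  have h : (fun τ : G ↦ adInv (E := E) τ x) = fun τ ↦ toLieAlgebra (E := E) τ (rightField x τ) :=
    funext fun τ ↦ adInv_apply τ x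
  rw [h]
  refine (mvfderiv_toLieAlgebra_rightField (E := E) (G := G) x σ v).trans ?_
  rw [adInv_apply]

lemma contMDiff_adInv (x : E) :
    ContMDiff 𝓘(ℝ, E) 𝓘(ℝ, E) ∞ (fun τ : G ↦ adInv (E := E) τ x) := by
  have _ : CompleteSpace E := FiniteDimensional.complete ℝ E
  have h : (fun τ : G ↦ adInv (E := E) τ x) = fun τ ↦ toLieAlgebra (E := E) τ (rightField x τ) :=
    funext fun τ ↦ adInv_apply τ x
  rw [h]
  exact contMDiff_toLieAlgebra (isSmoothField_rightField x)

/-- A subspace invariant under the adjoint action of the group is an ideal of its Lie algebra. -/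
lemma IsAdInvariant.bracket_mem {S : Submodule ℝ E} (hS : IsAdInvariant G S) {x : E} (hx : x ∈ S)
    (z : E) : bracketCLM E G z x ∈ S := by
  have _ : CompleteSpace E := FiniteDimensional.complete ℝ E
  have h := mvfderiv_mem_of_forall_mem (f := fun τ : G ↦ adInv (E := E) τ x)
    ((contMDiff_adInv x).mdifferentiable (by simp) 1) (fun τ ↦ hS τ x hx) (ofLieAlgebra (1 : G) z)
  rw [mvfderiv_adInv, toLieAlgebra_ofLieAlgebra, adInv_one] at h
  simpa using S.neg_mem h

/-- A normalized momentum map in coordinates. -/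
structure IsMomentum (Ω : SymplecticForm E G) {r : ℕ} (b : Fin r → E)
    (J : G → EuclideanSpace ℝ (Fin r)) : Prop where
  contMDiff : ContMDiff 𝓘(ℝ, E) 𝓘(ℝ, EuclideanSpace ℝ (Fin r)) ∞ J
  map_one : J 1 = 0
  mvfderiv_apply : ∀ (σ : G) (v : TangentSpace 𝓘(ℝ, E) σ) (i : Fin r),
    mvfderiv 𝓘(ℝ, E) J σ v i = Ω.atOne (adInv σ (b i)) (toLieAlgebra (E := E) σ v)

variable {Ω : SymplecticForm E G} {r : ℕ} {b : Fin r → E} {J : G → EuclideanSpace ℝ (Fin r)}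

lemma IsMomentum.mdifferentiableAt (h : IsMomentum Ω b J) (σ : G) :
    MDifferentiableAt 𝓘(ℝ, E) 𝓘(ℝ, EuclideanSpace ℝ (Fin r)) J σ :=
  h.contMDiff.mdifferentiable (by simp) σ

/-- Take the components of the given momentum map along the `b i`, minus their values at the unit.
The formula for the derivative comes from left invariance of the form and `σ⁻¹ x⁻(σ) = Ad(σ⁻¹) x`.
-/
lemma IsHamiltonian.exists_isMomentum (hΩ : Ω.IsLeftInvariant) {S : Submodule ℝ E}
    (hS : IsHamiltonian (G := G) Ω S) (b : Fin r → E) (hb : ∀ i, b i ∈ S) :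
    ∃ J : G → EuclideanSpace ℝ (Fin r), IsMomentum Ω b J := by
  have _ : CompleteSpace E := FiniteDimensional.complete ℝ E
  obtain ⟨J₀, hJ₀⟩ := hS
  let f : G → Fin r → ℝ := fun σ i ↦ J₀ σ ⟨b i, hb i⟩ - J₀ 1 ⟨b i, hb i⟩
  let e := (EuclideanSpace.equiv (Fin r) ℝ).symm
  have hf : ContMDiff 𝓘(ℝ, E) 𝓘(ℝ, Fin r → ℝ) ∞ f :=
    contMDiff_pi_space.2 fun i ↦ (hJ₀ ⟨b i, hb i⟩).1.sub contMDiff_const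
  have hs : ContMDiff 𝓘(ℝ, E) 𝓘(ℝ, EuclideanSpace ℝ (Fin r)) ∞ (fun σ ↦ e (f σ)) :=
    (e.contDiff.contMDiff).comp hf
  refine ⟨fun σ ↦ e (f σ), hs, ?_, fun σ v i ↦ ?_⟩
  · have : f 1 = 0 := by ext i; simp [f]
    simp only [this, map_zero]
  · let p : EuclideanSpace ℝ (Fin r) →L[ℝ] ℝ := EuclideanSpace.proj i
    have h1 := mfderiv_comp_apply σ (p.mdifferentiableAt (x := e (f σ)))
      (hs.mdifferentiable (by simp) σ) v
    have h3 : mfderiv 𝓘(ℝ, EuclideanSpace ℝ (Fin r)) 𝓘(ℝ, ℝ) p (e (f σ)) = p := p.mfderiv_eq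
    rw [h3] at h1
    have h4 : (p ∘ fun σ ↦ e (f σ)) = fun σ ↦ J₀ σ ⟨b i, hb i⟩ - J₀ 1 ⟨b i, hb i⟩ := rfl
    have h5 : mvfderiv 𝓘(ℝ, E) (fun σ ↦ J₀ σ ⟨b i, hb i⟩ - J₀ 1 ⟨b i, hb i⟩) σ =
        mvfderiv 𝓘(ℝ, E) (fun σ ↦ J₀ σ ⟨b i, hb i⟩) σ -
          mvfderiv 𝓘(ℝ, E) (fun _ : G ↦ J₀ 1 ⟨b i, hb i⟩) σ :=
      mvfderiv_sub ((hJ₀ ⟨b i, hb i⟩).1.mdifferentiable (by simp) σ) mdifferentiableAt_const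
    rw [mvfderiv_const, sub_zero] at h5
    rw [h4] at h1
    refine Eq.trans h1.symm ((DFunLike.congr_fun h5 v).trans ?_)
    refine ((hJ₀ ⟨b i, hb i⟩).2 σ v).trans ?_
    rw [adInv_apply]
    exact hΩ.eq_atOne σ _ v

/-- The momentum map is equivariant for an affine action. -/
lemma IsMomentum.exists_cocycle [ConnectedSpace G] (h : IsMomentum Ω b J)
    (hS : IsAdInvariant G (Submodule.span ℝ (Set.range b))) (g : G) :
    ∃ A : EuclideanSpace ℝ (Fin r) →L[ℝ] EuclideanSpace ℝ (Fin r),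
      ∀ τ, J (g * τ) = A (J τ) + J g := by
  have _ : CompleteSpace E := FiniteDimensional.complete ℝ E
  -- The matrix of `Ad(g⁻¹)` on the span of the `b i`, available by `Ad`-invariance; it is the
  -- linear part `A`.
  have hc : ∀ i, ∃ c : Fin r → ℝ, ∑ k, c k • b k = adInv g (b i) := fun i ↦
    (Submodule.mem_span_range_iff_exists_fun ℝ).1 (hS g (b i) (Submodule.subset_span ⟨i, rfl⟩))
  choose c hc using hc
  let A : EuclideanSpace ℝ (Fin r) →L[ℝ] EuclideanSpace ℝ (Fin r) :=
    LinearMap.toContinuousLinearMap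
      ((WithLp.linearEquiv 2 ℝ (Fin r → ℝ)).symm.toLinearMap ∘ₗ Matrix.toLin' (Matrix.of c) ∘ₗ
        (WithLp.linearEquiv 2 ℝ (Fin r → ℝ)).toLinearMap)
  have hA : ∀ u i, A u i = ∑ k, c i k * u k := fun u i ↦ by
    simp [A, Matrix.mulVec, dotProduct]
  refine ⟨A, fun τ ↦ ?_⟩
  have h1 : MDifferentiable 𝓘(ℝ, E) 𝓘(ℝ, EuclideanSpace ℝ (Fin r)) (J ∘ fun τ ↦ g * τ) :=
    fun τ ↦ (h.mdifferentiableAt _).comp τ (mdifferentiableAt_mul_left g τ)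
  have h2 : MDifferentiable 𝓘(ℝ, E) 𝓘(ℝ, EuclideanSpace ℝ (Fin r)) (A ∘ J) :=
    fun τ ↦ A.mdifferentiableAt.comp τ (h.mdifferentiableAt τ)
  have h3 : MDifferentiable 𝓘(ℝ, E) 𝓘(ℝ, EuclideanSpace ℝ (Fin r)) (fun τ ↦ (A ∘ J) τ + J g) :=
    fun τ ↦ (h2 τ).add mdifferentiableAt_const
  -- The derivatives agree since `Ad((gσ)⁻¹) = Ad(σ⁻¹) Ad(g⁻¹)` and left translation by `g` is
  -- invisible in the left trivialization; at `τ = 1` the two sides agree by `J 1 = 0`.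
  refine congrFun (eq_of_mvfderiv_eq (a := (1 : G)) h1 h3 (fun σ v ↦ ?_) ?_) τ
  · have e1 := mvfderiv_comp_of_eq' (h.mdifferentiableAt (g * σ))
      (mdifferentiableAt_mul_left (E := E) g σ) rfl v
    have e2 : mvfderiv 𝓘(ℝ, E) (fun τ ↦ (A ∘ J) τ + J g) σ =
        mvfderiv 𝓘(ℝ, E) (A ∘ J) σ + mvfderiv 𝓘(ℝ, E) (fun _ : G ↦ J g) σ :=
      mvfderiv_add (h2 σ) mdifferentiableAt_const
    rw [mvfderiv_const, add_zero] at e2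
    have e3 := mfderiv_comp_apply σ (A.mdifferentiableAt (x := J σ)) (h.mdifferentiableAt σ) v
    have e4 : mfderiv 𝓘(ℝ, EuclideanSpace ℝ (Fin r)) 𝓘(ℝ, EuclideanSpace ℝ (Fin r)) A (J σ) = A :=
      A.mfderiv_eq
    rw [e4] at e3
    refine e1.trans (Eq.trans ?_ ((DFunLike.congr_fun e2 v).trans e3).symm)
    ext i
    refine (h.mvfderiv_apply _ _ i).trans (Eq.trans ?_ (hA _ i).symm)
    rw [toLieAlgebra_mul_left, adInv_mul, ← hc, map_sum, map_sum, sum_apply]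
    refine Finset.sum_congr rfl fun k _ ↦ ?_
    rw [map_smul, map_smul, smul_apply, smul_eq_mul]
    exact congrArg (c i k * ·) (h.mvfderiv_apply σ v k).symm
  · simp [h.map_one]

/-- The kernel of the derivative of the momentum map. -/
lemma IsMomentum.mvfderiv_one_eq_zero_iff (h : IsMomentum Ω b J) (v : E) :
    (mvfderiv 𝓘(ℝ, E) J (1 : G) v = 0) ↔ ∀ x ∈ Submodule.span ℝ (Set.range b), Ω.atOne v x = 0 := by
  have e1 : toLieAlgebra (E := E) (1 : G) v = v := by
    have := toLieAlgebra_ofLieAlgebra (1 : G) v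
    rwa [ofLieAlgebra_one] at this
  have e2 : ∀ i, mvfderiv 𝓘(ℝ, E) J (1 : G) v i = -Ω.atOne v (b i) := fun i ↦ by
    refine (h.mvfderiv_apply 1 v i).trans ?_
    rw [adInv_one, Ω.atOne_swap]
    exact congrArg (fun u ↦ -Ω.atOne u (b i)) e1
  constructor
  · intro h0 x hx
    induction hx using Submodule.span_induction with
    | mem x hx =>
      obtain ⟨i, rfl⟩ := hx
      have := e2 i
      rw [h0] at this
      simpa using this.symm
    | zero => simp
    | add x y _ _ hx hy => rw [map_add, hx, hy, add_zero]
    | smul a x _ hx => rw [map_smul, hx, smul_zero]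
  · intro h0
    ext i
    rw [e2, h0 _ (Submodule.subset_span ⟨i, rfl⟩)]
    simp

/-- If a functional `f` kills the range of `dJ`, then `ω(Ad(σ⁻¹) ∑ f(e_i) b_i, ·) = 0`.
Nondegeneracy and injectivity of `Ad(σ⁻¹)` give `∑ f(e_i) b_i = 0`, and independence gives `f = 0`.
-/
lemma IsMomentum.surjective_mvfderiv (h : IsMomentum Ω b J) (hb : LinearIndependent ℝ b) (σ : G) :
    Function.Surjective (mvfderiv 𝓘(ℝ, E) J σ) := by
  set D : E →L[ℝ] EuclideanSpace ℝ (Fin r) := mvfderiv 𝓘(ℝ, E) J σ with hD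
  have hDa : ∀ v : E, ∀ i, D v i = Ω.atOne (adInv σ (b i)) (toLieAlgebra (E := E) σ v) :=
    fun v i ↦ h.mvfderiv_apply σ v i
  suffices hs : LinearMap.range D.toLinearMap = ⊤ from LinearMap.range_eq_top.1 hs
  by_contra hne
  obtain ⟨f, hf0, hf⟩ := Submodule.exists_le_ker_of_lt_top _ (lt_top_iff_ne_top.2 hne)
  apply hf0
  have hfu : ∀ u : EuclideanSpace ℝ (Fin r),
      f u = ∑ i, u i * f (EuclideanSpace.single i 1) := fun u ↦ by
    conv_lhs => rw [← (EuclideanSpace.basisFun (Fin r) ℝ).sum_repr u]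
    simp
  have h0 : ∑ i, f (EuclideanSpace.single i 1) • b i = 0 := by
    apply adInv_injective (E := E) σ
    rw [map_zero]
    refine Ω.atOne_nondegenerate fun w ↦ ?_
    have h1 : f (D (ofLieAlgebra σ w : E)) = 0 := hf ⟨_, rfl⟩
    rw [hfu] at h1
    rw [← h1, map_sum, map_sum, sum_apply]
    refine Finset.sum_congr rfl fun i _ ↦ ?_
    rw [map_smul, map_smul, smul_apply, smul_eq_mul, mul_comm]
    have e : toLieAlgebra (E := E) σ (ofLieAlgebra σ w : E) = w := toLieAlgebra_ofLieAlgebra σ w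
    exact congrArg (· * f (EuclideanSpace.single i 1))
      ((hDa (ofLieAlgebra σ w : E) i).trans (congrArg _ e)).symm
  have h2 := Fintype.linearIndependent_iff.1 hb _ h0
  ext u
  rw [hfu]
  simp [h2]

end Group

/-! ### Submersions in adapted coordinates -/

section Slice

variable {E : Type*} [NormedAddCommGroup E] [NormedSpace ℝ E] [FiniteDimensional ℝ E]
  {F : Type*} [NormedAddCommGroup F] [NormedSpace ℝ F] [FiniteDimensional ℝ F]
  {D : Type*} [NormedAddCommGroup D] [NormedSpace ℝ D] [FiniteDimensional ℝ D]

/-- The inverse function theorem, with a smooth inverse on the whole target. -/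
lemma exists_openPartialHomeomorph_contDiffOn {f : E → F} {a : E} {O : Set E} (hO : IsOpen O)
    (ha : a ∈ O) (hf : ContDiffOn ℝ ∞ f O) {f' : E ≃L[ℝ] F} (hf' : fderiv ℝ f a = f') :
    ∃ e : OpenPartialHomeomorph E F, a ∈ e.source ∧ e.source ⊆ O ∧ (∀ x, e x = f x) ∧
      ContDiffOn ℝ ∞ e.symm e.target := by
  have _ : CompleteSpace E := FiniteDimensional.complete ℝ E
  have hfat : ∀ x ∈ O, ContDiffAt ℝ ∞ f x := fun x hx ↦ hf.contDiffAt (hO.mem_nhds hx)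
  have hd : HasFDerivAt f (f' : E →L[ℝ] F) a := by
    rw [← hf']; exact ((hfat a ha).differentiableAt (by simp)).hasFDerivAt
  let e₀ := (hfat a ha).toOpenPartialHomeomorph f hd (by simp)
  have hc : ContinuousAt (fderiv ℝ f) a :=
    ((hfat a ha).fderiv_right (m := 0) (by simp)).continuousAt
  -- Invertibility of the derivative is an open condition; shrinking to it makes the inverse smooth
  -- on the whole target and not only at the image of `a`.
  have hinv : ∀ᶠ x in 𝓝 a, fderiv ℝ f x ∈ Set.range ((↑) : (E ≃L[ℝ] F) → E →L[ℝ] F) := by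
    apply hc.eventually
    rw [hf']
    exact ContinuousLinearEquiv.nhds f'
  obtain ⟨O', hO'sub, hO', haO'⟩ := mem_nhds_iff.1 (hinv.and (hO.mem_nhds ha))
  refine ⟨e₀.restrOpen O' hO', ⟨(hfat a ha).mem_toOpenPartialHomeomorph_source hd (by simp), haO'⟩,
    fun x hx ↦ (hO'sub hx.2).2, fun x ↦ rfl, fun y hy ↦ ?_⟩
  have hx := (e₀.restrOpen O' hO').map_target hy
  obtain ⟨⟨g', hg'⟩, hxO⟩ := hO'sub hx.2
  refine (OpenPartialHomeomorph.contDiffAt_symm (f₀' := g') (e₀.restrOpen O' hO') hy ?_ ?_).contDiffWithinAt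
  · rw [hg']; exact ((hfat _ hxO).differentiableAt (by simp)).hasFDerivAt
  · exact hfat _ hxO

variable {M : Type*} [TopologicalSpace M] [ChartedSpace E M] [IsManifold 𝓘(ℝ, E) ∞ M]

/-- A submersion is a projection in suitable coordinates. -/
lemma exists_slice_chart {J : M → F} (hJ : ContMDiff 𝓘(ℝ, E) 𝓘(ℝ, F) ∞ J) (m : M)
    (hsurj : Function.Surjective (mvfderiv 𝓘(ℝ, E) J m))
    {S : Submodule ℝ E} (hS : ∀ v : E, v ∈ S ↔ mvfderiv 𝓘(ℝ, E) J m v = 0)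
    (hdim : Module.finrank ℝ D = Module.finrank ℝ S) :
    ∃ Φ : OpenPartialHomeomorph M (D × F), m ∈ Φ.source ∧
      ContMDiffOn 𝓘(ℝ, E) 𝓘(ℝ, D × F) ∞ Φ Φ.source ∧
      ContMDiffOn 𝓘(ℝ, D × F) 𝓘(ℝ, E) ∞ Φ.symm Φ.target ∧
      (∀ x, x ∈ Φ.source → (Φ x).2 = J x) ∧ (Φ m).1 = 0 := by
  have _ : CompleteSpace E := FiniteDimensional.complete ℝ E
  have _ : CompleteSpace F := FiniteDimensional.complete ℝ F
  have _ : CompleteSpace D := FiniteDimensional.complete ℝ D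
  set χ := chartAt E m with hχ
  set f : E → F := J ∘ χ.symm with hf
  have hfs : ContDiffOn ℝ ∞ f χ.target :=
    (hJ.comp_contMDiffOn (contMDiffOn_chart_symm (I := 𝓘(ℝ, E)) (x := m))).contDiffOn
  set L : E →L[ℝ] F := fderiv ℝ f (χ m) with hL
  have hLeq : ∀ v : E, L v = mvfderiv 𝓘(ℝ, E) J m v := fun v ↦
    (mvfderiv_eq_fderiv (hJ.mdifferentiable (by simp) m) v).symm
  have hLker : LinearMap.ker (L : E →ₗ[ℝ] F) = S := by
    ext v
    exact ⟨fun h ↦ (hS v).2 ((hLeq v).symm.trans h), fun h ↦ (hLeq v).trans ((hS v).1 h)⟩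
  have hLsurj : LinearMap.range (L : E →ₗ[ℝ] F) = ⊤ := LinearMap.range_eq_top.2 fun y ↦ by
    obtain ⟨v, hv⟩ := hsurj y
    exact ⟨v, (hLeq v).trans hv⟩
  -- `P` is the projection to the kernel of `L` along the complement `T`, transported to `D`. Then
  -- `(P, L)` is an isomorphism, and it is the derivative of `ψ` at `χ m`.
  obtain ⟨T, hT⟩ := (LinearMap.ker (L : E →ₗ[ℝ] F)).exists_isCompl
  let α : LinearMap.ker (L : E →ₗ[ℝ] F) ≃ₗ[ℝ] D :=
    LinearEquiv.ofFinrankEq _ _ (by rw [hLker, hdim])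
  let P : E →L[ℝ] D := LinearMap.toContinuousLinearMap
    (α.toLinearMap ∘ₗ (LinearMap.ker (L : E →ₗ[ℝ] F)).projectionOnto T hT)
  have hPker : LinearMap.ker (P : E →ₗ[ℝ] D) = T := by
    have : (P : E →ₗ[ℝ] D) =
      α.toLinearMap ∘ₗ (LinearMap.ker (L : E →ₗ[ℝ] F)).projectionOnto T hT := rfl
    rw [this, LinearEquiv.ker_comp, Submodule.ker_projectionOnto]
  have hPrange : LinearMap.range (P : E →ₗ[ℝ] D) = ⊤ := by
    have : (P : E →ₗ[ℝ] D) =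
      α.toLinearMap ∘ₗ (LinearMap.ker (L : E →ₗ[ℝ] F)).projectionOnto T hT := rfl
    rw [this, LinearMap.range_comp, Submodule.range_projectionOnto, Submodule.map_top,
      LinearEquiv.range]
  let ψ' : E ≃L[ℝ] D × F := ContinuousLinearMap.equivProdOfSurjectiveOfIsCompl P L hPrange hLsurj
    (by rw [hPker]; exact hT.symm)
  let ψ : E → D × F := fun u ↦ (P (u - χ m), f u)
  have hmt : χ m ∈ χ.target := mem_chart_target E m
  have hψs : ContDiffOn ℝ ∞ ψ χ.target :=
    (P.contDiff.comp (contDiff_id.sub contDiff_const)).contDiffOn.prodMk hfs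
  have hfd : DifferentiableAt ℝ f (χ m) :=
    (hfs.contDiffAt (χ.open_target.mem_nhds hmt)).differentiableAt (by simp)
  have hψd : fderiv ℝ ψ (χ m) = ψ' := by
    have h1 : HasFDerivAt (fun u ↦ P (u - χ m)) P (χ m) :=
      P.hasFDerivAt.comp (χ m) ((hasFDerivAt_id (χ m)).sub_const (χ m))
    rw [(h1.prodMk hfd.hasFDerivAt).fderiv]
    rfl
  obtain ⟨e, hme, heO, hecoe, hesymm⟩ :=
    exists_openPartialHomeomorph_contDiffOn χ.open_target hmt hψs hψd
  refine ⟨χ.trans e, ?_, ?_, ?_, ?_, ?_⟩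
  · rw [OpenPartialHomeomorph.trans_source]
    exact ⟨mem_chart_source E m, hme⟩
  · have he : ContMDiffOn 𝓘(ℝ, E) 𝓘(ℝ, D × F) ∞ e χ.target :=
      (hψs.congr fun x _ ↦ hecoe x).contMDiffOn
    rw [OpenPartialHomeomorph.trans_source]
    exact he.comp ((contMDiffOn_chart (I := 𝓘(ℝ, E)) (x := m)).mono Set.inter_subset_left)
      fun x hx ↦ χ.map_source hx.1
  · rw [OpenPartialHomeomorph.trans_target]
    exact (contMDiffOn_chart_symm (I := 𝓘(ℝ, E)) (x := m)).comp
      (hesymm.contMDiffOn.mono Set.inter_subset_left) fun x hx ↦ hx.2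
  · intro x hx
    rw [OpenPartialHomeomorph.trans_source] at hx
    have h1 : (e (χ x)).2 = f (χ x) := by rw [hecoe]
    refine h1.trans ?_
    simp [hf, χ.left_inv hx.1]
  · have h1 : (e (χ m)).1 = P (χ m - χ m) := by rw [hecoe]
    exact h1.trans (by simp)

end Slice

/-! ### From a chart at the unit to a Lie group structure -/

section Subgroup

variable {E : Type*} [NormedAddCommGroup E] [NormedSpace ℝ E]
  {G : Type*} [TopologicalSpace G] [ChartedSpace E G] [Group G]
  [LieGroup 𝓘(ℝ, E) ∞ G]
  {D : Type*} [NormedAddCommGroup D] [NormedSpace ℝ D]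

/-- A chart `e` at the unit of a subgroup `K` of a Lie group, which is the restriction of the map
`p`. -/
structure IsSubgroupChart (K : Subgroup G) (e : OpenPartialHomeomorph K D) (p : G → D) :
    Prop where
  one_mem : 1 ∈ e.source
  apply_eq : ∀ x, e x = p x
  contMDiffAt : ∀ x ∈ e.source, ContMDiffAt 𝓘(ℝ, E) 𝓘(ℝ, D) ∞ p (x : G)
  contMDiffOn_symm : ContMDiffOn 𝓘(ℝ, D) 𝓘(ℝ, E) ∞ (fun y ↦ (e.symm y : G)) e.target

/-- The left translates of a chart at the unit. -/
@[reducible] def subgroupChartedSpace [IsTopologicalGroup G] {K : Subgroup G}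
    (e : OpenPartialHomeomorph K D) (he : 1 ∈ e.source) : ChartedSpace D K where
  atlas := Set.range fun g : K ↦ (Homeomorph.mulLeft g⁻¹).transOpenPartialHomeomorph e
  chartAt g := (Homeomorph.mulLeft g⁻¹).transOpenPartialHomeomorph e
  mem_chart_source g := by simpa using he
  chart_mem_atlas g := ⟨g, rfl⟩

variable [FiniteDimensional ℝ E] [FiniteDimensional ℝ D]

/-- Each translated chart is the restriction of a map that is smooth on part of `G`, and its inverse
is smooth into `G`. So the transition maps are smooth, the inclusion is smooth, and a map into `K`
is smooth once it is smooth into `G` (`hlift`); the group operations are then inherited from `G`. -/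
lemma IsSubgroupChart.exists_lieGroup {K : Subgroup G} {e : OpenPartialHomeomorph K D} {p : G → D}
    (h : IsSubgroupChart (E := E) K e p) :
    ∃ (_ : ChartedSpace D K) (_ : LieGroup 𝓘(ℝ, D) ∞ K),
      ContMDiff 𝓘(ℝ, D) 𝓘(ℝ, E) ∞ (Subtype.val : K → G) ∧
      ∀ x : K, Function.Injective (mfderiv 𝓘(ℝ, D) 𝓘(ℝ, E) (Subtype.val : K → G) x) := by
  have _ : CompleteSpace D := FiniteDimensional.complete ℝ D
  have _ : IsTopologicalGroup G := topologicalGroup_of_lieGroup 𝓘(ℝ, E) ∞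
  let _ : ChartedSpace D K := subgroupChartedSpace e h.one_mem
  have happly : ∀ g x : K, chartAt D g x = p ((g : G)⁻¹ * x) := fun g x ↦ h.apply_eq (g⁻¹ * x)
  have hpl : ∀ (g : G) (x : G), ContMDiffAt 𝓘(ℝ, E) 𝓘(ℝ, D) ∞ p (g * x) →
      ContMDiffAt 𝓘(ℝ, E) 𝓘(ℝ, D) ∞ (fun x ↦ p (g * x)) x := fun g x hp ↦
    ContMDiffAt.comp x (g := p) hp contMDiff_mul_left.contMDiffAt
  have hman : IsManifold 𝓘(ℝ, D) ∞ K := by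
    refine isManifold_of_contDiffOn 𝓘(ℝ, D) ∞ K ?_
    rintro _ _ ⟨g, rfl⟩ ⟨g', rfl⟩
    intro y hy
    simp only [modelWithCornersSelf_coe, modelWithCornersSelf_coe_symm, Set.range_id,
      Set.preimage_id, Set.inter_univ, OpenPartialHomeomorph.trans_source,
      OpenPartialHomeomorph.symm_source] at hy
    obtain ⟨hy1, hy2⟩ := hy
    have hy1' : y ∈ e.target := hy1
    have hy2' : g'⁻¹ * (g⁻¹⁻¹ * e.symm y) ∈ e.source := hy2
    have h1 : ContMDiffAt 𝓘(ℝ, D) 𝓘(ℝ, D) ∞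
        (fun y ↦ p ((g' : G)⁻¹ * ((g : G) * (e.symm y : G)))) y := by
      refine ContMDiffAt.comp (I' := 𝓘(ℝ, E)) y
        (g := fun x : G ↦ p ((g' : G)⁻¹ * ((g : G) * x))) (f := fun y ↦ (e.symm y : G)) ?_
        (h.contMDiffOn_symm.contMDiffAt (e.open_target.mem_nhds hy1'))
      have h2 := h.contMDiffAt _ hy2'
      have e1 : ∀ x : G, (g' : G)⁻¹ * ((g : G) * x) = (g' : G)⁻¹ * (g : G) * x := fun x ↦
        (mul_assoc _ _ _).symm
      simp only [e1]
      apply hpl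
      simpa [mul_assoc] using h2
    refine (h1.contDiffAt.contDiffWithinAt).congr_of_eventuallyEq ?_ ?_
    · refine Filter.Eventually.of_forall fun z ↦ ?_
      refine (h.apply_eq (g'⁻¹ * (g⁻¹⁻¹ * e.symm z))).trans ?_
      simp
    · refine (h.apply_eq (g'⁻¹ * (g⁻¹⁻¹ * e.symm y))).trans ?_
      simp
  have hval : ContMDiff 𝓘(ℝ, D) 𝓘(ℝ, E) ∞ (Subtype.val : K → G) := fun k ↦ by
    have h1 : ContMDiffAt 𝓘(ℝ, D) 𝓘(ℝ, E) ∞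
        (fun x : K ↦ (k : G) * (e.symm (chartAt D k x) : G)) k := by
      refine contMDiffAt_const.mul (ContMDiffAt.comp k (g := fun y ↦ (e.symm y : G))
        (f := fun x : K ↦ chartAt D k x) ?_ contMDiffAt_extChartAt)
      refine h.contMDiffOn_symm.contMDiffAt (e.open_target.mem_nhds ?_)
      exact mem_chart_target D k
    refine h1.congr_of_eventuallyEq ?_
    filter_upwards [(chartAt D k).open_source.mem_nhds (mem_chart_source D k)] with x hx
    have h2 : e.symm (e (k⁻¹ * x)) = k⁻¹ * x := e.left_inv hx
    have h3 : chartAt D k x = e (k⁻¹ * x) := rfl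
    rw [h3, h2]
    simp
  have hlift : ∀ {E' : Type _} [NormedAddCommGroup E'] [NormedSpace ℝ E'] {H' : Type _}
      [TopologicalSpace H'] {I' : ModelWithCorners ℝ E' H'} {M : Type _}
      [TopologicalSpace M] [ChartedSpace H' M] (f : M → K),
      ContMDiff I' 𝓘(ℝ, E) ∞ (fun x ↦ (f x : G)) → ContMDiff I' 𝓘(ℝ, D) ∞ f := by
    intro E' _ _ H' _ I' M _ _ f hf x
    refine contMDiffAt_iff_target.2 ⟨(hf.continuous.subtype_mk _).continuousAt, ?_⟩
    have h1 : (extChartAt 𝓘(ℝ, D) (f x)) ∘ f = (fun y : G ↦ p ((f x : G)⁻¹ * y)) ∘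
        (fun x ↦ (f x : G)) := funext fun z ↦ happly (f x) (f z)
    rw [h1]
    refine ContMDiffAt.comp x (hpl _ _ ?_) (hf x)
    have := h.contMDiffAt 1 h.one_mem
    simpa using this
  have hlie : LieGroup 𝓘(ℝ, D) ∞ K :=
    { hman with
      contMDiff_mul := by
        refine hlift (I' := 𝓘(ℝ, D).prod 𝓘(ℝ, D)) (M := K × K) _ ?_
        exact (hval.comp contMDiff_fst).mul (hval.comp contMDiff_snd)
      contMDiff_inv := hlift _ hval.inv }
  refine ⟨_, hlie, hval, fun k ↦ ?_⟩
  have hq : ContMDiffAt 𝓘(ℝ, E) 𝓘(ℝ, D) ∞ (fun y : G ↦ p ((k : G)⁻¹ * y)) (k : G) := by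
    apply hpl
    have := h.contMDiffAt 1 h.one_mem
    simpa using this
  -- The chart at `k` factors through the inclusion, which forces the derivative of the inclusion to
  -- be injective.
  have h1 : (fun y : G ↦ p ((k : G)⁻¹ * y)) ∘ (Subtype.val : K → G) =
      fun x ↦ extChartAt 𝓘(ℝ, D) k x := funext fun z ↦ (happly k z).symm
  intro v w hvw
  apply injective_mvfderiv_extChartAt (E := D) k
  have h2 := fun v ↦ mfderiv_comp_apply k (hq.mdifferentiableAt (by simp))
    (hval.mdifferentiable (by simp) k) v
  rw [h1] at h2
  exact (h2 v).trans ((congrArg _ hvw).trans (h2 w).symm)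

end Subgroup

/-! ### Identity components of subgroups -/

section IdentityComponent

variable {G : Type*} [TopologicalSpace G] [Group G] [IsTopologicalGroup G]

/-- The identity component of a subgroup, as a subgroup of the whole group. -/
def identityComponent (K : Subgroup G) : Subgroup G :=
  (Subgroup.connectedComponentOfOne K).map K.subtype

lemma coe_identityComponent (K : Subgroup G) :
    (identityComponent K : Set G) = connectedComponentIn (K : Set G) 1 :=
  (connectedComponentIn_eq_image K.one_mem).symm

lemma identityComponent_le (K : Subgroup G) : identityComponent K ≤ K := fun x hx ↦ by
  have hx' : x ∈ (identityComponent K : Set G) := hx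
  rw [coe_identityComponent] at hx'
  exact connectedComponentIn_subset _ _ hx'

lemma subset_identityComponent {K : Subgroup G} {s : Set G} (hs : IsPreconnected s)
    (h1 : 1 ∈ s) (hsK : s ⊆ K) : s ⊆ identityComponent K := by
  rw [coe_identityComponent]
  exact hs.subset_connectedComponentIn h1 hsK

lemma isClosed_identityComponent {K : Subgroup G} (hK : IsClosed (K : Set G)) :
    IsClosed (identityComponent K : Set G) := by
  have h := hK.isClosedEmbedding_subtypeVal.isClosedMap _
    (isClosed_connectedComponent (x := (1 : K)))
  exact h

lemma connectedSpace_identityComponent (K : Subgroup G) : ConnectedSpace (identityComponent K) := by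
  have h : IsConnected (identityComponent K : Set G) := by
    rw [coe_identityComponent, isConnected_connectedComponentIn_iff]
    exact K.one_mem
  exact isConnected_iff_connectedSpace.1 h

end IdentityComponent

/-! ### The identity component of a regular level subgroup -/

section Group

variable {E : Type*} [NormedAddCommGroup E] [NormedSpace ℝ E] [FiniteDimensional ℝ E]
  {G : Type*} [TopologicalSpace G] [ChartedSpace E G] [Group G]
  [LieGroup 𝓘(ℝ, E) ∞ G] [IsTopologicalGroup G]
  {F : Type*} [NormedAddCommGroup F] [NormedSpace ℝ F] [FiniteDimensional ℝ F]
  {D : Type*} [NormedAddCommGroup D] [NormedSpace ℝ D] [FiniteDimensional ℝ D]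

/-- The identity component of a subgroup which is a regular level set has a chart at the unit, and
it is open in the subgroup. -/
lemma exists_isSubgroupChart {J : G → F} (hJ : ContMDiff 𝓘(ℝ, E) 𝓘(ℝ, F) ∞ J)
    (hsurj : Function.Surjective (mvfderiv 𝓘(ℝ, E) J (1 : G)))
    {S : Submodule ℝ E} (hS : ∀ v : E, v ∈ S ↔ mvfderiv 𝓘(ℝ, E) J (1 : G) v = 0)
    (hdim : Module.finrank ℝ D = Module.finrank ℝ S)
    {K₀ : Subgroup G} (hK₀ : ∀ g, g ∈ K₀ ↔ J g = 0) :
    ∃ (e : OpenPartialHomeomorph (identityComponent K₀) D) (p : G → D),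
      IsSubgroupChart (E := E) (identityComponent K₀) e p ∧
      (∀ d : D, ∃ v ∈ S, mvfderiv 𝓘(ℝ, E) p (1 : G) v = d) ∧
      ∀ᶠ g in 𝓝 (1 : G), g ∈ K₀ → g ∈ identityComponent K₀ := by
  classical
  have _ : CompleteSpace E := FiniteDimensional.complete ℝ E
  have _ : CompleteSpace F := FiniteDimensional.complete ℝ F
  have _ : CompleteSpace D := FiniteDimensional.complete ℝ D
  have hJ1 : J 1 = 0 := (hK₀ 1).1 K₀.one_mem
  obtain ⟨Φ, h1, hΦ, hΦs, hΦJ, hΦ1⟩ := exists_slice_chart (D := D) hJ 1 hsurj hS hdim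
  have hΦ10 : Φ 1 = (0, 0) := Prod.ext hΦ1 ((hΦJ 1 h1).trans hJ1)
  let i : D → D × F := fun y ↦ (y, 0)
  have hi : Continuous i := Continuous.prodMk_left 0
  have h0 : i 0 ∈ Φ.target := by
    change (0, 0) ∈ Φ.target
    rw [← hΦ10]; exact Φ.map_source h1
  obtain ⟨ε, hε, hB⟩ := Metric.isOpen_iff.1 (Φ.open_target.preimage hi) 0 h0
  set B : Set D := Metric.ball 0 ε with hBdef
  have hB' : ∀ y ∈ B, i y ∈ Φ.target := hB
  have hB0 : (0 : D) ∈ B := Metric.mem_ball_self hε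
  let γ : D → G := fun y ↦ Φ.symm (i y)
  let p : G → D := fun g ↦ (Φ g).1
  have hpγ : ∀ y ∈ B, p (γ y) = y := fun y hy ↦ by
    change (Φ (Φ.symm (i y))).1 = y
    rw [Φ.right_inv (hB' y hy)]
  have hJγ : ∀ y ∈ B, J (γ y) = 0 := fun y hy ↦ by
    rw [← hΦJ _ (Φ.map_target (hB' y hy))]
    rw [Φ.right_inv (hB' y hy)]
  have hγ1 : γ 0 = 1 := by
    have : i 0 = Φ 1 := hΦ10.symm
    change Φ.symm (i 0) = 1
    rw [this, Φ.left_inv h1]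
  have hγs : ContMDiffOn 𝓘(ℝ, D) 𝓘(ℝ, E) ∞ γ B := by
    refine hΦs.comp (ContMDiff.contMDiffOn ?_) hB'
    exact (contDiff_prodMk_left (0 : F)).contMDiff
  -- A ball is connected and `γ` sends its centre to the unit, so the slice lies in the identity
  -- component and not merely in `K₀`. With `hγp` this shows that the component contains all of `K₀`
  -- near the unit.
  have hγK : ∀ y ∈ B, γ y ∈ identityComponent K₀ := fun y hy ↦
    subset_identityComponent ((convex_ball 0 ε).isPreconnected.image γ hγs.continuousOn)
      ⟨0, hB0, hγ1⟩ (by rintro _ ⟨z, hz, rfl⟩; exact (hK₀ _).2 (hJγ z hz)) ⟨y, hy, rfl⟩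
  have hγp : ∀ g ∈ Φ.source, g ∈ K₀ → γ (p g) = g := fun g hg hgK ↦ by
    have h2 : i (p g) = Φ g := Prod.ext rfl ((hΦJ g hg).trans ((hK₀ g).1 hgK)).symm
    change Φ.symm (i (p g)) = g
    rw [h2, Φ.left_inv hg]
  have hps : ∀ g ∈ Φ.source, ContMDiffAt 𝓘(ℝ, E) 𝓘(ℝ, D) ∞ p g := fun g hg ↦
    ContMDiffAt.comp g (g := fun q : D × F ↦ q.1) (contDiff_fst.contMDiff _)
      (hΦ.contMDiffAt (Φ.open_source.mem_nhds hg))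
  have hpo : IsOpen (Φ.source ∩ p ⁻¹' B) :=
    ContinuousOn.isOpen_inter_preimage (fun g hg ↦ (hps g hg).continuousAt.continuousWithinAt)
      Φ.open_source Metric.isOpen_ball
  let e : OpenPartialHomeomorph (identityComponent K₀) D :=
    { toFun := fun k ↦ p k
      invFun := fun y ↦ if h : γ y ∈ identityComponent K₀ then ⟨γ y, h⟩ else 1
      source := Subtype.val ⁻¹' (Φ.source ∩ p ⁻¹' B)
      target := B
      map_source' := fun k hk ↦ hk.2
      map_target' := fun y hy ↦ by
        rw [dif_pos (hγK y hy)]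
        refine ⟨Φ.map_target (hB' y hy), ?_⟩
        change p (γ y) ∈ B
        rwa [hpγ y hy]
      left_inv' := fun k hk ↦ by
        have h2 : γ (p k) = k := hγp k hk.1 (identityComponent_le K₀ k.2)
        rw [dif_pos (by rw [h2]; exact k.2)]
        exact Subtype.ext h2
      right_inv' := fun y hy ↦ by
        rw [dif_pos (hγK y hy)]
        exact hpγ y hy
      open_source := hpo.preimage continuous_subtype_val
      open_target := Metric.isOpen_ball
      continuousOn_toFun := fun k hk ↦
        ((hps k hk.1).continuousAt.comp continuous_subtype_val.continuousAt).continuousWithinAt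
      continuousOn_invFun := by
        rw [Topology.IsInducing.subtypeVal.continuousOn_iff]
        refine hγs.continuousOn.congr fun y hy ↦ ?_
        simp only [Function.comp_apply]
        rw [dif_pos (hγK y hy)] }
  refine ⟨e, p, ⟨⟨h1, ?_⟩, fun x ↦ rfl, fun x hx ↦ hps _ hx.1, ?_⟩, fun d ↦ ?_, ?_⟩
  · change (Φ 1).1 ∈ B
    rwa [hΦ1]
  · refine hγs.congr fun y hy ↦ ?_
    change ((if h : γ y ∈ identityComponent K₀ then ⟨γ y, h⟩ else 1 : identityComponent K₀) : G) = γ y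
    rw [dif_pos (hγK y hy)]
  · have hBn : B ∈ 𝓝 (0 : D) := Metric.ball_mem_nhds _ hε
    have hγd : MDifferentiableAt 𝓘(ℝ, D) 𝓘(ℝ, E) γ 0 :=
      (hγs.contMDiffAt hBn).mdifferentiableAt (by simp)
    refine ⟨(mfderiv 𝓘(ℝ, D) 𝓘(ℝ, E) γ 0 d : E), (hS _).2 ?_, ?_⟩
    · have h2 := mvfderiv_comp_of_eq' (hJ.mdifferentiable (by simp) 1) hγd hγ1 d
      refine h2.symm.trans ?_
      have h3 : J ∘ γ =ᶠ[𝓝 0] fun _ ↦ 0 := Filter.eventually_of_mem hBn hJγ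
      have h4 : mvfderiv 𝓘(ℝ, D) (J ∘ γ) 0 = 0 := by
        rw [mvfderiv_congr h3, mvfderiv_const]
      exact DFunLike.congr_fun h4 d
    · have h2 := mvfderiv_comp_of_eq' ((hps 1 h1).mdifferentiableAt (by simp)) hγd hγ1 d
      refine h2.symm.trans ?_
      have h3 : p ∘ γ =ᶠ[𝓝 0] id := Filter.eventually_of_mem hBn hpγ
      have h4 := mvfderiv_congr (E := D) h3
      refine (DFunLike.congr_fun h4 d).trans ?_
      have h5 : mfderiv 𝓘(ℝ, D) 𝓘(ℝ, D) (id : D → D) 0 = ContinuousLinearMap.id ℝ _ := mfderiv_id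
      exact DFunLike.congr_fun h5 d
  · have h1B : (1 : G) ∈ Φ.source ∩ p ⁻¹' B := ⟨h1, by change (Φ 1).1 ∈ B; rwa [hΦ1]⟩
    filter_upwards [hpo.mem_nhds h1B] with g hg hgK
    rw [← hγp g hg.1 hgK]
    exact hγK _ hg.2

/-- A connected Lie subgroup whose Lie algebra is tangent to a level subgroup is the identity
component of this level subgroup. -/
lemma IsConnectedLieSubgroup.eq_identityComponent {J : G → F}
    (hJ : ContMDiff 𝓘(ℝ, E) 𝓘(ℝ, F) ∞ J) {S : Submodule ℝ (GroupLieAlgebra 𝓘(ℝ, E) G)}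
    (hJS : ∀ (σ : G) (v : TangentSpace 𝓘(ℝ, E) σ), toLieAlgebra (E := E) σ v ∈ S →
      mvfderiv 𝓘(ℝ, E) J σ v = 0)
    {K₀ : Subgroup G} (hK₀ : ∀ g, g ∈ K₀ ↔ J g = 0)
    {e : OpenPartialHomeomorph (identityComponent K₀) D} {p : G → D}
    (he : IsSubgroupChart (E := E) (identityComponent K₀) e p)
    (hp : ∀ d : D, ∃ v ∈ S, mvfderiv 𝓘(ℝ, E) p (1 : G) v = d)
    {K : Subgroup G} (hK : IsConnectedLieSubgroup K S) : K = identityComponent K₀ := by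
  have _ : CompleteSpace E := FiniteDimensional.complete ℝ E
  have _ : CompleteSpace D := FiniteDimensional.complete ℝ D
  obtain ⟨k, N, _, _, _, _, j, _, hinj, rfl, hj, himm, hmem⟩ := hK
  have _ : IsTopologicalGroup N := topologicalGroup_of_lieGroup 𝓘(ℝ, EuclideanSpace ℝ (Fin k)) ∞
  have hjd : ∀ n, MDifferentiableAt 𝓘(ℝ, EuclideanSpace ℝ (Fin k)) 𝓘(ℝ, E) j n :=
    hj.mdifferentiable (by simp)
  have hJd : ∀ σ, MDifferentiableAt 𝓘(ℝ, E) 𝓘(ℝ, F) J σ := hJ.mdifferentiable (by simp)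
  -- The derivative of `j`, translated to the unit, takes values in `S`, along whose left translates
  -- `dJ` vanishes.
  have hconst : J ∘ j = fun _ ↦ 0 := by
    refine eq_of_mvfderiv_eq (E := EuclideanSpace ℝ (Fin k)) (a := 1)
      (fun n ↦ (hJd _).comp n (hjd n)) (fun n ↦ mdifferentiableAt_const) (fun n w ↦ ?_) ?_
    · refine (mvfderiv_comp_of_eq' (hJd _) (hjd n) rfl w).trans ?_
      refine (hJS _ _ ?_).trans ?_
      · exact (hmem _).2 ⟨_, (toLieAlgebra_mfderiv_monoidHom j hj n w).symm⟩
      · rw [mvfderiv_const]; rfl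
    · simpa using (hK₀ 1).1 K₀.one_mem
  have hle : j.range ≤ identityComponent K₀ := by
    refine subset_identityComponent (s := (j.range : Set G)) ?_ j.range.one_mem ?_
    · rw [MonoidHom.coe_range]
      exact isPreconnected_range hj.continuous
    · rintro _ ⟨n, rfl⟩
      exact (hK₀ _).2 (congrFun hconst n)
  refine le_antisymm hle ?_
  have hps : ContMDiffAt 𝓘(ℝ, E) 𝓘(ℝ, D) ∞ p 1 := he.contMDiffAt 1 he.one_mem
  have hpj : ContMDiffAt 𝓘(ℝ, EuclideanSpace ℝ (Fin k)) 𝓘(ℝ, D) ∞ (p ∘ j) 1 :=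
    hps.comp_of_eq (hj 1) (map_one j)
  set χ := extChartAt 𝓘(ℝ, EuclideanSpace ℝ (Fin k)) (1 : N) with hχ
  have hχ1 : χ.symm (χ 1) = 1 := extChartAt_to_inv 1
  have hq := hpj.contDiffAt_comp_extChartAt_symm.hasStrictFDerivAt (by simp)
  have hqs : LinearMap.range (fderiv ℝ ((p ∘ j) ∘ χ.symm) (χ 1)).toLinearMap = ⊤ := by
    refine LinearMap.range_eq_top.2 fun d ↦ ?_
    obtain ⟨v, hv, hvd⟩ := hp d
    obtain ⟨w, hw⟩ := (hmem v).1 hv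
    refine ⟨w, ?_⟩
    refine (mvfderiv_eq_fderiv (hpj.mdifferentiableAt (by simp)) w).symm.trans ?_
    refine (mvfderiv_comp_of_eq' (hps.mdifferentiableAt (by simp)) (hjd 1) (map_one j) w).trans ?_
    exact (congrArg (fun u : E ↦ mvfderiv 𝓘(ℝ, E) p (1 : G) u) hw).trans hvd
  -- `p ∘ j` is a submersion at the unit, so it maps neighbourhoods onto neighbourhoods. As `e` is
  -- injective on its source, the range of `j` contains a neighbourhood of the unit in the connected
  -- group `identityComponent K₀`, hence all of it.
  have hmap := hq.map_nhds_eq_of_surj hqs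
  obtain ⟨O, hO, hOe⟩ := isOpen_induced_iff.1 e.open_source
  have h1O : (1 : G) ∈ O := by
    have := he.one_mem
    rw [← hOe] at this
    exact this
  have hV : {u | j (χ.symm u) ∈ O} ∈ 𝓝 (χ 1) := by
    have hc : ContinuousAt (j ∘ χ.symm) (χ 1) :=
      hj.continuous.continuousAt.comp (continuousAt_extChartAt_symm 1)
    refine hc (hO.mem_nhds ?_)
    simpa [hχ1] using h1O
  have him := Filter.image_mem_map (m := (p ∘ j) ∘ χ.symm) hV
  rw [hmap] at him
  have hp1 : ((p ∘ j) ∘ χ.symm) (χ 1) = e 1 := by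
    simp [hχ1, he.apply_eq]
  rw [hp1] at him
  have hnhds : ((j.range.subgroupOf (identityComponent K₀) : Subgroup (identityComponent K₀)) :
      Set (identityComponent K₀)) ∈ 𝓝 1 := by
    filter_upwards [(e.continuousAt he.one_mem).eventually him, e.open_source.mem_nhds he.one_mem]
      with x hx hxs
    obtain ⟨u, hu, hux⟩ := hx
    have hju : j (χ.symm u) ∈ identityComponent K₀ := hle ⟨_, rfl⟩
    have hs : (⟨_, hju⟩ : identityComponent K₀) ∈ e.source := by
      rw [← hOe]; exact hu
    have : (⟨_, hju⟩ : identityComponent K₀) = x :=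
      e.injOn hs hxs ((he.apply_eq _).trans hux)
    change (x : G) ∈ j.range
    rw [← this]
    exact ⟨_, rfl⟩
  have _ : ConnectedSpace (identityComponent K₀) := connectedSpace_identityComponent K₀
  exact Subgroup.subgroupOf_eq_top.1 (Subgroup.eq_top_of_mem_nhds_one hnhds)

end Group

/-! ### Restriction of `∇⁺` to a subgroup -/

section AffineSubgroup

variable {E : Type*} [NormedAddCommGroup E] [NormedSpace ℝ E] [FiniteDimensional ℝ E]
  {G : Type*} [TopologicalSpace G] [ChartedSpace E G] [Group G]
  [LieGroup 𝓘(ℝ, E) ∞ G]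
  {E' : Type*} [NormedAddCommGroup E'] [NormedSpace ℝ E'] [FiniteDimensional ℝ E']
  {N : Type*} [TopologicalSpace N] [ChartedSpace E' N] [Group N]
  [LieGroup 𝓘(ℝ, E') ∞ N]

/-- An immersed subgroup whose Lie algebra is closed under the left symmetric product is an affine
subgroup. -/
lemma SymplecticForm.IsLeftInvariant.exists_isAffineMap {Ω : SymplecticForm E G}
    (hΩ : Ω.IsLeftInvariant) (j : N →* G) (hj : ContMDiff 𝓘(ℝ, E') 𝓘(ℝ, E) ∞ j)
    (himm : Function.Injective (mfderiv 𝓘(ℝ, E') 𝓘(ℝ, E) j 1))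
    (hclosed : ∀ x y : E', ∃ z : E', (mfderiv 𝓘(ℝ, E') 𝓘(ℝ, E) j 1 z : E) =
      leftSymCLM Ω (mfderiv 𝓘(ℝ, E') 𝓘(ℝ, E) j 1 y : E) (mfderiv 𝓘(ℝ, E') 𝓘(ℝ, E) j 1 x : E)) :
    ∃ cov : FieldOperator E' N, IsAffineStructure cov ∧ IsLeftInvariantConnection cov ∧
      IsAffineMap cov (canonicalConnection Ω) j := by
  have _ : CompleteSpace E := FiniteDimensional.complete ℝ E
  have _ : CompleteSpace E' := FiniteDimensional.complete ℝ E'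
  obtain ⟨T, hT⟩ : ∃ T : E' →L[ℝ] E, ∀ w, T w = mfderiv 𝓘(ℝ, E') 𝓘(ℝ, E) j 1 w :=
    ⟨mfderiv 𝓘(ℝ, E') 𝓘(ℝ, E) j 1, fun _ ↦ rfl⟩
  have hTinj : Function.Injective T := fun v w h ↦
    himm ((hT v).symm.trans (h.trans (hT w)))
  have hTc : ∀ x y, ∃ z, T z = leftSymCLM Ω (T y) (T x) := fun x y ↦ by
    obtain ⟨z, hz⟩ := hclosed x y
    refine ⟨z, (hT z).trans (hz.trans ?_)⟩
    rw [hT, hT]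
  have hTb : ∀ x y, T (bracketCLM E' N x y) = bracketCLM E G (T x) (T y) := fun x y ↦ by
    rw [hT x, hT y]
    exact (hT _).trans (mfderiv_monoidHom_bracket j hj x y)
  obtain ⟨R₀, hR₀⟩ := LinearMap.exists_leftInverse_of_injective T.toLinearMap
    (LinearMap.ker_eq_bot.2 hTinj)
  let R : E →L[ℝ] E' := LinearMap.toContinuousLinearMap R₀
  have hR : ∀ w, R (T w) = w := fun w ↦ LinearMap.congr_fun hR₀ w
  -- The restricted product, pulled back by a left inverse `R` of `T`; `hclosed` ensures that
  -- nothing is lost under `R`. The algebraic identities are then checked after the injection `T`.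
  let B : E' →L[ℝ] E' →L[ℝ] E' :=
    (ContinuousLinearMap.compL ℝ E' E E' R) ∘L ((leftSymCLM Ω).bilinearComp T T)
  have hB : ∀ y x, T (B y x) = leftSymCLM Ω (T y) (T x) := fun y x ↦ by
    obtain ⟨z, hz⟩ := hTc x y
    change T (R (leftSymCLM Ω (T y) (T x))) = _
    rw [← hz, hR]
  refine ⟨frameConnection toLieAlgebra ofLieAlgebra B,
    isCoframe_toLieAlgebra.isAffineStructure B (fun x y ↦ hTinj ?_) (fun x y z ↦ hTinj ?_),
    isLeftInvariantConnection_frameConnection B, ?_⟩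
  · rw [map_sub, hB, hB, hTb, hΩ.leftSymCLM_sub]
  · rw [map_sub, hB, hB, hB, hB, hB, hTb, leftSymCLM_leftSymCLM_sub]
  · rw [canonicalConnection_eq_frameConnection]
    refine isCoframe_toLieAlgebra.isAffineMap isCoframe_toLieAlgebra B (leftSymCLM Ω) hj
      (fun _ ↦ T) (fun _ ↦ mdifferentiableAt_const) (fun n v ↦ ?_) fun n u y ↦ ?_
    · exact (toLieAlgebra_mfderiv_monoidHom j hj n v).trans (hT _).symm
    · rw [mvfderiv_const, hB]
      simp

end AffineSubgroup

/-! ### Manifolds developed into a vector space -/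

section Developing

variable {F : Type*} [NormedAddCommGroup F] [NormedSpace ℝ F]
  {Q : Type*} [TopologicalSpace Q]

/-- The charted space structure given by a family of charts which are all restrictions of the same
map. -/
@[reducible] def developedChartedSpace (c : Q → OpenPartialHomeomorph Q F)
    (hc : ∀ q, q ∈ (c q).source) : ChartedSpace F Q where
  atlas := Set.range c
  chartAt := c
  mem_chart_source := hc
  chart_mem_atlas q := ⟨q, rfl⟩

/-- The transition maps are restrictions of the identity, since all charts restrict the same map. -/
lemma exists_isManifold_of_charts {f : Q → F} (c : Q → OpenPartialHomeomorph Q F)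
    (hc : ∀ q, q ∈ (c q).source) (hf : ∀ q x, c q x = f x) :
    ∃ (_ : ChartedSpace F Q) (_ : IsManifold 𝓘(ℝ, F) ∞ Q), ∀ q x : Q, chartAt F q x = f x := by
  let _ : ChartedSpace F Q := developedChartedSpace c hc
  refine ⟨developedChartedSpace c hc, isManifold_of_contDiffOn 𝓘(ℝ, F) ∞ Q ?_, hf⟩
  rintro _ _ ⟨q, rfl⟩ ⟨q', rfl⟩
  refine contDiffOn_id.congr fun y hy ↦ ?_
  simp only [modelWithCornersSelf_coe, modelWithCornersSelf_coe_symm, Set.range_id,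
    Set.preimage_id, Set.inter_univ, OpenPartialHomeomorph.trans_source,
    OpenPartialHomeomorph.symm_source] at hy
  have h1 : c q' ((c q).symm y) = y := by
    rw [hf, ← hf q, (c q).right_inv hy.1]
  exact h1

lemma exists_charts_of_locally_injective [Nonempty Q] {f : Q → F} (hfc : Continuous f)
    (hfo : IsOpenMap f) (hinj : ∀ q, ∃ U : Set Q, IsOpen U ∧ q ∈ U ∧ Set.InjOn f U) :
    ∃ c : Q → OpenPartialHomeomorph Q F, (∀ q, q ∈ (c q).source) ∧ ∀ q x, c q x = f x := by
  choose U hU hqU hUf using hinj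
  exact ⟨fun q ↦ OpenPartialHomeomorph.ofContinuousOpen ((hUf q).toPartialEquiv f (U q))
    hfc.continuousOn hfo (hU q), hqU, fun _ _ ↦ rfl⟩

variable [ChartedSpace F Q] [IsManifold 𝓘(ℝ, F) ∞ Q] {f : Q → F}

lemma eventuallyEq_id_of_chartAt_eq (hf : ∀ q x : Q, chartAt F q x = f x) (q : Q) :
    f ∘ (extChartAt 𝓘(ℝ, F) q).symm =ᶠ[𝓝 (extChartAt 𝓘(ℝ, F) q q)] id := by
  filter_upwards [extChartAt_target_mem_nhds (I := 𝓘(ℝ, F)) q] with y hy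
  have h : extChartAt 𝓘(ℝ, F) q ((extChartAt 𝓘(ℝ, F) q).symm y) = y :=
    (extChartAt 𝓘(ℝ, F) q).right_inv hy
  exact (hf q _).symm.trans h

lemma contMDiff_of_chartAt_eq (hf : ∀ q x : Q, chartAt F q x = f x) :
    ContMDiff 𝓘(ℝ, F) 𝓘(ℝ, F) ∞ f := fun q ↦
  (contMDiffAt_extChartAt (I := 𝓘(ℝ, F)) (x := q)).congr_of_eventuallyEq
    (Filter.Eventually.of_forall fun x ↦ (hf q x).symm)

/-- With identity transition maps, every tangent bundle trivialization coming from a chart is the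
identity of `F` on each fibre. -/
lemma trivializationAt_snd_of_chartAt_eq [IsManifold 𝓘(ℝ, F) 1 Q]
    (hf : ∀ q x : Q, chartAt F q x = f x) (q x : Q) (v : F) :
    (trivializationAt F (TangentSpace 𝓘(ℝ, F)) q (⟨x, v⟩ : TangentBundle 𝓘(ℝ, F) Q)).2 = v := by
  have h1 : ((chartAt F q).extend 𝓘(ℝ, F) ∘ ((chartAt F x).extend 𝓘(ℝ, F)).symm)
      = f ∘ (extChartAt 𝓘(ℝ, F) x).symm := funext fun y ↦ hf q _
  have h2 : fderivWithin ℝ ((chartAt F q).extend 𝓘(ℝ, F) ∘ ((chartAt F x).extend 𝓘(ℝ, F)).symm)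
      (Set.range 𝓘(ℝ, F)) (extChartAt 𝓘(ℝ, F) x x) = ContinuousLinearMap.id ℝ F := by
    rw [h1, modelWithCornersSelf_coe, Set.range_id, fderivWithin_univ,
      (eventuallyEq_id_of_chartAt_eq hf x).fderiv_eq, fderiv_id]
  exact DFunLike.congr_fun h2 v

variable [CompleteSpace F]

lemma mvfderiv_of_chartAt_eq (hf : ∀ q x : Q, chartAt F q x = f x) (q : Q)
    (v : TangentSpace 𝓘(ℝ, F) q) :
    mvfderiv 𝓘(ℝ, F) f q v = v := by
  refine (mvfderiv_eq_fderiv ((contMDiff_of_chartAt_eq hf).mdifferentiable (by simp) q) v).trans ?_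
  exact DFunLike.congr_fun ((eventuallyEq_id_of_chartAt_eq hf q).fderiv_eq.trans fderiv_id) v

/-- Here `θ` is `df`, the identity of `F` on each tangent space. The structure constants vanish
because the bracket acts on `f` as a commutator, that is, `d(df) = 0`. -/
lemma isCoframe_of_chartAt_eq (hf : ∀ q x : Q, chartAt F q x = f x) :
    IsCoframe (fun q ↦ mvfderiv 𝓘(ℝ, F) f q)
      (fun q ↦ (ContinuousLinearMap.id ℝ F : F →L[ℝ] TangentSpace 𝓘(ℝ, F) q)) 0 where
  left_inv q v := mvfderiv_of_chartAt_eq hf q v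
  right_inv q v := mvfderiv_of_chartAt_eq hf q v
  mdifferentiableAt Y q hY := mdifferentiableAt_mvfderiv_apply (contMDiff_of_chartAt_eq hf q) hY
  contMDiff Y hY := contMDiff_mvfderiv_apply (contMDiff_of_chartAt_eq hf) hY
  isSmoothField y hy q := by
    have _ : IsManifold 𝓘(ℝ, F) 1 Q := IsManifold.of_le (n := ∞) (by simp)
    refine contMDiffAt_totalSpace.2 ⟨contMDiffAt_id, ?_⟩
    have h : (fun x : Q ↦ (trivializationAt F (TangentSpace 𝓘(ℝ, F)) q
      (⟨x, y x⟩ : TangentBundle 𝓘(ℝ, F) Q)).2) = y :=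
      funext fun x ↦ trivializationAt_snd_of_chartAt_eq hf q x (y x)
    exact h.symm ▸ hy q
  structure_equation X Y hX hY q := by
    rw [mvfderiv_mlieBracket (contMDiff_of_chartAt_eq hf q) (hX.isDiffFieldAt q)
      (hY.isDiffFieldAt q), sub_self]
    simp

lemma IsCoframe.isAffineStructure_zero
    {θ : Π q : Q, TangentSpace 𝓘(ℝ, F) q →L[ℝ] F} {ψ : Π q : Q, F →L[ℝ] TangentSpace 𝓘(ℝ, F) q}
    (h : IsCoframe θ ψ 0) : IsAffineStructure (frameConnection θ ψ 0) :=
  h.isAffineStructure 0 (by simp) (by simp)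

lemma IsCoframe.frameConnection_zero_apply
    {θ : Π q : Q, TangentSpace 𝓘(ℝ, F) q →L[ℝ] F} {ψ : Π q : Q, F →L[ℝ] TangentSpace 𝓘(ℝ, F) q}
    (h : IsCoframe θ ψ 0) (v : F) (q : Q) : frameConnection θ ψ 0 (fun q ↦ ψ q v) q = 0 := by
  have h1 : (fun q ↦ θ q (ψ q v)) = fun _ ↦ v := funext fun q ↦ h.right_inv q v
  unfold frameConnection
  rw [h1, mvfderiv_const]
  simp

/-- Fields with constant `θ` commute: the structure equation with `c = 0` leaves only the bracket
term. -/
lemma IsCoframe.isCommutativeParallelism {ι : Type*} [Fintype ι]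
    {θ : Π q : Q, TangentSpace 𝓘(ℝ, F) q →L[ℝ] F} {ψ : Π q : Q, F →L[ℝ] TangentSpace 𝓘(ℝ, F) q}
    (h : IsCoframe θ ψ 0) (b : Module.Basis ι ℝ F) :
    IsCommutativeParallelism (fun i q ↦ ψ q (b i)) := by
  let e : ∀ q, F ≃ₗ[ℝ] TangentSpace 𝓘(ℝ, F) q := fun q ↦
    LinearEquiv.ofLinearMap (ψ q).toLinearMap (θ q).toLinearMap
      (LinearMap.ext (h.left_inv q)) (LinearMap.ext (h.right_inv q))
  refine ⟨fun i ↦ h.isSmoothField _ contMDiff_const, fun q ↦ ((b.map (e q)).linearIndependent :),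
    fun q ↦ (b.map (e q)).span_eq, fun i j q ↦ ?_⟩
  have hs : ∀ i, IsSmoothField (fun q ↦ ψ q (b i)) := fun i ↦ h.isSmoothField _ contMDiff_const
  apply h.injective q
  have h1 : ∀ i, (fun q ↦ θ q (ψ q (b i))) = fun _ ↦ b i :=
    fun i ↦ funext fun q ↦ h.right_inv q (b i)
  have h2 := h.structure_equation _ _ (hs i) (hs j) q
  rw [h1, h1, mvfderiv_const, mvfderiv_const] at h2
  rw [map_zero]
  simpa using h2

end Developing

/-! ### Submersions are open maps -/

section OpenMap

variable {E : Type*} [NormedAddCommGroup E] [NormedSpace ℝ E] [CompleteSpace E]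
  {M : Type*} [TopologicalSpace M] [ChartedSpace E M] [IsManifold 𝓘(ℝ, E) ∞ M]
  {F : Type*} [NormedAddCommGroup F] [NormedSpace ℝ F] [CompleteSpace F]

lemma isOpenMap_of_surjective_mvfderiv {J : M → F} (hJ : ContMDiff 𝓘(ℝ, E) 𝓘(ℝ, F) ∞ J)
    (hsurj : ∀ m, Function.Surjective (mvfderiv 𝓘(ℝ, E) J m)) : IsOpenMap J := by
  refine isOpenMap_iff_nhds_le.2 fun m ↦ ?_
  set χ := extChartAt 𝓘(ℝ, E) m with hχ
  have hq := (hJ m).contDiffAt_comp_extChartAt_symm.hasStrictFDerivAt (by simp)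
  have hqs : LinearMap.range (fderiv ℝ (J ∘ χ.symm) (χ m)).toLinearMap = ⊤ := by
    refine LinearMap.range_eq_top.2 fun d ↦ ?_
    obtain ⟨v, hv⟩ := hsurj m d
    exact ⟨v, (mvfderiv_eq_fderiv (hJ.mdifferentiable (by simp) m) v).symm.trans hv⟩
  have hmap := hq.map_nhds_eq_of_surj hqs
  have h1 : (J ∘ χ.symm) (χ m) = J m := by
    simp only [Function.comp_apply]
    exact congrArg J (extChartAt_to_inv m)
  rw [h1] at hmap
  rw [← hmap, ← Filter.map_map]
  refine Filter.map_mono ?_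
  have := (continuousAt_extChartAt_symm (I := 𝓘(ℝ, E)) m).tendsto
  rwa [extChartAt_to_inv] at this

end OpenMap

/-! ### The coset space, and the covariant derivative of `dJ` -/

section Group

variable {E : Type*} [NormedAddCommGroup E] [NormedSpace ℝ E] [FiniteDimensional ℝ E]
  {G : Type*} [TopologicalSpace G] [ChartedSpace E G] [Group G]
  [LieGroup 𝓘(ℝ, E) ∞ G]

/-- The space of left cosets of an open subgroup of a regular level subgroup is developed by the
defining map of this level subgroup. -/
lemma exists_isManifold_quotient [IsTopologicalGroup G] {F : Type*} [NormedAddCommGroup F]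
    [NormedSpace ℝ F] {J : G → F} (hJc : Continuous J) (hJo : IsOpenMap J)
    {K₀ K : Subgroup G} (hK₀ : ∀ a b, J a = J b ↔ a⁻¹ * b ∈ K₀) (hle : K ≤ K₀)
    (hK : ∀ᶠ g in 𝓝 (1 : G), g ∈ K₀ → g ∈ K) :
    ∃ (_ : ChartedSpace F (G ⧸ K)) (_ : IsManifold 𝓘(ℝ, F) ∞ (G ⧸ K)) (f : G ⧸ K → F),
      (∀ q x : G ⧸ K, chartAt F q x = f x) ∧ ∀ g : G, f g = J g := by
  let f : G ⧸ K → F := Quotient.lift J fun a b hab ↦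
    (hK₀ a b).2 (hle (QuotientGroup.leftRel_apply.1 hab))
  have hfJ : ∀ g : G, f g = J g := fun g ↦ rfl
  have hfc : Continuous f := hJc.quotient_lift _
  have hfo : IsOpenMap f := fun U hU ↦ by
    have : f '' U = J '' ((fun g : G ↦ (g : G ⧸ K)) ⁻¹' U) := by
      ext y
      constructor
      · rintro ⟨q, hq, rfl⟩
        obtain ⟨g, rfl⟩ := QuotientGroup.mk_surjective q
        exact ⟨g, hq, rfl⟩
      · rintro ⟨g, hg, rfl⟩
        exact ⟨g, hg, rfl⟩
    rw [this]
    exact hJo _ (hU.preimage QuotientGroup.continuous_mk)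
  -- For `a`, `b` near `g` the element `a⁻¹ b` is near the unit, where membership in `K₀` implies
  -- membership in `K`; so equal values of `J` mean equal cosets.
  have hinj : ∀ q, ∃ U : Set (G ⧸ K), IsOpen U ∧ q ∈ U ∧ Set.InjOn f U := fun q ↦ by
    obtain ⟨g, rfl⟩ := QuotientGroup.mk_surjective q
    have hd : Filter.Tendsto (fun p : G × G ↦ p.1⁻¹ * p.2) (𝓝 (g, g)) (𝓝 1) := by
      have : Continuous fun p : G × G ↦ p.1⁻¹ * p.2 := by fun_prop
      simpa using this.tendsto (g, g)
    have hev := hd.eventually hK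
    rw [nhds_prod_eq] at hev
    obtain ⟨V, hV, hVK⟩ := Filter.eventually_prod_self_iff (r := fun a b : G ↦ a⁻¹ * b ∈ K₀ → a⁻¹ * b ∈ K)
      |>.1 hev
    obtain ⟨W, hWV, hW, hgW⟩ := mem_nhds_iff.1 hV
    refine ⟨(fun g : G ↦ (g : G ⧸ K)) '' W, QuotientGroup.isOpenMap_coe W hW, ⟨g, hgW, rfl⟩, ?_⟩
    rintro _ ⟨a, ha, rfl⟩ _ ⟨b, hb, rfl⟩ hab
    exact QuotientGroup.eq.2 (hVK a (hWV ha) b (hWV hb) ((hK₀ a b).1 hab))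
  obtain ⟨c, hc, hcf⟩ := exists_charts_of_locally_injective hfc hfo hinj
  obtain ⟨i1, i2, h⟩ := exists_isManifold_of_charts c hc hcf
  exact ⟨i1, i2, f, h, hfJ⟩

lemma contMDiff_of_comp_chartAt_eq {F : Type*} [NormedAddCommGroup F]
    [NormedSpace ℝ F] {Q : Type*} [TopologicalSpace Q] [ChartedSpace F Q]
    {f : Q → F} (hf : ∀ q x : Q, chartAt F q x = f x) {g : G → Q} (hg : Continuous g)
    (hs : ContMDiff 𝓘(ℝ, E) 𝓘(ℝ, F) ∞ (f ∘ g)) : ContMDiff 𝓘(ℝ, E) 𝓘(ℝ, F) ∞ g := fun x ↦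
  contMDiffAt_iff_target.2 ⟨hg.continuousAt,
    (hs x).congr_of_eventuallyEq (Filter.Eventually.of_forall fun z ↦ hf (g x) (g z))⟩

variable {Ω : SymplecticForm E G} {r : ℕ} {b : Fin r → E} {J : G → EuclideanSpace ℝ (Fin r)}

/-- The derivative of a momentum map, read in the left trivialization, satisfies the equation of
affine maps. -/
lemma IsMomentum.exists_mvfderiv_eq (h : IsMomentum Ω b J) :
    ∃ T : G → E →L[ℝ] EuclideanSpace ℝ (Fin r),
      (∀ σ, MDifferentiableAt 𝓘(ℝ, E) 𝓘(ℝ, E →L[ℝ] EuclideanSpace ℝ (Fin r)) T σ) ∧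
      (∀ σ (v : TangentSpace 𝓘(ℝ, E) σ),
        mvfderiv 𝓘(ℝ, E) J σ v = T σ (toLieAlgebra (E := E) σ v)) ∧
      ∀ σ (u : TangentSpace 𝓘(ℝ, E) σ) (y : E),
        mvfderiv 𝓘(ℝ, E) T σ u y = T σ (leftSymCLM Ω y (toLieAlgebra (E := E) σ u)) := by
  have _ : CompleteSpace E := FiniteDimensional.complete ℝ E
  let A : Fin r → E →L[ℝ] E →L[ℝ] EuclideanSpace ℝ (Fin r) := fun i ↦
    ((ContinuousLinearMap.smulRightL ℝ E (EuclideanSpace ℝ (Fin r))).flip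
      (EuclideanSpace.single i 1)) ∘L Ω.atOne
  have hA : ∀ i x y, A i x y = Ω.atOne x y • EuclideanSpace.single i (1 : ℝ) := fun i x y ↦ rfl
  have hAi : ∀ (x : Fin r → E) y k, (∑ i, A i (x i) y) k = Ω.atOne (x k) y := fun x y k ↦ by
    simp [hA, Pi.single_apply]
  have hd : ∀ i σ, MDifferentiableAt 𝓘(ℝ, E) 𝓘(ℝ, E) (fun τ : G ↦ adInv (E := E) τ (b i)) σ :=
    fun i ↦ (contMDiff_adInv (b i)).mdifferentiable (by simp)
  let g : Fin r → G → E →L[ℝ] EuclideanSpace ℝ (Fin r) := fun i σ ↦ A i (adInv σ (b i))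
  have hg : ∀ i σ, MDifferentiableAt 𝓘(ℝ, E) 𝓘(ℝ, E →L[ℝ] EuclideanSpace ℝ (Fin r)) (g i) σ :=
    fun i σ ↦ ((A i).mdifferentiableAt (x := adInv σ (b i))).comp σ (hd i σ)
  have hg' : ∀ i σ (u : TangentSpace 𝓘(ℝ, E) σ), mvfderiv 𝓘(ℝ, E) (g i) σ u =
      A i (-bracketCLM E G (toLieAlgebra (E := E) σ u) (adInv σ (b i))) := fun i σ u ↦ by
    have h1 := mfderiv_comp_apply σ ((A i).mdifferentiableAt (x := adInv σ (b i))) (hd i σ) u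
    have h2 : mfderiv 𝓘(ℝ, E) 𝓘(ℝ, E →L[ℝ] EuclideanSpace ℝ (Fin r)) (A i) (adInv σ (b i)) = A i :=
      (A i).mfderiv_eq
    rw [h2] at h1
    exact h1.trans (congrArg (A i) (mvfderiv_adInv (b i) σ u))
  refine ⟨fun σ ↦ ∑ i, g i σ, fun σ ↦ ?_, fun σ v ↦ ?_, fun σ u y ↦ ?_⟩
  · exact (mvfderiv_finset_sum Finset.univ (fun i ↦ hg i σ) (0 : TangentSpace 𝓘(ℝ, E) σ)).1
  · ext k
    rw [h.mvfderiv_apply, sum_apply]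
    exact (hAi (fun i ↦ adInv σ (b i)) _ k).symm
  · have h1 := (mvfderiv_finset_sum Finset.univ (fun i ↦ hg i σ) u).2
    have h2 := congrArg (fun L : E →L[ℝ] EuclideanSpace ℝ (Fin r) ↦ L y) h1
    refine h2.trans ?_
    simp only [hg', sum_apply]
    ext k
    refine (hAi (fun i ↦ -bracketCLM E G (toLieAlgebra (E := E) σ u) (adInv σ (b i))) y k).trans ?_
    refine Eq.trans ?_ (hAi (fun i ↦ adInv σ (b i)) _ k).symm
    -- With `z = Ad(σ⁻¹) b_k`: `ω(-[u, z], y) = ω(y, [u, z]) = -ω(uy, z) = ω(z, uy)`.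
    rw [Ω.atOne_swap (adInv σ (b k)), atOne_leftSymCLM, neg_neg, Ω.atOne_swap, map_neg, neg_neg]

end Group

/-! ### Fibres of the momentum map and the Lie algebra of the level subgroup -/

section Group

variable {E : Type*} [NormedAddCommGroup E] [NormedSpace ℝ E] [FiniteDimensional ℝ E]
  {G : Type*} [TopologicalSpace G] [ChartedSpace E G] [Group G]
  [LieGroup 𝓘(ℝ, E) ∞ G]
  {Ω : SymplecticForm E G} {r : ℕ} {b : Fin r → E} {J : G → EuclideanSpace ℝ (Fin r)}

/-- The fibers of a momentum map are the cosets of a subgroup. -/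
lemma IsMomentum.exists_subgroup [ConnectedSpace G] (h : IsMomentum Ω b J)
    (hS : IsAdInvariant G (Submodule.span ℝ (Set.range b))) :
    ∃ K : Subgroup G, (∀ g, g ∈ K ↔ J g = 0) ∧ ∀ a b, J a = J b ↔ a⁻¹ * b ∈ K := by
  -- The cocycle identity makes the relation `J a = J b` invariant under left translation; the
  -- subgroup axioms and the description of the fibres are translates of suitable equalities.
  have key : ∀ g a b, J a = J b → J (g * a) = J (g * b) := fun g a b hab ↦ by
    obtain ⟨A, hA⟩ := h.exists_cocycle hS g
    rw [hA, hA, hab]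
  refine ⟨{ carrier := {g | J g = 0}, one_mem' := h.map_one, mul_mem' := ?_, inv_mem' := ?_ },
    fun g ↦ Iff.rfl, fun a b ↦ ?_⟩
  · intro a b ha hb
    have := key a b 1 (Eq.trans hb h.map_one.symm)
    rw [mul_one] at this
    exact this.trans ha
  · intro a ha
    have := key a⁻¹ a 1 (Eq.trans ha h.map_one.symm)
    rw [mul_one, inv_mul_cancel, h.map_one] at this
    exact this.symm
  · constructor
    · intro hab
      have := key a⁻¹ a b hab
      rw [inv_mul_cancel, h.map_one] at this
      exact this.symm
    · intro hab
      have := key a (a⁻¹ * b) 1 (Eq.trans hab h.map_one.symm)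
      rw [mul_inv_cancel_left, mul_one] at this
      exact this.symm

/-- `Ad`-invariance of the span propagates the description of the kernel of `dJ` from the unit to
all points. -/
lemma IsMomentum.mvfderiv_eq_zero (h : IsMomentum Ω b J)
    (hS : IsAdInvariant G (Submodule.span ℝ (Set.range b))) {σ : G} {v : TangentSpace 𝓘(ℝ, E) σ}
    (hv : ∀ x ∈ Submodule.span ℝ (Set.range b), Ω.atOne (toLieAlgebra (E := E) σ v) x = 0) :
    mvfderiv 𝓘(ℝ, E) J σ v = 0 := by
  ext i
  rw [h.mvfderiv_apply, Ω.atOne_swap, hv _ (hS σ _ (Submodule.subset_span ⟨i, rfl⟩))]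
  simp

variable {D : Type*} [NormedAddCommGroup D] [NormedSpace ℝ D] [FiniteDimensional ℝ D]
  {F : Type*} [NormedAddCommGroup F] [NormedSpace ℝ F]

/-- The Lie algebra of a level subgroup. -/
lemma mem_iff_exists_mfderiv_val_eq {J : G → F} (hJ : ContMDiff 𝓘(ℝ, E) 𝓘(ℝ, F) ∞ J)
    {S : Submodule ℝ E} (hS : ∀ v : E, v ∈ S ↔ mvfderiv 𝓘(ℝ, E) J (1 : G) v = 0)
    (hdim : Module.finrank ℝ D = Module.finrank ℝ S) {K : Subgroup G} [ChartedSpace D K]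
    (hval : ContMDiff 𝓘(ℝ, D) 𝓘(ℝ, E) ∞ (Subtype.val : K → G))
    (himm : Function.Injective (mfderiv 𝓘(ℝ, D) 𝓘(ℝ, E) (Subtype.val : K → G) 1))
    (hKJ : ∀ x : K, J x = 0) (v : E) :
    v ∈ S ↔ ∃ w : D, (mfderiv 𝓘(ℝ, D) 𝓘(ℝ, E) (Subtype.val : K → G) 1 w : E) = v := by
  obtain ⟨T, hT⟩ : ∃ T : D →L[ℝ] E, ∀ w, T w = mfderiv 𝓘(ℝ, D) 𝓘(ℝ, E) (Subtype.val : K → G) 1 w :=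
    ⟨mfderiv 𝓘(ℝ, D) 𝓘(ℝ, E) (Subtype.val : K → G) 1, fun _ ↦ rfl⟩
  have hTinj : Function.Injective T := fun v w h ↦ himm ((hT v).symm.trans (h.trans (hT w)))
  have hle : LinearMap.range T.toLinearMap ≤ S := by
    rintro _ ⟨w, rfl⟩
    refine (hS _).2 ?_
    have h1 := mvfderiv_comp_of_eq' (n := (1 : K)) (hJ.mdifferentiable (by simp) 1)
      (hval.mdifferentiable (by simp) 1) rfl w
    have h2 : J ∘ (Subtype.val : K → G) = fun _ ↦ 0 := funext hKJ
    rw [h2, mvfderiv_const] at h1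
    exact (congrArg (fun u : E ↦ mvfderiv 𝓘(ℝ, E) J (1 : G) u) (hT w)).trans h1.symm
  have heq : LinearMap.range T.toLinearMap = S :=
    Submodule.eq_of_le_of_finrank_eq hle (by rw [LinearMap.finrank_range_of_inj hTinj, hdim])
  rw [← heq]
  exact ⟨fun ⟨w, hw⟩ ↦ ⟨w, (hT w).symm.trans hw⟩, fun ⟨w, hw⟩ ↦ ⟨w, (hT w).trans hw⟩⟩

end Group

end SympLie

/-! ### The main theorem -/

theorem theorem2p4
    {E : Type*} [NormedAddCommGroup E] [NormedSpace ℝ E] [FiniteDimensional ℝ E]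
    {G : Type*} [TopologicalSpace G] [ChartedSpace E G] [Group G] [LieGroup 𝓘(ℝ, E) ∞ G]
    [ConnectedSpace G]
    (Ω : SymplecticForm E G) (hΩ : Ω.IsLeftInvariant)
    (H : Subgroup G) (𝔥 : Submodule ℝ (GroupLieAlgebra 𝓘(ℝ, E) G))
    (hH : IsConnectedLieSubgroup H 𝔥) (hnormal : H.Normal) (hnontrivial : H ≠ ⊥)
    (hHam : IsHamiltonian Ω 𝔥) :
    -- `∇⁺` is a left invariant affine structure on `G`
    IsAffineStructure (canonicalConnection Ω) ∧
    IsLeftInvariantConnection (canonicalConnection Ω) ∧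
    -- `K` is `H^⊥`, the connected Lie subgroup with Lie algebra the orthogonal of `𝔥`
    ∃ K : Subgroup G,
      IsConnectedLieSubgroup K (orthogonal Ω 𝔥) ∧
      (∀ K' : Subgroup G, IsConnectedLieSubgroup K' (orthogonal Ω 𝔥) → K' = K) ∧
      -- it is closed
      IsClosed (K : Set G) ∧
      -- with the subspace topology it is a Lie group, immersed in `G` with Lie algebra `𝔥^⊥`,
      -- with a left invariant affine structure for which the inclusion is affine
      (∃ (k : ℕ) (_ : ChartedSpace (EuclideanSpace ℝ (Fin k)) K)
          (_ : LieGroup 𝓘(ℝ, EuclideanSpace ℝ (Fin k)) ∞ K),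
        ContMDiff 𝓘(ℝ, EuclideanSpace ℝ (Fin k)) 𝓘(ℝ, E) ∞ (Subtype.val : K → G) ∧
        (∀ x : K, Function.Injective
          (mfderiv 𝓘(ℝ, EuclideanSpace ℝ (Fin k)) 𝓘(ℝ, E) (Subtype.val : K → G) x)) ∧
        (∀ v : GroupLieAlgebra 𝓘(ℝ, E) G, v ∈ orthogonal Ω 𝔥 ↔
          ∃ w : GroupLieAlgebra 𝓘(ℝ, EuclideanSpace ℝ (Fin k)) K,
            mfderiv 𝓘(ℝ, EuclideanSpace ℝ (Fin k)) 𝓘(ℝ, E) (Subtype.val : K → G) 1 w = v) ∧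
        ∃ covK : FieldOperator (EuclideanSpace ℝ (Fin k)) K,
          IsAffineStructure covK ∧ IsLeftInvariantConnection covK ∧
          IsAffineMap covK (canonicalConnection Ω) (Subtype.val : K → G)) ∧
      -- `G ⧸ K` is a smooth manifold, with the structure that makes the projection a submersion
      (∃ (r : ℕ) (_ : ChartedSpace (EuclideanSpace ℝ (Fin r)) (G ⧸ K))
          (_ : IsManifold 𝓘(ℝ, EuclideanSpace ℝ (Fin r)) ∞ (G ⧸ K)),
        ContMDiff 𝓘(ℝ, E) 𝓘(ℝ, EuclideanSpace ℝ (Fin r)) ∞ (QuotientGroup.mk : G → G ⧸ K) ∧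
        (∀ σ : G, Function.Surjective
          (mfderiv 𝓘(ℝ, E) 𝓘(ℝ, EuclideanSpace ℝ (Fin r)) (QuotientGroup.mk : G → G ⧸ K) σ)) ∧
        -- with a commutative parallelism `X`, the affine structure in which `X` is parallel,
        -- and the projection is affine
        ∃ X : Fin r → Π q : G ⧸ K, TangentSpace 𝓘(ℝ, EuclideanSpace ℝ (Fin r)) q,
          IsCommutativeParallelism X ∧
          ∃ covQ : FieldOperator (EuclideanSpace ℝ (Fin r)) (G ⧸ K),
            IsAffineStructure covQ ∧ (∀ i q, covQ (X i) q = 0) ∧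
            IsAffineMap (canonicalConnection Ω) covQ (QuotientGroup.mk : G → G ⧸ K)) := by
  have _ : CompleteSpace E := FiniteDimensional.complete ℝ E
  have _ : IsTopologicalGroup G := topologicalGroup_of_lieGroup 𝓘(ℝ, E) ∞
  have _ : T2Space G := t2Space_of_lieGroup E G
  refine ⟨hΩ.isAffineStructure, isLeftInvariantConnection_frameConnection (leftSymCLM Ω), ?_⟩
  obtain ⟨S, rfl⟩ : ∃ S : Submodule ℝ E, S = 𝔥 := ⟨𝔥, rfl⟩
  obtain ⟨S', hS'⟩ : ∃ S' : Submodule ℝ E, S' = orthogonal Ω S := ⟨_, rfl⟩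
  obtain ⟨r, hr⟩ : ∃ r, r = Module.finrank ℝ S := ⟨_, rfl⟩
  let b₀ := Module.finBasisOfFinrankEq ℝ S hr.symm
  let b : Fin r → E := fun i ↦ (b₀ i : E)
  have hbli : LinearIndependent ℝ b :=
    b₀.linearIndependent.map' (Submodule.subtype S) (Submodule.ker_subtype _)
  have hbspan : Submodule.span ℝ (Set.range b) = S := by
    have h1 : Set.range b = (Submodule.subtype S) '' Set.range b₀ := by
      rw [← Set.range_comp]; rfl
    rw [h1, Submodule.span_image, b₀.span_eq, Submodule.map_top, Submodule.range_subtype]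
  have hAd : IsAdInvariant G (Submodule.span ℝ (Set.range b)) := by
    rw [hbspan]; exact hH.isAdInvariant hnormal
  obtain ⟨J, hJ⟩ := hHam.exists_isMomentum hΩ b fun i ↦ (b₀ i).2
  have hS : ∀ v : E, v ∈ S' ↔ mvfderiv 𝓘(ℝ, E) J (1 : G) v = 0 := fun v ↦ by
    refine Iff.trans ?_ (hJ.mvfderiv_one_eq_zero_iff v).symm
    rw [hbspan, hS']
    rfl
  obtain ⟨k, hk⟩ : ∃ k, k = Module.finrank ℝ S' := ⟨_, rfl⟩
  subst hS'
  obtain ⟨K₀, hK₀, hJK₀⟩ := hJ.exists_subgroup hAd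
  obtain ⟨e, p, he, hp, hopen⟩ := exists_isSubgroupChart (D := EuclideanSpace ℝ (Fin k))
    hJ.contMDiff (hJ.surjective_mvfderiv hbli 1) hS (by rw [finrank_euclideanSpace_fin, hk]) hK₀
  have hclosed : IsClosed (K₀ : Set G) := by
    have h1 : (K₀ : Set G) = J ⁻¹' {0} := Set.ext hK₀
    rw [h1]
    exact isClosed_singleton.preimage hJ.contMDiff.continuous
  have _ : ConnectedSpace (identityComponent K₀) := connectedSpace_identityComponent K₀
  obtain ⟨i1, i2, hval, himm⟩ := he.exists_lieGroup
  have hrange := mem_iff_exists_mfderiv_val_eq hJ.contMDiff hS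
    (by rw [finrank_euclideanSpace_fin, hk]) hval (himm 1)
    (fun x ↦ (hK₀ _).1 (identityComponent_le K₀ x.2))
  refine ⟨identityComponent K₀, ?_, fun K' hK' ↦ ?_, isClosed_identityComponent hclosed,
    ⟨k, i1, i2, hval, himm, hrange, ?_⟩, ?_⟩
  · exact ⟨k, identityComponent K₀, inferInstance, i1, inferInstance, i2,
      (identityComponent K₀).subtype, inferInstance, Subtype.val_injective,
      (identityComponent K₀).range_subtype, hval, himm, hrange⟩
  · refine hK'.eq_identityComponent hJ.contMDiff (fun σ v hv ↦ ?_) hK₀ he hp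
    exact hJ.mvfderiv_eq_zero hAd fun x hx ↦ hv x (by rw [hbspan] at hx; exact hx)
  · refine hΩ.exists_isAffineMap (identityComponent K₀).subtype hval (himm 1) fun x y ↦ ?_
    -- `ω(xy, z) = -ω(y, [x, z])` vanishes: `[x, z]` lies in the ideal `𝔥`, and `y` is orthogonal to
    -- it.
    refine (hrange _).1 fun z hz ↦ ?_
    refine (atOne_leftSymCLM Ω _ _ z).trans (neg_eq_zero.2 ?_)
    refine (hrange _).2 ⟨y, rfl⟩ _ ?_
    have h1 := hAd.bracket_mem (x := z) (by rw [hbspan]; exact hz)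
      (mfderiv 𝓘(ℝ, EuclideanSpace ℝ (Fin k)) 𝓘(ℝ, E)
        (Subtype.val : identityComponent K₀ → G) 1 x : E)
    rw [hbspan] at h1
    exact h1
  · obtain ⟨j1, j2, f, hf, hfJ⟩ := exists_isManifold_quotient hJ.contMDiff.continuous
      (isOpenMap_of_surjective_mvfderiv hJ.contMDiff (hJ.surjective_mvfderiv hbli))
      hJK₀ (identityComponent_le K₀) hopen
    have hfJ' : f ∘ (QuotientGroup.mk : G → G ⧸ identityComponent K₀) = J := funext hfJ
    have hmk : ContMDiff 𝓘(ℝ, E) 𝓘(ℝ, EuclideanSpace ℝ (Fin r)) ∞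
        (QuotientGroup.mk : G → G ⧸ identityComponent K₀) :=
      contMDiff_of_comp_chartAt_eq hf QuotientGroup.continuous_mk (by rw [hfJ']; exact hJ.contMDiff)
    have hθ := isCoframe_of_chartAt_eq hf
    have hchain : ∀ σ (v : TangentSpace 𝓘(ℝ, E) σ), mvfderiv 𝓘(ℝ, E) J σ v =
        mvfderiv 𝓘(ℝ, EuclideanSpace ℝ (Fin r)) f (σ : G ⧸ identityComponent K₀)
          (mfderiv 𝓘(ℝ, E) 𝓘(ℝ, EuclideanSpace ℝ (Fin r))
            (QuotientGroup.mk : G → G ⧸ identityComponent K₀) σ v) := fun σ v ↦ by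
      have h1 := mfderiv_comp_apply σ
        ((contMDiff_of_chartAt_eq hf).mdifferentiable (by simp) (σ : G ⧸ identityComponent K₀))
        (hmk.mdifferentiable (by simp) σ) v
      rw [hfJ'] at h1
      exact h1
    refine ⟨r, j1, j2, hmk, fun σ w ↦ ?_, _,
      hθ.isCommutativeParallelism (EuclideanSpace.basisFun (Fin r) ℝ).toBasis, _,
      hθ.isAffineStructure_zero, fun i q ↦ hθ.frameConnection_zero_apply _ q, ?_⟩
    -- `dJ` is surjective and factors through the derivative of the projection, followed by the
    -- injective `df`.
    · obtain ⟨v, hv⟩ := hJ.surjective_mvfderiv hbli σ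
        (mvfderiv 𝓘(ℝ, EuclideanSpace ℝ (Fin r)) f (σ : G ⧸ identityComponent K₀) w)
      exact ⟨v, hθ.injective _ ((hchain σ v).symm.trans hv)⟩
    -- In the coframe `df` the projection has the same derivative `T` as `J`. The Christoffel
    -- symbols of the quotient being zero, the equation for an affine map is exactly `hT`.
    · obtain ⟨T, hTd, hTJ, hT⟩ := hJ.exists_mvfderiv_eq
      rw [canonicalConnection_eq_frameConnection]
      refine isCoframe_toLieAlgebra.isAffineMap hθ (leftSymCLM Ω) 0 hmk T hTd
        (fun σ v ↦ (hchain σ v).symm.trans (hTJ σ v)) fun σ u y ↦ ?_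
      rw [hT]
      simp
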